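/- **Model.** There are $n\ge 2$ processors $p_1,\dots,p_n$ with $n\ge 4f+1$; at most $f$ of them ever become corrupted (and may behave arbitrarily), the others are called correct. Time is divided into timeslots $t\in\mathbb N$. Messages travel over authenticated point-to-point channels; a message sent at $t$ arrives at some $t'$ with $t<t'\le\max\{\mathrm{GST},t\}+\Delta$, where $\Delta\ge 1$ is known and $\mathrm{GST}$ and the delays are chosen by the adversary. A message to oneself is received immediately. Each correct processor begins at some timeslot $\le\mathrm{GST}$. Signatures, threshold signatures and the hash function $H$ are perfect (unforgeable, resp. injective). Local computation takes no time: at every timeslot a correct processor carries out the instructions below, in order and repeatedly until they have no further effect, on the messages received so far. "Disseminate" means send to all. **Views.** Let $x\ge 2$. Superview $w\ge1$ consists of the views $(w-1)x+1,\dots,wx$ and has leader $p_{j+1}$, $j\equiv w \bmod n$, $0\le j<n$; $\mathrm{lead}(v)$ is the leader of the superview of $v$. View $v$ is *initial* if $v\equiv1\bmod x$. **Blocks.** A payload $C$ is encoded by an $(n,k)$-erasure code into $c_1,\dots,c_n$ (any $k$ of which, with $|C|$, determine $C$); the tag is $\tau(C,k)=(|C|,k,r)$ with $r$ the root of a Merkle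 tree over the $c_j$. A block is a triple $b=(v,\tau,h)$ signed by $\mathrm{lead}(v)$, with $v\ge1$ (its view), $h$ the hash of its parent and $k\in[n-f-1,n-1]$ the second entry of $\tau$; the genesis block is $b_{\rm gen}=(0,\tau(\lambda,n),\lambda)$, $\lambda$ the empty string. A certified fragment $(b,j,c,\pi)$ of $b$ at $j$ has $c$ of the correct length and $\pi$ a validation path from $r$ to $c$ at position $j$. Decoding $k$ certified fragments gives $\bot$ if reconstruction fails or the result does not have the tag of $b$. A stage-1 notarisation for $b$ is a set of at least $n-\frac32f$ stage-1 votes for $b$ by distinct processors. Stage-2 votes carry threshold signature shares: $f+1$ of them for $b$ form a stage-2 M-certificate, $n-f$ a stage-2 certificate for $b$; $2f+1$ $\mathrm{nullify}(v)$ messages form an N-certificate for $v$. A processor that receives enough shares forms the certificate; this counts as receiving it. **Local variables of a processor.** Its view $\mathtt v$ (initially 1); a block $\mathtt b$ (initially $b_{\rm gen}$); a timer $\mathtt T$ (initially 0, increasing by one per timeslot); flags $1\mathtt{voted}(v),2\mathtt{voted}(v),\mathtt{nullified}(v),\mathtt{oprop}(v),\mathtt{2ndpropose}(w)$ (initially false);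 a block $\mathtt{opar}$ (initially $b_{\rm gen}$). $\mathtt{blocks}$ contains $b_{\rm gen}$ and every block for which it has an M-certificate and whose parent is in $\mathtt{blocks}$. $\mathtt{blocks}^*$ contains $b_{\rm gen}$ and every block $b$ with parent in $\mathtt{blocks}$ for which it has received a stage-1 notarisation and, for some $k$ indices $j$ ($k$ from the tag of $b$), from $p_j$ a certified fragment of $b$ at $j$, the fragments not decoding to $\bot$. **Votable.** A certified fragment at $i$, received by $p_i$, of a view $v$ block $b$ is *votable for view $v$* if there is $b'$ with $H(b')$ the parent hash of $b$ and $b'.\mathrm{view}<v$ such that $p_i$ has N-certificates for all views strictly between $b'.\mathrm{view}$ and $v$, and either (a) $v$ is not initial and $b'\in\mathtt{blocks}$; or (b) $v$ is initial and $b'$ was in $\mathtt{blocks}$ when $p_i$ entered $v$; or (c) $v$ is initial, $p_i$ has received $(\mathrm{release},b)$ from $\mathrm{lead}(v)$, and $b'\in\mathtt{blocks}$. **Instructions for $p_i$ at every timeslot.** 1. Disseminate every N-certificate, stage-2 certificate and M-certificate that it did not have at an earlier timeslot. 2. If it has a votable fragment for $\mathtt v$, of block $b$ say, and $1\mathtt{voted}(\mathtt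 v)$ is false: set $1\mathtt{voted}(\mathtt v)$ true, disseminate a stage-1 vote for $b$ and, if $p_i\ne\mathrm{lead}(\mathtt v+1)$, the fragment; if $p_i=\mathrm{lead}(\mathtt v+1)$ and $\mathtt v+1$ is initial, set $\mathtt{oprop}(\mathtt v+1)$ true and $\mathtt{opar}:=b$. 3. If $\mathtt v$ is initial (in superview $w$), $p_i=\mathrm{lead}(\mathtt v)$, $\mathtt{oprop}(\mathtt v)$ is true and $\mathtt T=2\Delta$: if $\mathtt{opar}\in\mathtt{blocks}$, disseminate $(\mathrm{release},b)$ for the view $\mathtt v$ block $b$ it proposed; otherwise set $\mathtt{2ndpropose}(w)$ true. 4. Let $w$ be the superview of $\mathtt v+1$, and let "recently" mean since $\mathtt{2ndpropose}(w)$ took its current value. *Case 1:* $\mathtt v+1$ is initial, $p_i=\mathrm{lead}(\mathtt v+1)$, $p_i$ has a votable fragment for $\mathtt v$ and has not proposed for view $\mathtt v+1$: propose a view $\mathtt v+1$ block with parent $\mathtt{opar}$. *Case 2:* $\mathtt v$ is initial, $p_i=\mathrm{lead}(\mathtt v)$ and $p_i$ has not recently proposed for $\mathtt v$: propose a view $\mathtt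 v$ block $b$ with parent $\mathtt b$ and disseminate $(\mathrm{release},b)$. *Case 3:* $\mathtt v+1$ is not initial, $p_i=\mathrm{lead}(\mathtt v+1)$ and $p_i$ has recently proposed for some but not all views of $w$: it may (at times left open) propose, for the view after the last one it recently proposed for, a block whose parent is that last block. Proposing a block means choosing a payload (arbitrarily) and $k\in[n-f-1,n-1]$ as a function of the received messages and the view, with $k=n-f-1$ in initial views, and sending each $p_j$ the certified fragment at $j$. 5. If $\mathtt{blocks}^*$ contains a view $\mathtt v$ block $b$ and $\mathtt{nullified}(\mathtt v)$, $2\mathtt{voted}(\mathtt v)$ are false: set $2\mathtt{voted}(\mathtt v)$ true and disseminate a stage-2 vote for $b$. 6. If $\mathtt{blocks}$ contains a view $\mathtt v$ block $b$: if $\mathtt{nullified}(\mathtt v)$, $2\mathtt{voted}(\mathtt v)$ are false, set $2\mathtt{voted}(\mathtt v)$ true and disseminate a stage-2 vote for $b$; then set $\mathtt b:=b$, $\mathtt v:=\mathtt v+1$, $\mathtt T:=0$. 7. If $\mathtt{nullified}(\mathtt v)$ is false and a time-out applies, then for all $v\ge\mathtt v$ in the superview of $\mathtt v$ set $\mathtt{nullified}(v)$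 true and disseminate $\mathrm{nullify}(v)$. Time-outs for non-initial $\mathtt v$: $\mathtt T=\Delta$ and no stage-1 or stage-2 vote yet sent in view $\mathtt v$; $\mathtt T=2\Delta$ and no stage-2 vote. For initial $\mathtt v$: $\mathtt T=2\Delta$ and no certified fragment of any view $\mathtt v$ block received; $\mathtt T=4\Delta$ and no stage-1 or stage-2 vote; $\mathtt T=5\Delta$ and no stage-2 vote. 8. If it has an N-certificate for $\mathtt v$: set $\mathtt v:=\mathtt v+1$, $\mathtt T:=0$. **Lemma (Correct leaders finalise blocks, with optimistic proposals).** Suppose view $v$ is initial, $\mathrm{lead}(v)$ is correct, and the first correct processor to enter view $v$ does so at $t\ge\mathrm{GST}$. Then there is a view $v$ block for which all correct processors receive a stage-2 certificate by $t+6\Delta$; all correct processors enter view $v+1$ by $t+6\Delta$; and no correct processor ever disseminates a $\mathrm{nullify}(v)$ message. -/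

import Mathlib

namespace Carnot

/-! ### Parameters, views and leaders -/

/-- `n` processors, at most `f` of them faulty, superviews of `x` views, known delay bound `Δ`.
`2 ≤ n` makes the smallest reconstruction parameter `n - f - 1` a legal one (at least `1`), and
`1 ≤ Δ` is forced by messages taking at least one timeslot. -/
structure Params where
  n : ℕ
  f : ℕ
  x : ℕ
  Δ : ℕ
  four_mul_f_lt : 4 * f + 1 ≤ n
  two_le_n : 2 ≤ n
  two_le_x : 2 ≤ x
  one_le_Δ : 1 ≤ Δ

/-- Processors; the element `j` of `Fin n` is the processor written `p_{j+1}`. -/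
abbrev Params.Proc (P : Params) : Type := Fin P.n

/-- The superview of a view `v ≥ 1`: superview `w` is the interval `[(w-1)x+1, (w-1)x+x]`. -/
def Params.superview (P : Params) (v : ℕ) : ℕ := (v - 1) / P.x + 1

/-- `v ≡ 1 mod x`. -/
def Params.Initial (P : Params) (v : ℕ) : Prop := v ≡ 1 [MOD P.x]

/-- The leader of a view in superview `w` is `p_{j+1}` with `j ≡ w mod n`. -/
def Params.lead (P : Params) (v : ℕ) : P.Proc :=
  ⟨P.superview v % P.n, Nat.mod_lt _ (lt_of_lt_of_le Nat.zero_lt_two P.two_le_n)⟩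

/-! ### Blocks, hashing, erasure codes and Merkle trees -/

/-- Bit strings: payloads, fragments and hash values. -/
abbrev Bits : Type := List Bool

/-- A tag `(β, k, r)`. -/
structure Tag where
  len : ℕ
  k : ℕ
  root : Bits

/-- A tuple `(v, tag, hash of the parent)`. The signature of the leader of view `v` is
accounted for by the unforgeability clause `Execution.block_signature`. -/
structure Block where
  view : ℕ
  tag : Tag
  par : Bits

/-- The inputs of the hash function: blocks, leaves of a Merkle tree, inner nodes of one. -/
inductive HashInput where
  | block (b : Block)
  | leaf (c : Bits)
  | node (l r : Bits)

/-- For each `k ∈ [1,n]` an `(n,k)`-erasure code: all fragments of a string of length `β` have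
the same length `fragLen k β`, and any `k` fragments together with `β` determine the string.
Nothing is said about `reconstruct` on other inputs; `none` is a failure. -/
structure ErasureCode (n : ℕ) where
  fragLen : ℕ → ℕ → ℕ
  encode : ℕ → Bits → Fin n → Bits
  reconstruct : ℕ → ℕ → (I : Finset (Fin n)) → (I → Bits) → Option Bits
  length_encode : ∀ k, 1 ≤ k → k ≤ n → ∀ C i, (encode k C i).length = fragLen k C.length
  reconstruct_encode : ∀ k, 1 ≤ k → k ≤ n → ∀ (C : Bits) (I : Finset (Fin n)),
    I.card = k → (reconstruct k C.length I fun i => encode k C i) = some C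

/-- Message types. Signatures and threshold signatures are symbolic. -/
inductive Msg (n : ℕ) where
  /-- `(b, j, c, π)` -/
  | frag (b : Block) (j : Fin n) (c : Bits) (π : List Bits)
  /-- the stage-1 vote for `b` signed by `i` -/
  | vote1 (b : Block) (i : Fin n)
  /-- the stage-2 vote for `b` by `i`, with its two signature shares -/
  | vote2 (b : Block) (i : Fin n)
  /-- the `nullify(v)` message by `i`, with its signature share -/
  | nullify (v : ℕ) (i : Fin n)
  /-- an N-certificate for `v`: a `(2f+1)`-of-`n` threshold certificate -/
  | nCert (v : ℕ)
  /-- a stage-2 M-certificate for `b`: an `(f+1)`-of-`n` threshold certificate -/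
  | mCert (b : Block)
  /-- a stage-2 certificate for `b`: an `(n-f)`-of-`n` threshold certificate -/
  | cert (b : Block)
  /-- `(release, b)` -/
  | release (b : Block)

/-- The processor whose individual signature (share) a message carries. -/
def Msg.signer {n : ℕ} : Msg n → Option (Fin n)
  | .vote1 _ i => some i
  | .vote2 _ i => some i
  | .nullify _ i => some i
  | _ => none

/-- The block that a message is about. -/
def Msg.block {n : ℕ} : Msg n → Option Block
  | .frag b _ _ _ => some b
  | .vote1 b _ => some b
  | .vote2 b _ => some b
  | .mCert b => some b
  | .cert b => some b
  | .release b => some b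
  | .nullify _ _ => none
  | .nCert _ => none

/-- A set of received messages, each with the processor it was received from
(channels are authenticated). -/
abbrev Params.Inbox (P : Params) : Type := Set (P.Proc × Msg P.n)

/-- What the protocol is run with: a perfectly collision resistant hash function, erasure codes,
and the rule `g` by which leaders choose the reconstruction parameter. -/
structure Setup (P : Params) where
  H : HashInput → Bits
  H_injective : Function.Injective H
  code : ErasureCode P.n
  g : P.Inbox → ℕ → ℕ
  g_lower : ∀ S v, P.n - P.f - 1 ≤ g S v
  g_upper : ∀ S v, g S v ≤ P.n - 1
  g_initial : ∀ S v, P.Initial v → g S v = P.n - P.f - 1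

namespace Setup

variable {P : Params} (K : Setup P)

/-- The root of the Merkle tree of depth `d` with leaves `L 0, …, L (2 ^ d - 1)`. -/
def merkleRoot : ℕ → (ℕ → Bits) → Bits
  | 0, L => L 0
  | d + 1, L => K.H (.node (merkleRoot d L) (merkleRoot d fun i => L (i + 2 ^ d)))

/-- The siblings on the path from the root to leaf `i`, from top to bottom. -/
def merklePath : ℕ → (ℕ → Bits) → ℕ → List Bits
  | 0, _, _ => []
  | d + 1, L, i =>
      if i < 2 ^ d then K.merkleRoot d (fun j => L (j + 2 ^ d)) :: merklePath d L i
      else K.merkleRoot d L :: merklePath d (fun j => L (j + 2 ^ d)) (i - 2 ^ d)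

/-- The root computed from the hash `h` at position `i` and its siblings, listed from top to
bottom. -/
def rootOfPath : List Bits → ℕ → Bits → Bits
  | [], _, h => h
  | s :: π, i, h =>
      if i < 2 ^ π.length then K.H (.node (rootOfPath π i h) s)
      else K.H (.node s (rootOfPath π (i - 2 ^ π.length) h))

/-- The depth of a Merkle tree with at least `n` leaves. -/
def depth (P : Params) : ℕ := Nat.clog 2 P.n

/-- `π` is a validation path from `r` to `c` at position `i`. -/
def ValidPath (r c : Bits) (i : P.Proc) (π : List Bits) : Prop :=
  π.length = depth P ∧ K.rootOfPath π i (K.H (.leaf c)) = r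

/-- The leaves of the Merkle tree for the fragments of `C`: their hashes, padded up to a power
of two. -/
def leaves (C : Bits) (k : ℕ) (i : ℕ) : Bits :=
  if h : i < P.n then K.H (.leaf (K.code.encode k C ⟨i, h⟩)) else K.H (.leaf [])

/-- The tag `τ(C, k)`. -/
def tag (C : Bits) (k : ℕ) : Tag := ⟨C.length, k, K.merkleRoot (depth P) (K.leaves C k)⟩

/-- The validation path that `Encode(C, k)` attaches to the fragment at `i`. -/
def path (C : Bits) (k : ℕ) (i : P.Proc) : List Bits :=
  K.merklePath (depth P) (K.leaves C k) i

/-- `(c, π)` is a certified fragment of the tag `z` at `i`. -/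
def Certified (z : Tag) (i : P.Proc) (c : Bits) (π : List Bits) : Prop :=
  c.length = K.code.fragLen z.k z.len ∧ K.ValidPath z.root c i π

open Classical in
/-- `Decode`; `none` stands for `⊥`. -/
noncomputable def decode (z : Tag) (I : Finset P.Proc) (c : I → Bits) : Option Bits :=
  match K.code.reconstruct z.k z.len I c with
  | none => none
  | some C => if K.tag C z.k = z then some C else none

/-- The genesis block `(0, τ(λ, n), λ)`. -/
def genesis : Block := ⟨0, K.tag [] P.n, []⟩

end Setup

/-- The format of a block other than the genesis block. -/
def Params.IsBlock (P : Params) (b : Block) : Prop :=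
  1 ≤ b.view ∧ P.n - P.f - 1 ≤ b.tag.k ∧ b.tag.k ≤ P.n - 1

/-! ### Quantities determined by the received messages -/

namespace Params

variable (P : Params)

/-- `m` has been received (from any processor). -/
def Received (S : P.Inbox) (m : Msg P.n) : Prop := ∃ q, (q, m) ∈ S

/-- `certificates` contains an N-certificate for `v`. -/
def HasN (S : P.Inbox) (v : ℕ) : Prop :=
  P.Received S (.nCert v) ∨
    ∃ Q : Finset P.Proc, Q.card = 2 * P.f + 1 ∧ ∀ i ∈ Q, P.Received S (.nullify v i)

/-- `certificates` contains a stage-2 M-certificate for `b`. -/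
def HasM (S : P.Inbox) (b : Block) : Prop :=
  P.Received S (.mCert b) ∨
    ∃ Q : Finset P.Proc, Q.card = P.f + 1 ∧ ∀ i ∈ Q, P.Received S (.vote2 b i)

/-- `certificates` contains a stage-2 certificate for `b`. -/
def HasCert (S : P.Inbox) (b : Block) : Prop :=
  P.Received S (.cert b) ∨
    ∃ Q : Finset P.Proc, Q.card = P.n - P.f ∧ ∀ i ∈ Q, P.Received S (.vote2 b i)

/-- A stage-1 notarisation for `b`, at least `n - (3/2) f` stage-1 votes, has been received. -/
def HasNotarisation (S : P.Inbox) (b : Block) : Prop :=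
  ∃ Q : Finset P.Proc, 2 * P.n ≤ 2 * Q.card + 3 * P.f ∧ ∀ i ∈ Q, P.Received S (.vote1 b i)

end Params

namespace Setup

variable {P : Params} (K : Setup P)

/-- The local variable `blocks`. -/
inductive InBlocks (S : P.Inbox) : Block → Prop
  | genesis : InBlocks S K.genesis
  | child (b b' : Block) (hb : P.IsBlock b) (hM : P.HasM S b) (hb' : InBlocks S b')
      (hpar : K.H (.block b') = b.par) : InBlocks S b

/-- The local variable `blocks*`. -/
def InBlocksStar (S : P.Inbox) (b : Block) : Prop :=
  b = K.genesis ∨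
    (P.IsBlock b ∧ P.HasNotarisation S b ∧
      (∃ (I : Finset P.Proc) (c : P.Proc → Bits) (π : P.Proc → List Bits),
        I.card = b.tag.k ∧
        (∀ j ∈ I, (j, Msg.frag b j (c j) (π j)) ∈ S ∧ K.Certified b.tag j (c j) (π j)) ∧
        K.decode b.tag I (fun j => c j) ≠ none) ∧
      ∃ b', K.InBlocks S b' ∧ K.H (.block b') = b.par)

end Setup

/-! ### The local state of a processor -/

structure LocalState (P : Params) where
  /-- all messages received so far -/
  S : P.Inbox
  /-- the value of `S` at the end of the previous timeslot -/
  prevS : P.Inbox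
  /-- messages sent during the present timeslot, each with its addressee -/
  out : Set (P.Proc × Msg P.n)
  /-- the variable `v` -/
  view : ℕ
  /-- the variable `b` -/
  b : Block
  /-- the local timer -/
  T : ℕ
  /-- the value of `blocks` at the moment of entering the present view -/
  entryBlocks : Set Block
  nullified : ℕ → Bool
  voted1 : ℕ → Bool
  voted2 : ℕ → Bool
  secondPropose : ℕ → Bool
  oprop : ℕ → Bool
  opar : Block
  /-- the blocks proposed so far, each with the value that `secondPropose(w)` had when it was
  proposed, for `w` the superview of the block -/
  proposed : Set (Block × Bool)

namespace LocalState

variable {P : Params}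

/-- `p` sends the messages `M` (pairs of an addressee and a message); what it sends to itself is
received immediately. -/
def send (s : LocalState P) (p : P.Proc) (M : Set (P.Proc × Msg P.n)) : LocalState P :=
  { s with
    out := s.out ∪ M
    S := s.S ∪ {y | y.1 = p ∧ (p, y.2) ∈ M} }

/-- `p` sends the messages `M` to all processors. -/
def disseminate (s : LocalState P) (p : P.Proc) (M : Set (Msg P.n)) : LocalState P :=
  s.send p {y | y.2 ∈ M}

/-- The present value of `secondPropose(w)`, where `v + 1` is in superview `w`, `v` being the
present view. -/
def secondNow (s : LocalState P) : Bool := s.secondPropose (P.superview (s.view + 1))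

/-- A view `v'` block of the superview `w` of `v + 1` has been proposed since
`secondPropose(w)` took its current value. -/
def ProposedSince (s : LocalState P) (v' : ℕ) : Prop :=
  ∃ b, (b, s.secondNow) ∈ s.proposed ∧ b.view = v' ∧ P.superview v' = P.superview (s.view + 1)

/-- Enter the next view. -/
def enterNext (K : Setup P) (s : LocalState P) : LocalState P :=
  { s with
    view := s.view + 1
    T := 0
    entryBlocks := {b | K.InBlocks s.S b} }

/-- The start of a new timeslot, at which the set of messages received from other processors
has become `R`. -/
def tick (s : LocalState P) (R : P.Inbox) : LocalState P :=
  { s with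
    S := s.S ∪ R
    prevS := s.S
    out := ∅
    T := s.T + 1 }

/-- The state in which a processor begins; `R` is what it has received by then. -/
def first (K : Setup P) (R : P.Inbox) : LocalState P where
  S := R
  prevS := ∅
  out := ∅
  view := 1
  b := K.genesis
  T := 0
  entryBlocks := {b | K.InBlocks R b}
  nullified := fun _ => false
  voted1 := fun _ => false
  voted2 := fun _ => false
  secondPropose := fun _ => false
  oprop := fun _ => false
  opar := K.genesis
  proposed := ∅

end LocalState

/-! ### The instructions -/

namespace Setup

variable {P : Params} (K : Setup P) (p : P.Proc)

/-- `p` has received the fragment `(b, p, c, π)`, and it is votable for the present view. -/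
def Votable (s : LocalState P) (b : Block) (c : Bits) (π : List Bits) : Prop :=
  P.IsBlock b ∧ b.view = s.view ∧
  P.Received s.S (.frag b p c π) ∧ K.Certified b.tag p c π ∧
  ∃ b' : Block, K.H (.block b') = b.par ∧ b'.view < s.view ∧
    ((¬ P.Initial s.view ∧ K.InBlocks s.S b') ∨
      (P.Initial s.view ∧ b' ∈ s.entryBlocks) ∨
      (P.Initial s.view ∧ (P.lead s.view, Msg.release b) ∈ s.S ∧ K.InBlocks s.S b')) ∧
    ∀ v', b'.view < v' → v' < s.view → P.HasN s.S v'

/-- `p` has received some votable fragment for the present view. -/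
def HasVotable (s : LocalState P) : Prop := ∃ b c π, K.Votable p s b c π

/-- The predicate `TimeoutReady`. -/
def TimeoutReady (s : LocalState P) : Prop :=
  (¬ P.Initial s.view ∧ s.T = P.Δ ∧
    s.voted1 s.view = false ∧ s.voted2 s.view = false) ∨
  (¬ P.Initial s.view ∧ s.T = 2 * P.Δ ∧ s.voted2 s.view = false) ∨
  (P.Initial s.view ∧ s.T = 2 * P.Δ ∧
    ¬ ∃ b j c π, P.IsBlock b ∧ b.view = s.view ∧ P.Received s.S (.frag b j c π) ∧
      K.Certified b.tag j c π) ∨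
  (P.Initial s.view ∧ s.T = 4 * P.Δ ∧
    s.voted1 s.view = false ∧ s.voted2 s.view = false) ∨
  (P.Initial s.view ∧ s.T = 5 * P.Δ ∧ s.voted2 s.view = false)

/-- Case 1 of `ProposeReady`: an optimistic proposal. -/
def ProposeReady1 (s : LocalState P) : Prop :=
  P.Initial (s.view + 1) ∧ p = P.lead (s.view + 1) ∧ K.HasVotable p s ∧
    ¬ ∃ b o, (b, o) ∈ s.proposed ∧ b.view = s.view + 1

/-- Case 2 of `ProposeReady`: the first, or the second, proposal made inside an initial view. -/
def ProposeReady2 (s : LocalState P) : Prop :=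
  P.Initial s.view ∧ p = P.lead s.view ∧ ¬ s.ProposedSince s.view

/-- The necessary condition in Case 3 of `ProposeReady` (later views of a superview). -/
def ProposeReady3 (s : LocalState P) : Prop :=
  ¬ P.Initial (s.view + 1) ∧ p = P.lead (s.view + 1) ∧
    (∃ v', s.ProposedSince v') ∧
    ∃ v', 1 ≤ v' ∧ P.superview v' = P.superview (s.view + 1) ∧ ¬ s.ProposedSince v'

/-- `p` proposes a view `v` block with parent `par` and an arbitrary payload `C`, and releases it
if `rel` holds. -/
def SendBlock (v : ℕ) (par : Block) (rel : Prop) (s s' : LocalState P) : Prop :=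
  ∃ (C : Bits) (k : ℕ) (b : Block),
    k = K.g s.S v ∧ b = ⟨v, K.tag C k, K.H (.block par)⟩ ∧
    s' =
      { s.send p
          ({y | y.2 = Msg.frag b y.1 (K.code.encode k C y.1) (K.path C k y.1)} ∪
            {y | rel ∧ y.2 = Msg.release b}) with
        proposed := insert (b, s.secondPropose (P.superview v)) s.proposed }

open Classical in
/-- The procedure `ProposeBlock`. -/
def ProposeBlock (s s' : LocalState P) : Prop :=
  if P.Initial (s.view + 1) ∧
      ¬ ∃ b o, (b, o) ∈ s.proposed ∧ P.superview b.view = P.superview (s.view + 1) then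
    K.SendBlock p (s.view + 1) s.opar False s s'
  else if P.Initial s.view ∧ ¬ ∃ v', s.ProposedSince v' then
    K.SendBlock p s.view s.b True s s'
  else
    ∃ b', (b', s.secondNow) ∈ s.proposed ∧ P.superview b'.view = P.superview (s.view + 1) ∧
      (∀ v', s.ProposedSince v' → v' ≤ b'.view) ∧
      K.SendBlock p (b'.view + 1) b' False s s'

/-- Disseminate new N-certificates. -/
def disseminateN (s s' : LocalState P) : Prop :=
  s' = s.disseminate p {m | ∃ v, m = .nCert v ∧ P.HasN s.S v ∧ ¬ P.HasN s.prevS v}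

/-- Disseminate new stage-2 certificates and new stage-2 M-certificates. -/
def disseminateM (s s' : LocalState P) : Prop :=
  s' = s.disseminate p
    ({m | ∃ b, m = .cert b ∧ P.HasCert s.S b ∧ ¬ P.HasCert s.prevS b} ∪
      {m | ∃ b, m = .mCert b ∧ P.HasM s.S b ∧ ¬ P.HasM s.prevS b})

open Classical in
/-- Stage-1 voting. -/
def stage1 (s s' : LocalState P) : Prop :=
  if K.HasVotable p s ∧ s.voted1 s.view = false then
    ∃ b c π, K.Votable p s b c π ∧
      s' =
        { s.disseminate p
            ({Msg.vote1 b p} ∪ {m | p ≠ P.lead (s.view + 1) ∧ m = Msg.frag b p c π}) with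
          voted1 := Function.update s.voted1 s.view true
          oprop :=
            if p = P.lead (s.view + 1) ∧ P.Initial (s.view + 1) then
              Function.update s.oprop (s.view + 1) true
            else s.oprop
          opar := if p = P.lead (s.view + 1) ∧ P.Initial (s.view + 1) then b else s.opar }
  else s' = s

open Classical in
/-- The leader's decision, `2Δ` after entering an initial view, about its optimistic proposal. -/
def releaseOrReplace (s s' : LocalState P) : Prop :=
  if P.Initial s.view ∧ p = P.lead s.view ∧ s.oprop s.view = true ∧ s.T = 2 * P.Δ then
    if K.InBlocks s.S s.opar then
      s' = s.disseminate p {m | ∃ b o, (b, o) ∈ s.proposed ∧ b.view = s.view ∧ m = .release b}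
    else
      s' = { s with
        secondPropose := Function.update s.secondPropose (P.superview s.view) true }
  else s' = s

open Classical in
/-- If `ProposeReady` then `ProposeBlock`. In Case 3 the time at which a leader has finished sending
its previous block is left open, so there it may propose but does not have to. -/
def propose (s s' : LocalState P) : Prop :=
  if K.ProposeReady1 p s ∨ ProposeReady2 p s then K.ProposeBlock p s s'
  else (ProposeReady3 p s ∧ K.ProposeBlock p s s') ∨ s' = s

/-- Disseminate a stage-2 vote for `b`. -/
def castVote2 (s : LocalState P) (b : Block) : LocalState P :=
  { s.disseminate p {Msg.vote2 b p} with voted2 := Function.update s.voted2 s.view true }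

open Classical in
/-- Stage-2 voting for a block in `blocks*`. -/
def stage2 (s s' : LocalState P) : Prop :=
  if (∃ b, K.InBlocksStar s.S b ∧ b.view = s.view) ∧
      s.nullified s.view = false ∧ s.voted2 s.view = false then
    ∃ b, K.InBlocksStar s.S b ∧ b.view = s.view ∧ s' = castVote2 p s b
  else s' = s

open Classical in
/-- If `blocks` contains a block for the present view: stage-2 vote for it if still possible,
record it and go to the next view. -/
def advanceBlock (s s' : LocalState P) : Prop :=
  if ∃ b, K.InBlocks s.S b ∧ b.view = s.view then
    ∃ b, K.InBlocks s.S b ∧ b.view = s.view ∧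
      s' =
        { LocalState.enterNext K
            (if s.nullified s.view = false ∧ s.voted2 s.view = false then castVote2 p s b
              else s) with
          b := b }
  else s' = s

open Classical in
/-- Time-out: send `nullify(v)` for the present and all later views of the present superview. -/
def timeout (s s' : LocalState P) : Prop :=
  if s.nullified s.view = false ∧ K.TimeoutReady s then
    s' =
      { s.disseminate p
          {m | ∃ v, s.view ≤ v ∧ P.superview v = P.superview s.view ∧ m = .nullify v p} with
        nullified := fun v =>
          s.nullified v || decide (s.view ≤ v ∧ P.superview v = P.superview s.view) }
  else s' = s

open Classical in
/-- If there is an N-certificate for the present view, go to the next view. -/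
def advanceN (s s' : LocalState P) : Prop :=
  if P.HasN s.S s.view then s' = LocalState.enterNext K s else s' = s

/-- The instructions, in the order in which they are carried out. -/
def instructions : List (LocalState P → LocalState P → Prop) :=
  [disseminateN p, disseminateM p, K.stage1 p, K.releaseOrReplace p, K.propose p, K.stage2 p,
    K.advanceBlock p, K.timeout p, K.advanceN]

/-- The list of instructions is carried out once, from top to bottom. -/
def Pass : LocalState P → LocalState P → Prop := (K.instructions p).foldr Relation.Comp Eq

/-- No instruction has any further effect. -/
def Quiescent (s : LocalState P) : Prop := ∀ I ∈ K.instructions p, I s s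

/-- What a correct processor does in one timeslot: local computation takes no time, so the
instructions are carried out, from top to bottom and repeatedly, until they have no further
effect. -/
def Slot (s s' : LocalState P) : Prop := Relation.ReflTransGen (K.Pass p) s s' ∧ K.Quiescent p s'

end Setup

/-! ### Executions -/

/-- An execution in the partial synchrony model, with perfect cryptography. Processors outside
`correct` send arbitrary messages, subject to unforgeability. -/
structure Execution {P : Params} (K : Setup P) where
  /-- the processors that never become corrupted -/
  correct : Finset P.Proc
  card_faulty : correctᶜ.card ≤ P.f
  GST : ℕ
  /-- the timeslot at which a processor begins -/
  start : P.Proc → ℕ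
  start_le : ∀ p ∈ correct, start p ≤ GST
  /-- `sent p t q` is the set of messages that `p` sends to `q` at timeslot `t` -/
  sent : P.Proc → ℕ → P.Proc → Set (Msg P.n)
  /-- `arrival p t q m` is the timeslot at which `m`, if sent by `p` to `q` at `t`, arrives -/
  arrival : P.Proc → ℕ → P.Proc → Msg P.n → ℕ
  arrival_gt : ∀ p t q m, m ∈ sent p t q → t < arrival p t q m
  arrival_le : ∀ p t q m, m ∈ sent p t q → arrival p t q m ≤ max GST t + P.Δ
  /-- the local state of a correct processor at the end of timeslot `t`, for `t ≥ start p` -/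
  state : P.Proc → ℕ → LocalState P
  sent_before : ∀ p ∈ correct, ∀ t < start p, ∀ q, sent p t q = ∅
  sent_eq : ∀ p ∈ correct, ∀ t, start p ≤ t → ∀ q, sent p t q = {m | (q, m) ∈ (state p t).out}
  run_start : ∀ p ∈ correct,
    K.Slot p
      (LocalState.first K
        {y | y.1 ≠ p ∧ ∃ t₀, y.2 ∈ sent y.1 t₀ p ∧ arrival y.1 t₀ p y.2 ≤ start p})
      (state p (start p))
  run_step : ∀ p ∈ correct, ∀ t, start p ≤ t →
    K.Slot p
      ((state p t).tick
        {y | y.1 ≠ p ∧ ∃ t₀, y.2 ∈ sent y.1 t₀ p ∧ arrival y.1 t₀ p y.2 ≤ t + 1})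
      (state p (t + 1))
  /-- signatures and signature shares of correct processors cannot be forged -/
  signature : ∀ p t q m i, m ∈ sent p t q → m.signer = some i → i ∈ correct →
    ∃ t' ≤ t, ∃ q', m ∈ sent i t' q'
  /-- blocks carry the signature of the leader of their view, which cannot be forged either -/
  block_signature : ∀ p t q m b, m ∈ sent p t q → m.block = some b → 1 ≤ b.view →
    P.lead b.view ∈ correct →
    ∃ t' ≤ t, start (P.lead b.view) ≤ t' ∧ ∃ o, (b, o) ∈ (state (P.lead b.view) t').proposed
  /-- a threshold certificate exists only if sufficiently many shares have been produced -/
  threshold_n : ∀ p t q v, Msg.nCert v ∈ sent p t q →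
    ∃ Q : Finset P.Proc, Q.card = 2 * P.f + 1 ∧
      ∀ i ∈ Q, i ∈ correct → ∃ t' ≤ t, ∃ q', Msg.nullify v i ∈ sent i t' q'
  threshold_m : ∀ p t q b, Msg.mCert b ∈ sent p t q →
    ∃ Q : Finset P.Proc, Q.card = P.f + 1 ∧
      ∀ i ∈ Q, i ∈ correct → ∃ t' ≤ t, ∃ q', Msg.vote2 b i ∈ sent i t' q'
  threshold_cert : ∀ p t q b, Msg.cert b ∈ sent p t q →
    ∃ Q : Finset P.Proc, Q.card = P.n - P.f ∧
      ∀ i ∈ Q, i ∈ correct → ∃ t' ≤ t, ∃ q', Msg.vote2 b i ∈ sent i t' q'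

namespace Execution

variable {P : Params} {K : Setup P} (E : Execution K)

/-- The view that `p` is in, or has reached, at the end of timeslot `t` (`0` if `p` has not begun). -/
def viewAt (p : P.Proc) (t : ℕ) : ℕ := if t < E.start p then 0 else (E.state p t).view

/-- `p` enters view `v` at timeslot `t` (views are entered one after the other, possibly several
in a timeslot). -/
def Enters (p : P.Proc) (v t : ℕ) : Prop := v ≤ E.viewAt p t ∧ ∀ t' < t, E.viewAt p t' < v

/-- The first correct processor to enter view `v` does so at `t`. -/
def FirstEntry (v t : ℕ) : Prop :=
  (∃ p ∈ E.correct, E.Enters p v t) ∧ ∀ p ∈ E.correct, ∀ t', E.Enters p v t' → t ≤ t'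

/-- `p` has received a stage-2 certificate for `b` (or formed one from received votes) by `t`. -/
def HasCertBy (p : P.Proc) (t : ℕ) (b : Block) : Prop :=
  E.start p ≤ t ∧ P.HasCert (E.state p t).S b

/-- `p` disseminates a `nullify(v)` message at some timeslot. -/
def SendsNullify (p : P.Proc) (v : ℕ) : Prop := ∃ t q, Msg.nullify v p ∈ E.sent p t q

end Execution

end Carnot

/-! The core is that no correct processor ever sends `nullify(v)`, proved by induction on the
timeslot (`noNullify`). While nobody has done so there is no N-certificate for `v`, because its
`2f+1` shares would include one of a correct processor. Hence a correct processor leaves `v` only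
with a view `v` block in `blocks`, and the M-certificates behind that block reach everybody within
`Δ` (`NoNullifyBefore.inBlocks`). So at each deadline either such a block is present, and then no
time-out fires, or the following schedule has been kept.

Certificates are passed on, so all correct processors enter `v` between `t` and `t + Δ`
(`FirstEntry.enters`). The leader proposes at the latest on entering, so fragments are received by
`t + 2Δ` (`fragment_by`). If the leader enters at `e`, then by `e + 2Δ ≤ t + 3Δ` it has released a
proposal whose parent is in its `blocks`, so every correct processor has a votable fragment by `t +
4Δ` (`votable_by`). All correct processors have then voted, and by `t + 5Δ` their votes and
fragments put the block into `blocks*` (`blocksStar_by`). Timers start at `t` or later, so whenever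
a time-out of `2Δ`, `4Δ` or `5Δ` could fire, what it waits for has arrived.

The last stage needs all stage-1 votes to be for one block (`HonestVote.unique`). The leader may
propose twice: optimistically, and again if at `e + 2Δ` the parent `opar` is missing from its
`blocks`. A vote for the optimistic block requires either that the voter had the parent on entering
`v`, by `t + Δ`, so that the leader has it by `t + 2Δ ≤ e + 2Δ`; or a release, which the leader
sends at `e + 2Δ` only if it has the parent. Both rule out a replacement (`eq_of_replaced`).

Stage-2 votes inherit this uniqueness, since a block with a stage-2 vote of a correct processor also
has a stage-1 vote of one (`honestVote_of_vote2`). So by `t + 5Δ` all correct processors have cast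
stage-2 votes for the same block (`vote2_by`), and these votes are received by `t + 6Δ`.

To make this formal, each pass through the instructions is split into guarded single changes
(`Pass.steps`). Safety facts are invariants of these changes (`Micro.induct`); progress comes from
the fact that at the end of a slot no instruction has any further effect (`Quiescent`). -/

namespace Carnot

open Relation (ReflTransGen)

/-! ### Arithmetic of views -/

namespace Params

variable (P : Params)

theorem x_pos : 0 < P.x := lt_of_lt_of_le Nat.zero_lt_two P.two_le_x

variable {P}

theorem Initial.exists_eq {v : ℕ} (h : P.Initial v) : ∃ k, v = P.x * k + 1 := by
  have hx := P.two_le_x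
  have h1 : v % P.x = 1 := by
    have := h
    unfold Params.Initial Nat.ModEq at this
    rwa [Nat.mod_eq_of_lt (by omega : 1 < P.x)] at this
  exact ⟨v / P.x, by rw [← h1]; exact (Nat.div_add_mod v P.x).symm⟩

theorem initial_mul_add_one (k : ℕ) : P.Initial (P.x * k + 1) := by
  unfold Params.Initial Nat.ModEq
  simp [Nat.add_mod]

theorem Initial.one_le {v : ℕ} (h : P.Initial v) : 1 ≤ v := by
  obtain ⟨k, rfl⟩ := h.exists_eq
  omega

theorem superview_mul_add_one (k : ℕ) : P.superview (P.x * k + 1) = k + 1 := by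
  simp [Params.superview, P.x_pos]

theorem superview_mono {u v : ℕ} (h : u ≤ v) : P.superview u ≤ P.superview v := by
  unfold Params.superview
  exact Nat.succ_le_succ (Nat.div_le_div_right (by omega))

theorem Initial.superview_pred_lt {v u : ℕ} (h : P.Initial v) (hu : 1 ≤ u) (huv : u < v) :
    P.superview u < P.superview v := by
  obtain ⟨k, rfl⟩ := h.exists_eq
  rw [superview_mul_add_one]
  unfold Params.superview
  refine Nat.succ_lt_succ ((Nat.div_lt_iff_lt_mul P.x_pos).2 ?_)
  rw [mul_comm]
  omega

theorem Initial.le_of_superview_eq {v u : ℕ} (h : P.Initial v) (hu : 1 ≤ u)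
    (huv : P.superview u = P.superview v) : v ≤ u := by
  by_contra hlt
  exact absurd huv (h.superview_pred_lt hu (by omega)).ne

theorem superview_succ_of_not_initial {v : ℕ} (hv : 1 ≤ v) (h : ¬ P.Initial (v + 1)) :
    P.superview (v + 1) = P.superview v := by
  have hx := P.x_pos
  unfold Params.superview
  obtain ⟨u, rfl⟩ : ∃ u, v = u + 1 := ⟨v - 1, by omega⟩
  simp only [Nat.add_sub_cancel]
  rw [Nat.succ_div, if_neg]
  · rintro ⟨k, hk⟩
    exact h (hk ▸ initial_mul_add_one k)

/-- Two consecutive initial views would make `x` divide `1`. This separates optimistic proposals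
from those made inside an initial view, and gives `v` and `v + 1` the same leader. -/
theorem Initial.not_initial_succ {v : ℕ} (h : P.Initial v) : ¬ P.Initial (v + 1) := by
  intro h'
  have hx := P.two_le_x
  obtain ⟨k, hk⟩ := h.exists_eq
  obtain ⟨l, hl⟩ := h'.exists_eq
  have h2 : P.x * l = P.x * k + 1 := by omega
  have h3 : P.x ∣ 1 := by
    have h4 : P.x ∣ P.x * k + 1 := h2 ▸ Dvd.intro l rfl
    exact (Nat.dvd_add_right (Dvd.intro k rfl)).1 h4
  have := Nat.le_of_dvd Nat.one_pos h3
  omega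

theorem Initial.superview_succ {v : ℕ} (h : P.Initial v) :
    P.superview (v + 1) = P.superview v :=
  superview_succ_of_not_initial h.one_le h.not_initial_succ

theorem lead_congr {u v : ℕ} (h : P.superview u = P.superview v) : P.lead u = P.lead v := by
  simp [Params.lead, h]

theorem superview_eq_of_between {u v w : ℕ} (huv : u ≤ v) (hvw : v ≤ w)
    (h : P.superview u = P.superview w) : P.superview v = P.superview w :=
  le_antisymm (superview_mono hvw) (h ▸ superview_mono huv)

/-! ### Monotonicity in the received messages -/

theorem Received.mono {S S' : P.Inbox} (h : S ⊆ S') {m : Msg P.n} (hm : P.Received S m) :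
    P.Received S' m := hm.imp fun _ hq => h hq

theorem HasN.mono {S S' : P.Inbox} (h : S ⊆ S') {v : ℕ} (hm : P.HasN S v) : P.HasN S' v :=
  hm.imp (Received.mono h) fun ⟨Q, hQ, hi⟩ => ⟨Q, hQ, fun i hiQ => (hi i hiQ).mono h⟩

theorem HasM.mono {S S' : P.Inbox} (h : S ⊆ S') {b : Block} (hm : P.HasM S b) : P.HasM S' b :=
  hm.imp (Received.mono h) fun ⟨Q, hQ, hi⟩ => ⟨Q, hQ, fun i hiQ => (hi i hiQ).mono h⟩

theorem HasNotarisation.mono {S S' : P.Inbox} (h : S ⊆ S') {b : Block}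
    (hm : P.HasNotarisation S b) : P.HasNotarisation S' b :=
  let ⟨Q, hQ, hi⟩ := hm
  ⟨Q, hQ, fun i hiQ => (hi i hiQ).mono h⟩

theorem not_received_empty (m : Msg P.n) : ¬ P.Received ∅ m := fun ⟨_, h⟩ => h

theorem not_hasN_empty (v : ℕ) : ¬ P.HasN ∅ v := by
  rintro (h | ⟨Q, hQ, h⟩)
  · exact not_received_empty _ h
  · obtain ⟨i, hi⟩ := Finset.card_pos.1 (by omega : 0 < Q.card)
    exact not_received_empty _ (h i hi)

theorem not_hasM_empty (b : Block) : ¬ P.HasM ∅ b := by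
  rintro (h | ⟨Q, hQ, h⟩)
  · exact not_received_empty _ h
  · obtain ⟨i, hi⟩ := Finset.card_pos.1 (by omega : 0 < Q.card)
    exact not_received_empty _ (h i hi)

end Params

namespace Setup

variable {P : Params} (K : Setup P)

variable {K} in
theorem InBlocks.mono {S S' : P.Inbox} (h : S ⊆ S') {b : Block} (hb : K.InBlocks S b) :
    K.InBlocks S' b := by
  induction hb with
  | genesis => exact .genesis
  | child b b' hb hM _ hpar ih => exact .child b b' hb (hM.mono h) ih hpar

variable {K} in
theorem InBlocksStar.mono {S S' : P.Inbox} (h : S ⊆ S') {b : Block} (hb : K.InBlocksStar S b) :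
    K.InBlocksStar S' b := by
  refine hb.imp id ?_
  rintro ⟨h1, h2, ⟨I, c, π, hI, hf, hd⟩, b', hb', hpar⟩
  exact ⟨h1, h2.mono h, ⟨I, c, π, hI, fun j hj => ⟨h (hf j hj).1, (hf j hj).2⟩, hd⟩, b',
    hb'.mono h, hpar⟩

variable {K} in
/-- A block of a positive view in `blocks` has a stage-2 M-certificate and its parent is in
`blocks`. -/
theorem InBlocks.of_one_le {S : P.Inbox} {b : Block} (hb : K.InBlocks S b) (h : 1 ≤ b.view) :
    P.IsBlock b ∧ P.HasM S b ∧ ∃ b', K.H (.block b') = b.par ∧ K.InBlocks S b' := by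
  cases hb with
  | genesis => simp [Setup.genesis] at h
  | child _ b' hb hM hb' hpar => exact ⟨hb, hM, b', hpar, hb'⟩

variable {K} in
theorem InBlocksStar.of_one_le {S : P.Inbox} {b : Block} (hb : K.InBlocksStar S b)
    (h : 1 ≤ b.view) :
    P.IsBlock b ∧ P.HasNotarisation S b ∧ ∃ b', K.H (.block b') = b.par ∧ K.InBlocks S b' := by
  rcases hb with rfl | ⟨h1, h2, _, b', h3, h4⟩
  · simp [Setup.genesis] at h
  · exact ⟨h1, h2, b', h4, h3⟩

theorem block_injective {b b' : Block} (h : K.H (.block b) = K.H (.block b')) : b = b' :=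
  HashInput.block.inj (K.H_injective h)

/-! ### Merkle trees and decoding -/

theorem length_merklePath (d : ℕ) (L : ℕ → Bits) (i : ℕ) : (K.merklePath d L i).length = d := by
  induction d generalizing L i with
  | zero => rfl
  | succ d ih =>
    unfold merklePath
    split <;> simp [ih]

theorem rootOfPath_merklePath (d : ℕ) (L : ℕ → Bits) (i : ℕ) (hi : i < 2 ^ d) :
    K.rootOfPath (K.merklePath d L i) i (L i) = K.merkleRoot d L := by
  induction d generalizing L i with
  | zero =>
    have : i = 0 := by simpa using hi
    subst this
    rfl
  | succ d ih =>
    unfold merklePath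
    split
    · rename_i h
      simp [rootOfPath, merkleRoot, length_merklePath, h, ih L i h]
    · rename_i h
      have h2 : i - 2 ^ d < 2 ^ d := by rw [pow_succ] at hi; omega
      have h3 := ih (fun j => L (j + 2 ^ d)) (i - 2 ^ d) h2
      simp only [Nat.sub_add_cancel (not_lt.1 h)] at h3
      simp [rootOfPath, merkleRoot, length_merklePath, h, h3]

/-- Injectivity of the hash peels off one level at a time: equal roots have equal children, and `i`
selects the same child on both sides. Nothing is assumed about the origin of the path, so it may be
adversarial. -/
theorem eq_of_rootOfPath_eq (π : List Bits) (L : ℕ → Bits) (i : ℕ) (h : Bits)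
    (hi : i < 2 ^ π.length) (hr : K.rootOfPath π i h = K.merkleRoot π.length L) : h = L i := by
  induction π generalizing L i with
  | nil =>
    have : i = 0 := by simpa using hi
    subst this
    exact hr
  | cons s π ih =>
    simp only [List.length_cons, merkleRoot] at hr hi
    unfold rootOfPath at hr
    split at hr
    · rename_i hlt
      have := K.H_injective hr
      simp only [HashInput.node.injEq] at this
      exact ih L i hlt this.1
    · rename_i hlt
      have := K.H_injective hr
      simp only [HashInput.node.injEq] at this
      have h2 := ih (fun j => L (j + 2 ^ π.length)) (i - 2 ^ π.length)
        (by rw [pow_succ] at hi; omega) this.2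
      simpa [Nat.sub_add_cancel (not_lt.1 hlt)] using h2

theorem lt_two_pow_depth (i : P.Proc) : (i : ℕ) < 2 ^ depth P :=
  lt_of_lt_of_le i.2 (Nat.le_pow_clog one_lt_two _)

theorem certified_encode (C : Bits) (k : ℕ) (hk : 1 ≤ k) (hkn : k ≤ P.n) (i : P.Proc) :
    K.Certified (K.tag C k) i (K.code.encode k C i) (K.path C k i) := by
  refine ⟨K.code.length_encode k hk hkn C i, K.length_merklePath _ _ _, ?_⟩
  have := K.rootOfPath_merklePath (depth P) (K.leaves C k) i (lt_two_pow_depth i)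
  rwa [show K.leaves C k i = K.H (.leaf (K.code.encode k C i)) by simp [leaves]] at this

theorem eq_encode_of_certified {C : Bits} {k : ℕ} {i : P.Proc} {c : Bits} {π : List Bits}
    (h : K.Certified (K.tag C k) i c π) : c = K.code.encode k C i := by
  obtain ⟨_, hl, hr⟩ := h
  have h2 := K.eq_of_rootOfPath_eq π (K.leaves C k) i (K.H (.leaf c))
    (hl ▸ lt_two_pow_depth i) (by rw [hr, hl]; rfl)
  rw [show K.leaves C k i = K.H (.leaf (K.code.encode k C i)) by simp [leaves]] at h2
  exact HashInput.leaf.inj (K.H_injective h2)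

/-- Any `k` certified fragments of a correctly formed tag can be decoded. -/
theorem decode_ne_none {C : Bits} {k : ℕ} (hk : 1 ≤ k) (hkn : k ≤ P.n) (I : Finset P.Proc)
    (hI : I.card = k) (c : P.Proc → Bits) (π : P.Proc → List Bits)
    (h : ∀ j ∈ I, K.Certified (K.tag C k) j (c j) (π j)) :
    K.decode (K.tag C k) I (fun j => c j) ≠ none := by
  have h1 : (fun j : I => c j) = fun j : I => K.code.encode k C j :=
    funext fun j => K.eq_encode_of_certified (h j j.2)
  have h2 := K.code.reconstruct_encode k hk hkn C I hI
  rw [h1]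
  unfold decode
  simp [tag, h2]

end Setup

/-! ### Single state changes and the invariants they preserve -/

/-- Everything that can only grow while the instructions are carried out. -/
structure LocalState.Ext {P : Params} (s s' : LocalState P) : Prop where
  S : s.S ⊆ s'.S
  out : s.out ⊆ s'.out
  proposed : s.proposed ⊆ s'.proposed
  view : s.view ≤ s'.view
  voted1 : ∀ u, s.voted1 u = true → s'.voted1 u = true
  voted2 : ∀ u, s.voted2 u = true → s'.voted2 u = true
  nullified : ∀ u, s.nullified u = true → s'.nullified u = true
  secondPropose : ∀ u, s.secondPropose u = true → s'.secondPropose u = true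
  oprop : ∀ u, s.oprop u = true → s'.oprop u = true
  prevS : s'.prevS = s.prevS

namespace LocalState.Ext

variable {P : Params} {s s' s'' : LocalState P}

theorem refl (s : LocalState P) : s.Ext s :=
  ⟨le_rfl, le_rfl, le_rfl, le_rfl, fun _ => id, fun _ => id, fun _ => id, fun _ => id,
    fun _ => id, rfl⟩

theorem trans (h : s.Ext s') (h' : s'.Ext s'') : s.Ext s'' :=
  ⟨h.S.trans h'.S, h.out.trans h'.out, h.proposed.trans h'.proposed, h.view.trans h'.view,
    fun u => h'.voted1 u ∘ h.voted1 u, fun u => h'.voted2 u ∘ h.voted2 u,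
    fun u => h'.nullified u ∘ h.nullified u, fun u => h'.secondPropose u ∘ h.secondPropose u,
    fun u => h'.oprop u ∘ h.oprop u, h'.prevS.trans h.prevS⟩

end LocalState.Ext

namespace Setup

variable {P : Params} (K : Setup P) (p : P.Proc)

/-- `S` alone provides a fragment at `p` that is votable for the initial view `u`, of a released
block. -/
def ReleasedVotable (S : P.Inbox) (u : ℕ) : Prop :=
  ∃ (b : Block) (c : Bits) (π : List Bits), P.IsBlock b ∧ b.view = u ∧
    P.Received S (.frag b p c π) ∧ K.Certified b.tag p c π ∧ (P.lead u, Msg.release b) ∈ S ∧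
    ∃ b' : Block, K.H (.block b') = b.par ∧ b'.view < u ∧ K.InBlocks S b' ∧
      ∀ v', b'.view < v' → v' < u → P.HasN S v'

variable {K p} in
theorem ReleasedVotable.hasVotable {S : P.Inbox} {s : LocalState P}
    (h : K.ReleasedVotable p S s.view) (hS : S ⊆ s.S) (hi : P.Initial s.view) :
    K.HasVotable p s := by
  obtain ⟨b, c, π, h1, h2, h3, h4, h5, b', h6, h7, h8, h9⟩ := h
  exact ⟨b, c, π, h1, h2, h3.mono hS, h4, b', h6, h7, .inr (.inr ⟨hi, hS h5, h8.mono hS⟩),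
    fun v' h h' => (h9 v' h h').mono hS⟩

variable {K p} in
theorem Votable.mono {s s' : LocalState P} {b : Block} {c : Bits} {π : List Bits}
    (h : K.Votable p s b c π) (hS : s.S ⊆ s'.S) (hv : s'.view = s.view)
    (he : s'.entryBlocks = s.entryBlocks) : K.Votable p s' b c π := by
  obtain ⟨h1, h2, h3, h4, b', h6, h7, h8, h9⟩ := h
  rw [Votable, hv, he]
  exact ⟨h1, h2, h3.mono hS, h4, b', h6, h7,
    h8.imp (And.imp_right (InBlocks.mono hS))
      (Or.imp id fun ⟨h, h', h''⟩ => ⟨h, hS h', h''.mono hS⟩),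
    fun v' h h' => (h9 v' h h').mono hS⟩

variable {K p} in
theorem HasVotable.mono {s s' : LocalState P} (h : K.HasVotable p s) (hS : s.S ⊆ s'.S)
    (hv : s'.view = s.view) (he : s'.entryBlocks = s.entryBlocks) : K.HasVotable p s' :=
  let ⟨b, c, π, hb⟩ := h
  ⟨b, c, π, hb.mono hS hv he⟩

/-- A leader that has voted in the last view before one of its superviews has made its optimistic
proposal. -/
def OptimisticDone (s : LocalState P) : Prop :=
  P.Initial (s.view + 1) → p = P.lead (s.view + 1) → s.voted1 s.view = true →
    ∃ b o, (b, o) ∈ s.proposed ∧ b.view = s.view + 1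

open Classical in
/-- The individual state changes of a processor, each with the conditions under which it happens;
`S₀` is the set of messages received at the beginning of the timeslot. -/
inductive Step (S₀ : P.Inbox) : LocalState P → LocalState P → Prop
  | nCerts (s) : Step S₀ s
      (s.disseminate p {m | ∃ v, m = .nCert v ∧ P.HasN s.S v ∧ ¬ P.HasN s.prevS v})
  | certs (s) : Step S₀ s (s.disseminate p
      ({m | ∃ b, m = .cert b ∧ P.HasCert s.S b ∧ ¬ P.HasCert s.prevS b} ∪
        {m | ∃ b, m = .mCert b ∧ P.HasM s.S b ∧ ¬ P.HasM s.prevS b}))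
  | vote1 (s b c π) (hb : K.Votable p s b c π) (h1 : s.voted1 s.view = false) : Step S₀ s
      { s.disseminate p
          ({Msg.vote1 b p} ∪ {m | p ≠ P.lead (s.view + 1) ∧ m = Msg.frag b p c π}) with
        voted1 := Function.update s.voted1 s.view true
        oprop :=
          if p = P.lead (s.view + 1) ∧ P.Initial (s.view + 1) then
            Function.update s.oprop (s.view + 1) true
          else s.oprop
        opar := if p = P.lead (s.view + 1) ∧ P.Initial (s.view + 1) then b else s.opar }
  | release (s) (hi : P.Initial s.view) (hp : p = P.lead s.view) (ho : s.oprop s.view = true)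
      (hT : s.T = 2 * P.Δ) (hb : K.InBlocks s.S s.opar) : Step S₀ s
      (s.disseminate p {m | ∃ b o, (b, o) ∈ s.proposed ∧ b.view = s.view ∧ m = .release b})
  | second (s) (hi : P.Initial s.view) (hp : p = P.lead s.view) (ho : s.oprop s.view = true)
      (hT : s.T = 2 * P.Δ) (hb : ¬ K.InBlocks s.S s.opar) : Step S₀ s
      { s with secondPropose := Function.update s.secondPropose (P.superview s.view) true }
  | optimistic (s s') (hi : P.Initial (s.view + 1)) (hp : p = P.lead (s.view + 1))
      (hv : s.voted1 s.view = true)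
      (hno : ¬ ∃ b o, (b, o) ∈ s.proposed ∧ P.superview b.view = P.superview (s.view + 1))
      (hs : K.SendBlock p (s.view + 1) s.opar False s s') : Step S₀ s s'
  | fresh (s s') (hi : P.Initial s.view) (hp : p = P.lead s.view)
      (hno : ¬ ∃ v', s.ProposedSince v') (hs : K.SendBlock p s.view s.b True s s') : Step S₀ s s'
  | later (s s' b') (hb : (b', s.secondNow) ∈ s.proposed)
      (hw : P.superview b'.view = P.superview (s.view + 1))
      (hw' : P.superview (b'.view + 1) = P.superview (s.view + 1))
      (hmax : ∀ v', s.ProposedSince v' → v' ≤ b'.view)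
      (hs : K.SendBlock p (b'.view + 1) b' False s s') : Step S₀ s s'
  | vote2 (s b) (hv : b.view = s.view) (hb : K.InBlocksStar s.S b ∨ K.InBlocks s.S b)
      (h0 : s.nullified s.view = false) (h2 : s.voted2 s.view = false) :
      Step S₀ s (castVote2 p s b)
  | advance (s b) (hv : b.view = s.view) (hb : K.InBlocks s.S b)
      (h2 : s.voted2 s.view = true ∨ s.nullified s.view = true) (hd : OptimisticDone p s) :
      Step S₀ s { LocalState.enterNext K s with b := b }
  | timeout (s) (h0 : s.nullified s.view = false) (hT : K.TimeoutReady s)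
      (hb : ¬ ∃ b, K.InBlocks s.S b ∧ b.view = s.view)
      (hb' : (∃ b, K.InBlocksStar S₀ b ∧ b.view = s.view) → s.voted2 s.view = true)
      (h1 : P.Initial s.view → K.ReleasedVotable p S₀ s.view → s.voted1 s.view = true) :
      Step S₀ s
      { s.disseminate p
          {m | ∃ v, s.view ≤ v ∧ P.superview v = P.superview s.view ∧ m = .nullify v p} with
        nullified := fun v =>
          s.nullified v || decide (s.view ≤ v ∧ P.superview v = P.superview s.view) }
  | skip (s) (hN : P.HasN s.S s.view) (hd : OptimisticDone p s) :
      Step S₀ s (LocalState.enterNext K s)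

variable {K p}

open LocalState in
theorem SendBlock.ext {v : ℕ} {par : Block} {rel : Prop} {s s' : LocalState P}
    (h : K.SendBlock p v par rel s s') : s.Ext s' := by
  obtain ⟨C, k, b, -, -, rfl⟩ := h
  exact ⟨Set.subset_union_left, Set.subset_union_left, Set.subset_insert _ _, le_rfl,
    fun _ => id, fun _ => id, fun _ => id, fun _ => id, fun _ => id, rfl⟩

theorem update_true {f : ℕ → Bool} {a u : ℕ} (h : f u = true) :
    Function.update f a true u = true := by
  by_cases hu : u = a
  · subst hu; simp
  · simpa [hu] using h

open LocalState in
theorem Step.ext {S₀ : P.Inbox} {s s' : LocalState P} (h : K.Step p S₀ s s') : s.Ext s' := by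
  cases h with
  | optimistic _ _ _ _ _ hs => exact hs.ext
  | fresh _ _ _ _ hs => exact hs.ext
  | later _ _ _ _ _ _ hs => exact hs.ext
  | vote1 b c π hb h1 =>
    refine ⟨Set.subset_union_left, Set.subset_union_left, le_rfl, le_rfl,
      fun _ => update_true, fun _ => id, fun _ => id, fun _ => id, fun u hu => ?_, rfl⟩
    dsimp only
    split
    · exact update_true hu
    · exact hu
  | second =>
    exact ⟨le_rfl, le_rfl, le_rfl, le_rfl,
      fun _ => id, fun _ => id, fun _ => id, fun _ => update_true, fun _ => id, rfl⟩
  | vote2 =>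
    exact ⟨Set.subset_union_left, Set.subset_union_left, le_rfl, le_rfl,
      fun _ => id, fun _ => update_true, fun _ => id, fun _ => id, fun _ => id, rfl⟩
  | timeout =>
    exact ⟨Set.subset_union_left, Set.subset_union_left, le_rfl, le_rfl,
      fun _ => id, fun _ => id, fun _ h => by simp [h], fun _ => id, fun _ => id, rfl⟩
  | advance =>
    exact ⟨le_rfl, le_rfl, le_rfl, Nat.le_succ _,
      fun _ => id, fun _ => id, fun _ => id, fun _ => id, fun _ => id, rfl⟩
  | skip =>
    exact ⟨le_rfl, le_rfl, le_rfl, Nat.le_succ _,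
      fun _ => id, fun _ => id, fun _ => id, fun _ => id, fun _ => id, rfl⟩
  | _ =>
    exact ⟨Set.subset_union_left, Set.subset_union_left, le_rfl, le_rfl,
      fun _ => id, fun _ => id, fun _ => id, fun _ => id, fun _ => id, rfl⟩

theorem Step.ext_of_reflTransGen {S₀ : P.Inbox} {s s' : LocalState P}
    (h : Relation.ReflTransGen (K.Step p S₀) s s') : s.Ext s' := by
  induction h with
  | refl => exact .refl _
  | tail _ h ih => exact ih.trans h.ext

/-- What a processor receives during its own computation it has sent to itself, and conversely. -/
theorem Step.self_sent {S₀ : P.Inbox} {s s' : LocalState P} (h : K.Step p S₀ s s') :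
    (∀ y ∈ s'.S, y ∈ s.S ∨ y.1 = p ∧ (p, y.2) ∈ s'.out) ∧
      ∀ m, (p, m) ∈ s'.out → (p, m) ∈ s.out ∨ (p, m) ∈ s'.S := by
  have key : ∀ M : Set (P.Proc × Msg P.n),
      (∀ y ∈ (s.send p M).S, y ∈ s.S ∨ y.1 = p ∧ (p, y.2) ∈ (s.send p M).out) ∧
      ∀ m, (p, m) ∈ (s.send p M).out → (p, m) ∈ s.out ∨ (p, m) ∈ (s.send p M).S := by
    intro M
    refine ⟨fun y hy => hy.imp id fun h => ⟨h.1, .inr h.2⟩, fun m hm => hm.imp id fun h => ?_⟩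
    exact .inr ⟨rfl, h⟩
  have key2 : ∀ {v par rel}, K.SendBlock p v par rel s s' →
    (∀ y ∈ s'.S, y ∈ s.S ∨ y.1 = p ∧ (p, y.2) ∈ s'.out) ∧
      ∀ m, (p, m) ∈ s'.out → (p, m) ∈ s.out ∨ (p, m) ∈ s'.S := by
    rintro v par rel ⟨C, k, b, -, -, rfl⟩
    exact key _
  cases h with
  | optimistic _ _ _ _ _ hs => exact key2 hs
  | fresh _ _ _ _ hs => exact key2 hs
  | later _ _ _ _ _ _ hs => exact key2 hs
  | second => exact ⟨fun _ => .inl, fun _ => .inl⟩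
  | advance => exact ⟨fun _ => .inl, fun _ => .inl⟩
  | skip => exact ⟨fun _ => .inl, fun _ => .inl⟩
  | _ => exact key _

/-! ### Invariants of the local state -/

/-- Invariants that do not refer to the other processors. -/
structure Regular (s : LocalState P) : Prop where
  one_le_view : 1 ≤ s.view
  voted1_le : ∀ u, s.voted1 u = true → u ≤ s.view
  one_le_proposed : ∀ b o, (b, o) ∈ s.proposed → 1 ≤ b.view
  /-- the views proposed for in a superview with the same flag form an initial segment -/
  proposed_down : ∀ b o, (b, o) ∈ s.proposed → ∀ u, 1 ≤ u → u ≤ b.view →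
    P.superview u = P.superview b.view → ∃ b', (b', o) ∈ s.proposed ∧ b'.view = u
  proposed_unique : ∀ b b' o, (b, o) ∈ s.proposed → (b', o) ∈ s.proposed → b.view = b'.view → b = b'
  proposed_second : ∀ b, (b, true) ∈ s.proposed → s.secondPropose (P.superview b.view) = true

theorem Regular.of_eq {s s' : LocalState P} (h : Regular s) (hv : s.view ≤ s'.view)
    (h1 : s'.voted1 = s.voted1) (hp : s'.proposed = s.proposed)
    (h2 : ∀ u, s.secondPropose u = true → s'.secondPropose u = true) : Regular s' := by
  refine ⟨h.one_le_view.trans hv, fun u hu => (h.voted1_le u (h1 ▸ hu)).trans hv, ?_, ?_, ?_, ?_⟩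
  all_goals rw [hp]
  · exact h.one_le_proposed
  · exact h.proposed_down
  · exact h.proposed_unique
  · exact fun b hb => h2 _ (h.proposed_second b hb)

/-- The preservation of the invariants when a block is proposed. -/
theorem Regular.sendBlock {s s' : LocalState P} (h : Regular s) {v : ℕ} {par : Block} {rel : Prop}
    (hs : K.SendBlock p v par rel s s') (hv : 1 ≤ v)
    (hdown : ∀ u, 1 ≤ u → u < v → P.superview u = P.superview v →
      ∃ b', (b', s.secondPropose (P.superview v)) ∈ s.proposed ∧ b'.view = u)
    (hnew : ∀ b', (b', s.secondPropose (P.superview v)) ∈ s.proposed → b'.view ≠ v) :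
    Regular s' := by
  obtain ⟨C, k, b, -, hb, rfl⟩ := hs
  have hbv : b.view = v := by rw [hb]
  refine ⟨h.one_le_view, h.voted1_le, ?_, ?_, ?_, ?_⟩
  · rintro b1 o1 (h1 | h1)
    · obtain ⟨rfl, rfl⟩ := Prod.mk.inj h1
      omega
    · exact h.one_le_proposed b1 o1 h1
  · rintro b1 o1 (h1 | h1) u hu hub hsu
    · obtain ⟨rfl, rfl⟩ := Prod.mk.inj h1
      rcases hub.lt_or_eq with hlt | heq
      · obtain ⟨b', hb', hb'u⟩ := hdown u hu (by omega) (by rw [hsu, hbv])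
        exact ⟨b', .inr hb', hb'u⟩
      · exact ⟨b1, .inl rfl, heq.symm⟩
    · obtain ⟨b', hb', hb'u⟩ := h.proposed_down b1 o1 h1 u hu hub hsu
      exact ⟨b', .inr hb', hb'u⟩
  · rintro b1 b2 o (h1 | h1) (h2 | h2) h12
    · rw [(Prod.mk.inj h1).1, (Prod.mk.inj h2).1]
    · obtain ⟨rfl, rfl⟩ := Prod.mk.inj h1
      exact absurd (h12.symm.trans hbv) (hnew b2 h2)
    · obtain ⟨rfl, rfl⟩ := Prod.mk.inj h2
      exact absurd (h12.trans hbv) (hnew b1 h1)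
    · exact h.proposed_unique b1 b2 o h1 h2 h12
  · rintro b1 (h1 | h1)
    · obtain ⟨rfl, h2⟩ := Prod.mk.inj h1
      rw [hbv]
      exact h2.symm
    · exact h.proposed_second b1 h1

/-- Optimistic and fresh proposals are for the first view of a superview, so nothing lies below
them; a later proposal extends the highest recent one by one view. This keeps the proposed views an
initial segment without repetition. -/
theorem Regular.step {S₀ : P.Inbox} {s s' : LocalState P} (hs : K.Step p S₀ s s')
    (h : Regular s) : Regular s' := by
  cases hs with
  | optimistic _ hi hp hv hno hs =>
    refine h.sendBlock hs (by omega) (fun u hu huv hsu => ?_) fun b' hb' hv => ?_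
    · exact absurd hsu (hi.superview_pred_lt hu huv).ne
    · exact hno ⟨b', _, hb', by rw [hv]⟩
  | fresh _ hi hp hno hs =>
    refine h.sendBlock hs h.one_le_view (fun u hu huv hsu => ?_) fun b' hb' hv => ?_
    · exact absurd hsu (hi.superview_pred_lt hu huv).ne
    · refine hno ⟨_, b', ?_, hv, hi.superview_succ.symm⟩
      rwa [LocalState.secondNow, hi.superview_succ]
  | later _ b' hb hw hw' hmax hs =>
    have hnow : s.secondNow = s.secondPropose (P.superview (b'.view + 1)) := by
      rw [LocalState.secondNow, hw']
    refine h.sendBlock hs (by omega) (fun u hu huv hsu => ?_) fun b1 hb1 hv => ?_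
    · rw [← hnow]
      exact h.proposed_down b' _ hb u hu (by omega) (by rw [hsu, hw', hw])
    · have := hmax (b'.view + 1) ⟨b1, hnow ▸ hb1, hv, hw'⟩
      omega
  | vote1 b c π hb h1 =>
    refine ⟨h.one_le_view, fun u hu => ?_, h.one_le_proposed, h.proposed_down, h.proposed_unique,
      h.proposed_second⟩
    by_cases huv : u = s.view
    · exact huv.le
    · exact h.voted1_le u (by simpa [huv] using hu)
  | second => exact h.of_eq le_rfl rfl rfl fun _ => update_true
  | advance => exact h.of_eq (Nat.le_succ _) rfl rfl fun _ => id
  | skip => exact h.of_eq (Nat.le_succ _) rfl rfl fun _ => id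
  | _ => exact h.of_eq le_rfl rfl rfl fun _ => id

end Setup

/-! ### Reduction of a pass through the instructions to single state changes -/

namespace Setup

variable {P : Params} {K : Setup P} {p : P.Proc}

/-- The parts of the state that only change on leaving a view or on a time-out. -/
structure SameView (s s' : LocalState P) : Prop where
  view : s'.view = s.view
  T : s'.T = s.T
  entryBlocks : s'.entryBlocks = s.entryBlocks
  nullified : s'.nullified = s.nullified

theorem SameView.refl (s : LocalState P) : SameView s s := ⟨rfl, rfl, rfl, rfl⟩

theorem SameView.trans {s s' s'' : LocalState P} (h : SameView s s') (h' : SameView s' s'') :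
    SameView s s'' :=
  ⟨h'.view.trans h.view, h'.T.trans h.T, h'.entryBlocks.trans h.entryBlocks,
    h'.nullified.trans h.nullified⟩

theorem OptimisticDone.mono {s s' : LocalState P} (h : OptimisticDone p s)
    (hv : s'.view = s.view) (h1 : s'.voted1 s'.view = true → s.voted1 s.view = true)
    (hp : s.proposed ⊆ s'.proposed) : OptimisticDone p s' := by
  intro hi hl h1'
  rw [hv] at hi hl ⊢
  obtain ⟨b, o, hb, hbv⟩ := h hi hl (h1 h1')
  exact ⟨b, o, hp hb, hbv⟩

/-- The case without a votable fragment is kept apart because the same pass may still create one: a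
leader receives its own release at once. -/
theorem stage1_steps {S₀ : P.Inbox} {s s' : LocalState P} (h : K.stage1 p s s') :
    ReflTransGen (K.Step p S₀) s s' ∧ SameView s s' ∧ s'.voted2 = s.voted2 ∧
      s'.proposed = s.proposed ∧
      ((K.HasVotable p s' ∧ s'.voted1 s'.view = true) ∨ (s' = s ∧ ¬ K.HasVotable p s)) ∨
      s' = s ∧ s.voted1 s.view = true := by
  unfold stage1 at h
  split at h
  · obtain ⟨b, c, π, hb, rfl⟩ := h
    refine .inl ⟨.single (.vote1 s b c π hb (by tauto)), ⟨rfl, rfl, rfl, rfl⟩, rfl, rfl, .inl ⟨?_, ?_⟩⟩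
    · exact ⟨b, c, π, hb.mono Set.subset_union_left rfl rfl⟩
    · simp [LocalState.disseminate, LocalState.send]
  · rename_i hn
    subst h
    by_cases hv : K.HasVotable p s'
    · exact .inr ⟨rfl, by simpa [hv] using hn⟩
    · exact .inl ⟨.refl, .refl _, rfl, rfl, .inr ⟨rfl, hv⟩⟩

theorem releaseOrReplace_steps {S₀ : P.Inbox} {s s' : LocalState P}
    (h : K.releaseOrReplace p s s') :
    ReflTransGen (K.Step p S₀) s s' ∧ SameView s s' ∧ s'.voted2 = s.voted2 ∧
      s'.voted1 = s.voted1 ∧ s'.proposed = s.proposed ∧ (¬ P.Initial s.view → s' = s) := by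
  unfold releaseOrReplace at h
  split at h
  · rename_i hc
    obtain ⟨hi, hp, ho, hT⟩ := hc
    split at h
    · rename_i hb
      subst h
      exact ⟨.single (.release s hi hp ho hT hb), ⟨rfl, rfl, rfl, rfl⟩, rfl, rfl, rfl,
        fun h => absurd hi h⟩
    · rename_i hb
      subst h
      exact ⟨.single (.second s hi hp ho hT hb), ⟨rfl, rfl, rfl, rfl⟩, rfl, rfl, rfl,
        fun h => absurd hi h⟩
  · subst h
    exact ⟨.refl, .refl _, rfl, rfl, rfl, fun _ => rfl⟩

theorem SendBlock.sameView {v : ℕ} {par : Block} {rel : Prop} {s s' : LocalState P}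
    (h : K.SendBlock p v par rel s s') :
    SameView s s' ∧ s'.voted2 = s.voted2 ∧ s'.voted1 = s.voted1 ∧
      ∃ b, (b, s.secondPropose (P.superview v)) ∈ s'.proposed ∧ b.view = v := by
  obtain ⟨C, k, b, -, hb, rfl⟩ := h
  exact ⟨⟨rfl, rfl, rfl, rfl⟩, rfl, rfl, b, .inl rfl, by rw [hb]⟩

/-- When anything of the present superview has been proposed since `secondPropose` took its
current value, the initial view has. -/
theorem Regular.proposedSince_initial {s : LocalState P} (hr : Regular s) (hi : P.Initial s.view)
    {v' : ℕ} (h : s.ProposedSince v') : s.ProposedSince s.view := by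
  obtain ⟨b, hb, rfl, hw⟩ := h
  rw [hi.superview_succ] at hw
  obtain ⟨b', hb', hv⟩ := hr.proposed_down b _ hb s.view hr.one_le_view
    (hi.le_of_superview_eq (hr.one_le_proposed b _ hb) hw) hw.symm
  exact ⟨b', hb', hv, hi.superview_succ.symm⟩

theorem propose_steps {S₀ : P.Inbox} {s s' : LocalState P} (hr : Regular s)
    (hv1 : ¬ P.Initial s.view → K.HasVotable p s → s.voted1 s.view = true)
    (h : K.propose p s s') :
    ReflTransGen (K.Step p S₀) s s' ∧ SameView s s' ∧ s'.voted2 = s.voted2 ∧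
      s'.voted1 = s.voted1 ∧
      (K.HasVotable p s → P.Initial (s.view + 1) → p = P.lead (s.view + 1) →
        ∃ b o, (b, o) ∈ s'.proposed ∧ b.view = s.view + 1) := by
  have hni : P.Initial (s.view + 1) → ¬ P.Initial s.view := fun h h' => h'.not_initial_succ h
  unfold propose at h
  split at h
  · rename_i hc
    by_cases hi : P.Initial (s.view + 1)
    · obtain ⟨-, hp, hv, hno⟩ : K.ProposeReady1 p s :=
        hc.resolve_right fun h => hni hi h.1
      -- Readiness only excludes an earlier proposal for the initial view, the branch of
      -- `ProposeBlock` one for any view of the superview. They agree because proposed views form an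
      -- initial segment.
      have hno' : ¬ ∃ b o, (b, o) ∈ s.proposed ∧
          P.superview b.view = P.superview (s.view + 1) := by
        rintro ⟨b, o, hb, hw⟩
        obtain ⟨b', hb', hb'v⟩ := hr.proposed_down b o hb (s.view + 1) (by omega)
          (hi.le_of_superview_eq (hr.one_le_proposed b o hb) hw) hw.symm
        exact hno ⟨b', o, hb', hb'v⟩
      rw [ProposeBlock, if_pos ⟨hi, hno'⟩] at h
      obtain ⟨h1, h2, h3, b, h4⟩ := h.sameView
      exact ⟨.single (.optimistic s s' hi hp (hv1 (hni hi) hv) hno' h), h1, h2, h3,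
        fun _ _ _ => ⟨b, _, h4⟩⟩
    · obtain ⟨hi', hp, hno⟩ : ProposeReady2 p s := hc.resolve_left fun h => hi h.1
      have hno' : ¬ ∃ v', s.ProposedSince v' := fun ⟨_, h⟩ => hno (hr.proposedSince_initial hi' h)
      rw [ProposeBlock, if_neg fun h => hi h.1, if_pos ⟨hi', hno'⟩] at h
      obtain ⟨h1, h2, h3, -⟩ := h.sameView
      exact ⟨.single (.fresh s s' hi' hp hno' h), h1, h2, h3, fun _ h => absurd h hi⟩
  · rename_i hc
    have hpost : ∀ {s' : LocalState P}, s.proposed ⊆ s'.proposed →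
        K.HasVotable p s → P.Initial (s.view + 1) → p = P.lead (s.view + 1) →
        ∃ b o, (b, o) ∈ s'.proposed ∧ b.view = s.view + 1 := by
      intro s' hsub hv hi hp
      by_contra hno
      refine hc (.inl ⟨hi, hp, hv, ?_⟩)
      rintro ⟨b, o, hb, hbv⟩
      exact hno ⟨b, o, hsub hb, hbv⟩
    rcases h with ⟨⟨hi, hp, hex, v', hv', hw', hno⟩, h⟩ | rfl
    · rw [ProposeBlock, if_neg fun h => hi h.1, if_neg fun h => h.2 hex] at h
      obtain ⟨b', hb', hw, hmax, h⟩ := h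
      -- The unproposed view `v'` lies beyond the last proposed one, so the successor of the latter
      -- is still in the superview.
      have hlt : ¬ v' ≤ b'.view := by
        intro hle
        obtain ⟨b1, hb1, hb1v⟩ := hr.proposed_down b' _ hb' v' hv' hle (hw'.trans hw.symm)
        exact hno ⟨b1, hb1, hb1v, hw'⟩
      have hw2 : P.superview (b'.view + 1) = P.superview (s.view + 1) := by
        rw [← hw']
        exact Params.superview_eq_of_between (by omega) (by omega) (hw.trans hw'.symm)
      obtain ⟨h1, h2, h3, -⟩ := h.sameView
      exact ⟨.single (.later s s' b' hb' hw hw2 hmax h), h1, h2, h3, hpost h.ext.proposed⟩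
    · exact ⟨.refl, .refl _, rfl, rfl, hpost le_rfl⟩

theorem stage2_steps {S₀ : P.Inbox} {s s' : LocalState P} (h : K.stage2 p s s') :
    ReflTransGen (K.Step p S₀) s s' ∧ SameView s s' ∧ s'.voted1 = s.voted1 ∧
      s'.proposed = s.proposed ∧
      ((∃ b, K.InBlocksStar s.S b ∧ b.view = s.view) → s'.nullified s'.view = false →
        s'.voted2 s'.view = true) := by
  unfold stage2 at h
  split at h
  · rename_i hc
    obtain ⟨b, hb, hv, rfl⟩ := h
    refine ⟨.single (.vote2 s b hv (.inl hb) hc.2.1 hc.2.2), ⟨rfl, rfl, rfl, rfl⟩, rfl, rfl,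
      fun _ _ => ?_⟩
    simp [castVote2, LocalState.disseminate, LocalState.send]
  · rename_i hc
    subst h
    exact ⟨.refl, .refl _, rfl, rfl, fun h1 h2 => by simpa [h1, h2] using hc⟩

theorem advanceBlock_steps {S₀ : P.Inbox} {s s' : LocalState P} (hd : OptimisticDone p s)
    (h : K.advanceBlock p s s') :
    ReflTransGen (K.Step p S₀) s s' ∧
      (s' = s ∧ (¬ ∃ b, K.InBlocks s.S b ∧ b.view = s.view) ∨
        s'.view = s.view + 1 ∧ s'.T = 0 ∧ s'.voted1 = s.voted1) := by
  unfold advanceBlock at h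
  split at h
  · obtain ⟨b, hb, hv, rfl⟩ := h
    -- A pending stage-2 vote becomes a change of its own, so that a view is left through a block
    -- only when it is already voted for or nullified.
    by_cases hc : s.nullified s.view = false ∧ s.voted2 s.view = false
    · rw [if_pos hc]
      refine ⟨.tail (.single (.vote2 s b hv (.inr hb) hc.1 hc.2))
        (.advance _ b hv (hb.mono Set.subset_union_left) (.inl ?_) hd), .inr ⟨rfl, rfl, rfl⟩⟩
      simp [castVote2, LocalState.disseminate, LocalState.send]
    · rw [if_neg hc]
      refine ⟨.single (.advance _ b hv hb ?_ hd), .inr ⟨rfl, rfl, rfl⟩⟩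
      cases h1 : s.nullified s.view <;> cases h2 : s.voted2 s.view <;> simp_all
  · rename_i hn
    subst h
    exact ⟨.refl, .inl ⟨rfl, hn⟩⟩

theorem TimeoutReady.T_ne_zero {s : LocalState P} (h : K.TimeoutReady s) : s.T ≠ 0 := by
  have := P.one_le_Δ
  rcases h with h | h | h | h | h <;> omega

/-- The order of the instructions yields the guards of a time-out. Voting precedes it in the same
pass, so every vote that the messages `S₀` from the beginning of the slot allow has been cast before
`nullify` can be sent. Likewise proposing precedes leaving a view, which gives `OptimisticDone`. -/
theorem Pass.steps {S₀ : P.Inbox} {s s' : LocalState P} (h : K.Pass p s s') (hr : Regular s)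
    (hd : OptimisticDone p s) (hS : S₀ ⊆ s.S) :
    ReflTransGen (K.Step p S₀) s s' ∧ OptimisticDone p s' := by
  have hreg : ∀ {s1 : LocalState P}, ReflTransGen (K.Step p S₀) s s1 → Regular s1 := by
    intro s1 h1
    induction h1 with
    | refl => exact hr
    | tail _ h ih => exact ih.step h
  -- No stage-1 vote has yet been cast in a view that is just being entered, so there the condition
  -- is vacuous.
  have hvac : ∀ {s1 s2 : LocalState P}, Regular s1 → s2.view = s1.view + 1 →
      s2.voted1 = s1.voted1 → OptimisticDone p s2 := by
    intro s1 s2 hr1 hv h1 _ _ h2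
    rw [h1, hv] at h2
    have := hr1.voted1_le _ h2
    omega
  obtain ⟨s1, rfl, s2, rfl, s3, h3, s4, h4, s5, h5, s6, h6, s7, h7, s8, h8, s9, h9, rfl⟩ := h
  set s1 := s.disseminate p {m | ∃ v, m = .nCert v ∧ P.HasN s.S v ∧ ¬ P.HasN s.prevS v} with hs1
  have t1 : ReflTransGen (K.Step p S₀) s s1 := .single (.nCerts s)
  set s2 := s1.disseminate p _ with hs2
  have t2 : ReflTransGen (K.Step p S₀) s s2 := t1.tail (.certs s1)
  have hd2 : OptimisticDone p s2 := hd
  -- stage-1 voting and proposing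
  have hpost : ReflTransGen (K.Step p S₀) s2 s5 ∧ SameView s2 s5 ∧ OptimisticDone p s5 ∧
      (P.Initial s5.view → K.ReleasedVotable p S₀ s5.view → s5.voted1 s5.view = true) := by
    obtain ⟨t4, f4, e4, e4', e4'', hn4⟩ := releaseOrReplace_steps (S₀ := S₀) h4
    rcases stage1_steps (S₀ := S₀) h3 with ⟨t3, f3, e3, e3', hv3⟩ | ⟨rfl, hv3⟩
    · have hr4 : Regular s4 := hreg ((t2.trans t3).trans t4)
      rcases hv3 with ⟨hv3, hv3'⟩ | ⟨rfl, hnv⟩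
      · have h14 : s4.voted1 s4.view = true := by rw [e4', f4.view]; exact hv3'
        obtain ⟨t5, f5, e5, e5', hp5⟩ := propose_steps (S₀ := S₀) hr4 (fun _ _ => h14) h5
        refine ⟨(t3.trans t4).trans t5, (f3.trans f4).trans f5, ?_, fun _ _ => ?_⟩
        · intro hi hl _
          rw [f5.view] at hi hl ⊢
          exact hp5 (hv3.mono (Step.ext_of_reflTransGen t4).S f4.view f4.entryBlocks) hi hl
        · rw [e5', f5.view]; exact h14
      · obtain ⟨t5, f5, e5, e5', hp5⟩ := propose_steps (S₀ := S₀) hr4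
          (fun hi hv => by
            rw [hn4 (f4.view ▸ hi)] at hv
            exact absurd hv hnv) h5
        have f := f4.trans f5
        refine ⟨t4.trans t5, f, ?_, fun hi hv => ?_⟩
        · refine hd2.mono f.view (fun h => ?_)
            (Step.ext_of_reflTransGen (t4.trans t5)).proposed
          rwa [e5', e4', f.view] at h
        · rw [f.view] at hi hv
          exact absurd (hv.hasVotable (hS.trans (Step.ext_of_reflTransGen t2).S) hi) hnv
    · have hr4 : Regular s4 := hreg (t2.trans t4)
      have h14 : s4.voted1 s4.view = true := by rw [e4', f4.view]; exact hv3
      obtain ⟨t5, f5, e5, e5', hp5⟩ := propose_steps (S₀ := S₀) hr4 (fun _ _ => h14) h5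
      have f := f4.trans f5
      refine ⟨t4.trans t5, f, ?_, fun _ _ => ?_⟩
      · exact hd2.mono f.view (fun _ => hv3) (Step.ext_of_reflTransGen (t4.trans t5)).proposed
      · rw [e5', f5.view]; exact h14
  obtain ⟨t5', f5, hd5, hrv5⟩ := hpost
  have t5 := t2.trans t5'
  obtain ⟨t6', f6, e6, e6', hv6⟩ := stage2_steps (S₀ := S₀) h6
  have t6 := t5.trans t6'
  have hd6 : OptimisticDone p s6 :=
    hd5.mono f6.view (fun h => by rwa [e6, f6.view] at h) e6'.ge
  obtain ⟨t7', h7⟩ := advanceBlock_steps (S₀ := S₀) hd6 h7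
  have t7 := t6.trans t7'
  have hd7 : OptimisticDone p s7 := by
    rcases h7 with ⟨rfl, -⟩ | ⟨hv, -, h1⟩
    · exact hd6
    · exact hvac (hreg t6) hv h1
  have h8' : ReflTransGen (K.Step p S₀) s7 s8 ∧ OptimisticDone p s8 := by
    unfold timeout at h8
    split at h8
    · rename_i hc
      subst h8
      refine ⟨.single (.timeout s7 hc.1 hc.2 ?_ ?_ ?_), hd7⟩
      -- If this pass has just entered a new view, the timer is `0` and no time-out applies;
      -- otherwise nothing has changed since stage-2 voting.
      all_goals
        rcases h7 with ⟨rfl, hnb⟩ | ⟨-, hT, -⟩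
        swap
        · exact absurd hT hc.2.T_ne_zero
      · exact hnb
      · rintro ⟨b, hb, hbv⟩
        refine hv6 ⟨b, hb.mono (hS.trans (Step.ext_of_reflTransGen t5).S), ?_⟩ hc.1
        rw [hbv, f6.view]
      · intro hi hv
        rw [f6.view] at hi hv
        rw [e6, f6.view]
        exact hrv5 hi hv
    · subst h8
      exact ⟨.refl, hd7⟩
  obtain ⟨t8', hd8⟩ := h8'
  have t8 := t7.trans t8'
  unfold advanceN at h9
  split at h9
  · rename_i hc
    subst h9
    exact ⟨t8.tail (.skip s8 hc hd8), hvac (hreg t8) rfl rfl⟩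
  · subst h9
    exact ⟨t8, hd8⟩

theorem Slot.steps {S₀ : P.Inbox} {s s' : LocalState P} (h : K.Slot p s s') (hr : Regular s)
    (hd : OptimisticDone p s) (hS : S₀ ⊆ s.S) :
    ReflTransGen (K.Step p S₀) s s' ∧ Regular s' ∧ OptimisticDone p s' := by
  obtain ⟨h, -⟩ := h
  induction h with
  | refl => exact ⟨.refl, hr, hd⟩
  | tail _ h ih =>
    obtain ⟨t, hr1, hd1⟩ := ih
    obtain ⟨t', hd2⟩ := h.steps hr1 hd1 (hS.trans (Step.ext_of_reflTransGen t).S)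
    refine ⟨t.trans t', ?_, hd2⟩
    clear hd2 h
    induction t' with
    | refl => exact hr1
    | tail _ h ih => exact ih.step h

end Setup

/-! ### Executions as sequences of single state changes -/

/-- What can only grow in the course of an execution. -/
structure LocalState.Grows {P : Params} (s s' : LocalState P) : Prop where
  S : s.S ⊆ s'.S
  proposed : s.proposed ⊆ s'.proposed
  view : s.view ≤ s'.view
  voted1 : ∀ u, s.voted1 u = true → s'.voted1 u = true
  voted2 : ∀ u, s.voted2 u = true → s'.voted2 u = true
  nullified : ∀ u, s.nullified u = true → s'.nullified u = true
  secondPropose : ∀ u, s.secondPropose u = true → s'.secondPropose u = true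
  oprop : ∀ u, s.oprop u = true → s'.oprop u = true

namespace LocalState

variable {P : Params} {s s' s'' : LocalState P}

theorem Ext.grows (h : s.Ext s') : s.Grows s' :=
  ⟨h.S, h.proposed, h.view, h.voted1, h.voted2, h.nullified, h.secondPropose, h.oprop⟩

theorem Grows.trans (h : s.Grows s') (h' : s'.Grows s'') : s.Grows s'' :=
  ⟨h.S.trans h'.S, h.proposed.trans h'.proposed, h.view.trans h'.view,
    fun u => h'.voted1 u ∘ h.voted1 u, fun u => h'.voted2 u ∘ h.voted2 u,
    fun u => h'.nullified u ∘ h.nullified u, fun u => h'.secondPropose u ∘ h.secondPropose u,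
    fun u => h'.oprop u ∘ h.oprop u⟩

theorem grows_tick (s : LocalState P) (R : P.Inbox) : s.Grows (s.tick R) :=
  ⟨Set.subset_union_left, le_rfl, le_rfl, fun _ => id, fun _ => id, fun _ => id, fun _ => id,
    fun _ => id⟩

end LocalState

namespace Execution

variable {P : Params} {K : Setup P} (E : Execution K)

/-- What `p` has received from the other processors by timeslot `t`. -/
def inbox (p : P.Proc) (t : ℕ) : P.Inbox :=
  {y | y.1 ≠ p ∧ ∃ t₀, y.2 ∈ E.sent y.1 t₀ p ∧ E.arrival y.1 t₀ p y.2 ≤ t}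

/-- The state of `p` at the beginning of timeslot `t`. -/
def init (p : P.Proc) (t : ℕ) : LocalState P :=
  if t = E.start p then .first K (E.inbox p t) else (E.state p (t - 1)).tick (E.inbox p t)

/-- `s` is a state through which `p` passes at timeslot `t`. -/
structure Micro (p : P.Proc) (t : ℕ) (s : LocalState P) : Prop where
  start_le : E.start p ≤ t
  from_init : ReflTransGen (K.Step p (E.init p t).S) (E.init p t) s
  to_state : ReflTransGen (K.Step p (E.init p t).S) s (E.state p t)

variable {E} {p : P.Proc}

theorem init_start : E.init p (E.start p) = .first K (E.inbox p (E.start p)) := if_pos rfl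

theorem init_succ {t : ℕ} (ht : E.start p ≤ t) :
    E.init p (t + 1) = (E.state p t).tick (E.inbox p (t + 1)) := if_neg (by omega)

theorem slot (hp : p ∈ E.correct) {t : ℕ} (ht : E.start p ≤ t) :
    K.Slot p (E.init p t) (E.state p t) := by
  rcases ht.eq_or_lt with rfl | hlt
  · rw [init_start]
    exact E.run_start p hp
  · obtain ⟨t, rfl⟩ : ∃ u, t = u + 1 := ⟨t - 1, by omega⟩
    rw [init_succ (by omega)]
    exact E.run_step p hp t (by omega)

theorem regular_init (hp : p ∈ E.correct) {t : ℕ} (ht : E.start p ≤ t) :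
    Setup.Regular (E.init p t) ∧ Setup.OptimisticDone p (E.init p t) := by
  induction t, ht using Nat.le_induction with
  | base =>
    rw [init_start]
    refine ⟨⟨le_rfl, ?_, ?_, ?_, ?_, ?_⟩, ?_⟩ <;>
      simp [LocalState.first, Setup.OptimisticDone]
  | succ t ht ih =>
    obtain ⟨-, hr, hd⟩ := (E.slot hp ht).steps ih.1 ih.2 le_rfl
    rw [init_succ ht]
    exact ⟨hr.of_eq le_rfl rfl rfl fun _ => id, hd⟩

theorem chain (hp : p ∈ E.correct) {t : ℕ} (ht : E.start p ≤ t) :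
    ReflTransGen (K.Step p (E.init p t).S) (E.init p t) (E.state p t) :=
  ((E.slot hp ht).steps (regular_init hp ht).1 (regular_init hp ht).2 le_rfl).1

theorem micro_init (hp : p ∈ E.correct) {t : ℕ} (ht : E.start p ≤ t) :
    E.Micro p t (E.init p t) := ⟨ht, .refl, chain hp ht⟩

theorem micro_state (hp : p ∈ E.correct) {t : ℕ} (ht : E.start p ≤ t) :
    E.Micro p t (E.state p t) := ⟨ht, chain hp ht, .refl⟩

theorem quiescent (hp : p ∈ E.correct) {t : ℕ} (ht : E.start p ≤ t) :
    K.Quiescent p (E.state p t) := (slot hp ht).2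

namespace Micro

variable {t : ℕ} {s s' : LocalState P}

theorem ext_init (h : E.Micro p t s) : (E.init p t).Ext s := Setup.Step.ext_of_reflTransGen h.from_init

theorem ext_state (h : E.Micro p t s) : s.Ext (E.state p t) := Setup.Step.ext_of_reflTransGen h.to_state

/-- Induction along a timeslot. -/
theorem slot_induct {Φ : LocalState P → Prop} (h0 : Φ (E.init p t))
    (hstep : ∀ s s', E.Micro p t s → E.Micro p t s' → K.Step p (E.init p t).S s s' → Φ s → Φ s')
    (h : E.Micro p t s) : Φ s := by
  obtain ⟨ht, h1, h2⟩ := h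
  induction h1 with
  | refl => exact h0
  | tail h1 hs ih => exact hstep _ _ ⟨ht, h1, h2.head hs⟩ ⟨ht, h1.tail hs, h2⟩ hs (ih (h2.head hs))

/-- Induction along an execution. -/
theorem induct (hp : p ∈ E.correct) {Φ : ℕ → LocalState P → Prop}
    (hfirst : Φ (E.start p) (.first K (E.inbox p (E.start p))))
    (htick : ∀ t, E.start p ≤ t → Φ t (E.state p t) →
      Φ (t + 1) ((E.state p t).tick (E.inbox p (t + 1))))
    (hstep : ∀ t s s', E.Micro p t s → E.Micro p t s' → K.Step p (E.init p t).S s s' →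
      Φ t s → Φ t s')
    (h : E.Micro p t s) : Φ t s := by
  have key : Φ t (E.init p t) := by
    have ht := h.start_le
    clear h
    induction t, ht using Nat.le_induction with
    | base => rw [init_start]; exact hfirst
    | succ t ht ih =>
      rw [init_succ ht]
      exact htick t ht (slot_induct ih (hstep t) (micro_state hp ht))
  exact slot_induct key (hstep t) h

theorem regular (hp : p ∈ E.correct) (h : E.Micro p t s) : Setup.Regular s :=
  slot_induct (regular_init hp h.start_le).1 (fun _ _ _ _ hs hr => hr.step hs) h

end Micro

theorem grows_state (hp : p ∈ E.correct) {t t' : ℕ} (ht : E.start p ≤ t) (htt : t ≤ t') :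
    (E.state p t).Grows (E.state p t') := by
  induction t', htt using Nat.le_induction with
  | base => exact (LocalState.Ext.refl _).grows
  | succ t' htt ih =>
    have := (micro_init hp (by omega : E.start p ≤ t' + 1)).ext_state.grows
    rw [init_succ (by omega)] at this
    exact (ih.trans (LocalState.grows_tick _ _)).trans this

theorem grows_init (hp : p ∈ E.correct) {t t' : ℕ} (ht : E.start p ≤ t) (htt : t < t') :
    (E.state p t).Grows (E.init p t') := by
  obtain ⟨t', rfl⟩ : ∃ u, t' = u + 1 := ⟨t' - 1, by omega⟩
  rw [init_succ (by omega)]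
  exact (grows_state hp ht (by omega)).trans (LocalState.grows_tick _ _)

theorem Micro.grows (hp : p ∈ E.correct) {t t' : ℕ} {s : LocalState P} (h : E.Micro p t s)
    (htt : t ≤ t') : s.Grows (E.state p t') :=
  h.ext_state.grows.trans (grows_state hp h.start_le htt)

theorem Micro.grows_of_lt (hp : p ∈ E.correct) {t t' : ℕ} {s s' : LocalState P}
    (h : E.Micro p t s) (h' : E.Micro p t' s') (htt : t < t') : s.Grows s' :=
  (h.ext_state.grows.trans (grows_init hp h.start_le htt)).trans h'.ext_init.grows

/-! ### Sending and receiving -/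

theorem start_le_of_sent (hp : p ∈ E.correct) {t : ℕ} {q : P.Proc} {m : Msg P.n}
    (h : m ∈ E.sent p t q) : E.start p ≤ t := by
  by_contra hlt
  rw [E.sent_before p hp t (by omega) q] at h
  exact h

theorem init_out (t : ℕ) : (E.init p t).out = ∅ := by
  unfold init
  split <;> rfl

theorem Micro.sent_of_out (hp : p ∈ E.correct) {t : ℕ} {s : LocalState P} (h : E.Micro p t s)
    {q : P.Proc} {m : Msg P.n} (hm : (q, m) ∈ s.out) : m ∈ E.sent p t q := by
  rw [E.sent_eq p hp t h.start_le q]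
  exact h.ext_state.out hm

/-- Every message of a correct processor is sent by one of its steps. -/
theorem sent_origin (hp : p ∈ E.correct) {t : ℕ} {q : P.Proc} {m : Msg P.n}
    (h : m ∈ E.sent p t q) : ∃ s s', E.Micro p t s ∧ E.Micro p t s' ∧
      K.Step p (E.init p t).S s s' ∧ (q, m) ∉ s.out ∧ (q, m) ∈ s'.out := by
  have ht := start_le_of_sent hp h
  by_contra hno
  push Not at hno
  have : (q, m) ∉ (E.state p t).out :=
    Micro.slot_induct (Φ := fun s => (q, m) ∉ s.out) (by simp [init_out])
      (fun s s' h h' hs hm => hno s s' h h' hs hm) (micro_state hp ht)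
  rw [E.sent_eq p hp t ht q] at h
  exact this h

theorem Micro.self_sent {t : ℕ} {s : LocalState P} (h : E.Micro p t s) :
    (∀ y ∈ s.S, y ∈ (E.init p t).S ∨ y.1 = p ∧ (p, y.2) ∈ s.out) ∧
      ∀ m, (p, m) ∈ s.out → (p, m) ∈ s.S := by
  refine slot_induct (Φ := fun s => (∀ y ∈ s.S, y ∈ (E.init p t).S ∨ y.1 = p ∧ (p, y.2) ∈ s.out) ∧
    ∀ m, (p, m) ∈ s.out → (p, m) ∈ s.S) ⟨fun _ => .inl, by simp [init_out]⟩ ?_ h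
  rintro s s' - - hs ⟨h1, h2⟩
  obtain ⟨h3, h4⟩ := hs.self_sent
  refine ⟨fun y hy => ?_, fun m hm => ?_⟩
  · rcases h3 y hy with hy | hy
    · exact (h1 y hy).imp id fun h => ⟨h.1, hs.ext.out h.2⟩
    · exact .inr hy
  · exact (h4 m hm).elim (fun h => hs.ext.S (h2 m h)) id

/-- The bound on the sending time is strict because delays are positive and self-addressed messages
of this slot are not yet there. This drives the induction on time in `honestVote_of_vote2`. -/
theorem sent_of_mem_init (hp : p ∈ E.correct) {t : ℕ} (ht : E.start p ≤ t) :
    ∀ y ∈ (E.init p t).S, ∃ t₀ < t, y.2 ∈ E.sent y.1 t₀ p := by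
  have hin : ∀ t, ∀ y ∈ E.inbox p t, ∃ t₀ < t, y.2 ∈ E.sent y.1 t₀ p := by
    rintro t y ⟨-, t₀, h, ha⟩
    exact ⟨t₀, (E.arrival_gt _ _ _ _ h).trans_le ha, h⟩
  induction t, ht using Nat.le_induction with
  | base => rw [init_start]; exact hin _
  | succ t ht ih =>
    rw [init_succ ht]
    rintro y (hy | hy)
    · rcases (micro_state hp ht).self_sent.1 y hy with h | ⟨h, h'⟩
      · obtain ⟨t₀, h1, h2⟩ := ih y h
        exact ⟨t₀, by omega, h2⟩
      · exact ⟨t, by omega, h ▸ (micro_state hp ht).sent_of_out hp h'⟩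
    · exact hin _ y hy

theorem Micro.sent_of_mem (hp : p ∈ E.correct) {t : ℕ} {s : LocalState P} (h : E.Micro p t s) :
    ∀ y ∈ s.S, ∃ t₀ ≤ t, y.2 ∈ E.sent y.1 t₀ p := by
  intro y hy
  rcases h.self_sent.1 y hy with h' | ⟨h', h''⟩
  · obtain ⟨t₀, h1, h2⟩ := sent_of_mem_init hp h.start_le y h'
    exact ⟨t₀, h1.le, h2⟩
  · exact ⟨t, le_rfl, h' ▸ h.sent_of_out hp h''⟩

theorem Micro.received_sent (hp : p ∈ E.correct) {t : ℕ} {s : LocalState P} (h : E.Micro p t s)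
    {m : Msg P.n} (hm : P.Received s.S m) : ∃ q, ∃ t₀ ≤ t, m ∈ E.sent q t₀ p :=
  let ⟨q, hq⟩ := hm
  ⟨q, h.sent_of_mem hp _ hq⟩

/-- Messages between correct processors arrive in time. -/
theorem mem_init_of_sent {q : P.Proc} (hp : p ∈ E.correct) (hq : q ∈ E.correct) {t t' : ℕ}
    {m : Msg P.n} (h : m ∈ E.sent q t p) (ht' : E.GST + P.Δ ≤ t') (htt : t + P.Δ ≤ t') :
    (q, m) ∈ (E.init p t').S := by
  have hst := E.start_le p hp
  have hΔ := P.one_le_Δ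
  -- Self-addressed messages are not in `inbox`; they were stored on sending and are never lost.
  by_cases hqp : q = p
  · subst hqp
    have ht := start_le_of_sent hq h
    rw [E.sent_eq q hq t ht q] at h
    exact (grows_init hq ht (by omega)).S ((micro_state hq ht).self_sent.2 m h)
  · have hin : (q, m) ∈ E.inbox p t' :=
      ⟨hqp, t, h, (E.arrival_le q t p m h).trans (by omega)⟩
    unfold init
    split
    · exact hin
    · exact .inr hin

end Execution

namespace Setup

variable {P : Params} {K : Setup P} {p : P.Proc}

theorem SendBlock.out {v : ℕ} {par : Block} {rel : Prop} {s s' : LocalState P}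
    (h : K.SendBlock p v par rel s s') {q : P.Proc} {m : Msg P.n} (hm : (q, m) ∈ s'.out) :
    (q, m) ∈ s.out ∨ (∃ b j c π, m = .frag b j c π) ∨
      ∃ b, rel ∧ m = .release b ∧ b.view = v ∧ K.H (.block par) = b.par ∧
        (b, s.secondPropose (P.superview v)) ∈ s'.proposed := by
  obtain ⟨C, k, b, -, hb, rfl⟩ := h
  rcases hm with hm | hm | ⟨hr, hm⟩
  · exact .inl hm
  · exact .inr (.inl ⟨_, _, _, _, hm⟩)
  · exact .inr (.inr ⟨b, hr, hm, by rw [hb], by rw [hb], .inl rfl⟩)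

end Setup

namespace Execution

variable {P : Params} {K : Setup P} {E : Execution K} {p : P.Proc}

/-! ### Why correct processors send messages -/

theorem vote1_origin (hp : p ∈ E.correct) {t : ℕ} {q j : P.Proc} {b : Block}
    (h : Msg.vote1 b j ∈ E.sent p t q) :
    j = p ∧ ∃ s c π, E.Micro p t s ∧ K.Votable p s b c π := by
  obtain ⟨s, s', h1, -, hs, hn, hm⟩ := sent_origin hp h
  cases hs with
  | optimistic _ _ _ _ _ hs => simpa [hn] using hs.out hm
  | fresh _ _ _ _ hs => simpa [hn] using hs.out hm
  | later _ _ _ _ _ _ hs => simpa [hn] using hs.out hm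
  | vote1 b' c π hb =>
    have : b = b' ∧ j = p := by
      simpa [LocalState.disseminate, LocalState.send, hn] using hm
    obtain ⟨rfl, rfl⟩ := this
    exact ⟨rfl, s, c, π, h1, hb⟩
  | _ => simp [LocalState.disseminate, LocalState.send, Setup.castVote2,
      LocalState.enterNext, hn] at hm

theorem vote2_origin (hp : p ∈ E.correct) {t : ℕ} {q j : P.Proc} {b : Block}
    (h : Msg.vote2 b j ∈ E.sent p t q) :
    j = p ∧ ∃ s, E.Micro p t s ∧ b.view = s.view ∧
      (K.InBlocksStar s.S b ∨ K.InBlocks s.S b) := by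
  obtain ⟨s, s', h1, -, hs, hn, hm⟩ := sent_origin hp h
  cases hs with
  | optimistic _ _ _ _ _ hs => simpa [hn] using hs.out hm
  | fresh _ _ _ _ hs => simpa [hn] using hs.out hm
  | later _ _ _ _ _ _ hs => simpa [hn] using hs.out hm
  | vote2 b' hv hb =>
    have : b = b' ∧ j = p := by
      simpa [LocalState.disseminate, LocalState.send, Setup.castVote2, hn] using hm
    obtain ⟨rfl, rfl⟩ := this
    exact ⟨rfl, s, h1, hv, hb⟩
  | _ => simp [LocalState.disseminate, LocalState.send, LocalState.enterNext, hn] at hm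

/-- Besides the time-out itself this retains what the processor had failed to obtain. These failures
are what the schedule of the initial view contradicts. -/
theorem nullify_origin (hp : p ∈ E.correct) {t : ℕ} {q j : P.Proc} {v : ℕ}
    (h : Msg.nullify v j ∈ E.sent p t q) :
    j = p ∧ ∃ s, E.Micro p t s ∧ s.view ≤ v ∧ P.superview v = P.superview s.view ∧
      K.TimeoutReady s ∧ (¬ ∃ b, K.InBlocks s.S b ∧ b.view = s.view) ∧
      ((∃ b, K.InBlocksStar (E.init p t).S b ∧ b.view = s.view) → s.voted2 s.view = true) ∧
      (P.Initial s.view → K.ReleasedVotable p (E.init p t).S s.view →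
        s.voted1 s.view = true) := by
  obtain ⟨s, s', h1, -, hs, hn, hm⟩ := sent_origin hp h
  cases hs with
  | optimistic _ _ _ _ _ hs => simpa [hn] using hs.out hm
  | fresh _ _ _ _ hs => simpa [hn] using hs.out hm
  | later _ _ _ _ _ _ hs => simpa [hn] using hs.out hm
  | timeout h0 hT hb hb' hv =>
    obtain ⟨u, hu, hw, hm⟩ := hm.resolve_left hn
    obtain ⟨rfl, rfl⟩ := Msg.nullify.inj hm
    exact ⟨rfl, s, h1, hu, hw, hT, hb, hb', hv⟩
  | _ => simp [LocalState.disseminate, LocalState.send, LocalState.enterNext,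
      Setup.castVote2, hn] at hm

theorem release_origin (hp : p ∈ E.correct) {t : ℕ} {q : P.Proc} {b : Block}
    (h : Msg.release b ∈ E.sent p t q) :
    ∃ s s', E.Micro p t s ∧ E.Micro p t s' ∧ b.view = s.view ∧
      ((s.oprop s.view = true ∧ s.T = 2 * P.Δ ∧ K.InBlocks s.S s.opar ∧
          ∃ o, (b, o) ∈ s.proposed) ∨
        (¬ ∃ v', s.ProposedSince v') ∧
          (b, s.secondPropose (P.superview s.view)) ∈ s'.proposed) := by
  obtain ⟨s, s', h1, h2, hs, hn, hm⟩ := sent_origin hp h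
  cases hs with
  | optimistic _ _ _ _ _ hs => simpa [hn] using hs.out hm
  | fresh _ hi hl hno hs =>
    obtain ⟨b', -, hb, hv, -, hpr⟩ := ((hs.out hm).resolve_left hn).resolve_left (by simp)
    obtain rfl := Msg.release.inj hb
    exact ⟨s, s', h1, h2, hv, .inr ⟨hno, hpr⟩⟩
  | later _ _ _ _ _ _ hs => simpa [hn] using hs.out hm
  | release hi hl ho hT hb =>
    obtain ⟨b', o, hb', hv, hm⟩ := hm.resolve_left hn
    obtain rfl := Msg.release.inj hm
    exact ⟨s, _, h1, h2, hv, .inl ⟨ho, hT, hb, o, hb'⟩⟩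
  | _ => simp [LocalState.disseminate, LocalState.send, LocalState.enterNext,
      Setup.castVote2, hn] at hm

/-! ### Certificates are passed on -/

theorem init_prevS (hp : p ∈ E.correct) {t : ℕ} (ht : E.start p ≤ t) :
    (E.state p t).prevS = ∅ ∨ ∃ u, t = u + 1 ∧ E.start p ≤ u ∧
      (E.state p t).prevS = (E.state p u).S := by
  rw [(micro_state hp ht).ext_init.prevS]
  rcases ht.eq_or_lt with rfl | hlt
  · rw [init_start]
    exact .inl rfl
  · obtain ⟨u, rfl⟩ : ∃ u, t = u + 1 := ⟨t - 1, by omega⟩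
    rw [init_succ (by omega)]
    exact .inr ⟨u, rfl, by omega, rfl⟩

/-- At the first slot that ends with the certificate, `prevS` lacks it. Dissemination has no further
effect at the end of that slot, so the certificate is already among the messages sent. -/
theorem hasN_sent (hp : p ∈ E.correct) {t : ℕ} (ht : E.start p ≤ t) {v : ℕ}
    (h : P.HasN (E.state p t).S v) : ∃ t₀ ≤ t, ∀ q, Msg.nCert v ∈ E.sent p t₀ q := by
  induction t using Nat.strong_induction_on with
  | _ t ih =>
    by_cases hprev : P.HasN (E.state p t).prevS v
    · rcases init_prevS hp ht with he | ⟨u, rfl, hu, he⟩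
      · exact absurd (he ▸ hprev) (Params.not_hasN_empty v)
      · obtain ⟨t₀, h1, h2⟩ := ih u (by omega) hu (he ▸ hprev)
        exact ⟨t₀, by omega, h2⟩
    · refine ⟨t, le_rfl, fun q => ?_⟩
      have hq : Setup.disseminateN p (E.state p t) (E.state p t) :=
        quiescent hp ht _ (by simp [Setup.instructions])
      unfold Setup.disseminateN at hq
      rw [E.sent_eq p hp t ht q, Set.mem_ofPred_eq, hq]
      exact .inr ⟨v, rfl, h, hprev⟩

theorem hasM_sent (hp : p ∈ E.correct) {t : ℕ} (ht : E.start p ≤ t) {b : Block}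
    (h : P.HasM (E.state p t).S b) : ∃ t₀ ≤ t, ∀ q, Msg.mCert b ∈ E.sent p t₀ q := by
  induction t using Nat.strong_induction_on with
  | _ t ih =>
    by_cases hprev : P.HasM (E.state p t).prevS b
    · rcases init_prevS hp ht with he | ⟨u, rfl, hu, he⟩
      · exact absurd (he ▸ hprev) (Params.not_hasM_empty b)
      · obtain ⟨t₀, h1, h2⟩ := ih u (by omega) hu (he ▸ hprev)
        exact ⟨t₀, by omega, h2⟩
    · refine ⟨t, le_rfl, fun q => ?_⟩
      have hq : Setup.disseminateM p (E.state p t) (E.state p t) :=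
        quiescent hp ht _ (by simp [Setup.instructions])
      unfold Setup.disseminateM at hq
      rw [E.sent_eq p hp t ht q, Set.mem_ofPred_eq, hq]
      exact .inr (.inr ⟨b, rfl, h, hprev⟩)

theorem Micro.hasN_init {q : P.Proc} (hp : p ∈ E.correct) (hq : q ∈ E.correct)
    {t t' : ℕ} {s : LocalState P} (h : E.Micro q t s) {v : ℕ} (hv : P.HasN s.S v)
    (ht' : E.GST + P.Δ ≤ t') (htt : t + P.Δ ≤ t') : P.HasN (E.init p t').S v :=
  let ⟨_, h1, h2⟩ := hasN_sent hq h.start_le (hv.mono h.ext_state.S)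
  .inl ⟨q, mem_init_of_sent hp hq (h2 p) ht' (by omega)⟩

/-- Membership in `blocks` rests on M-certificates for the whole ancestry, and each of them has been
passed on. -/
theorem Micro.inBlocks_init {q : P.Proc} (hp : p ∈ E.correct) (hq : q ∈ E.correct)
    {t t' : ℕ} {s : LocalState P} (h : E.Micro q t s) {b : Block} (hb : K.InBlocks s.S b)
    (ht' : E.GST + P.Δ ≤ t') (htt : t + P.Δ ≤ t') : K.InBlocks (E.init p t').S b := by
  induction hb with
  | genesis => exact .genesis
  | child b b' hb hM _ hpar ih =>
    obtain ⟨_, h1, h2⟩ := hasM_sent hq h.start_le (hM.mono h.ext_state.S)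
    exact .child b b' hb (.inl ⟨q, mem_init_of_sent hp hq (h2 p) ht' (by omega)⟩) ih hpar

/-! ### The local variables -/

/-- The certificates let other processors follow. The clause on flags shows later that whoever left
the view without nullifying it has cast a stage-2 vote. -/
theorem Micro.left_view (hp : p ∈ E.correct) {t : ℕ} {s : LocalState P} (h : E.Micro p t s) :
    ∀ u, 1 ≤ u → u < s.view → P.HasN s.S u ∨
      (∃ b, K.InBlocks s.S b ∧ b.view = u) ∧ (s.voted2 u = true ∨ s.nullified u = true) := by
  refine h.induct hp (Φ := fun _ s => ∀ u, 1 ≤ u → u < s.view → P.HasN s.S u ∨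
      (∃ b, K.InBlocks s.S b ∧ b.view = u) ∧ (s.voted2 u = true ∨ s.nullified u = true)) ?_ ?_ ?_
  · intro u hu hlt
    simp only [LocalState.first] at hlt
    omega
  · intro t ht ih u hu hlt
    exact (ih u hu hlt).imp (.mono Set.subset_union_left)
      (.imp_left fun ⟨b, hb, hv⟩ => ⟨b, hb.mono Set.subset_union_left, hv⟩)
  · rintro t s s' - - hs ih u hu hlt
    have he := hs.ext
    have hmono : u < s.view → P.HasN s'.S u ∨
        (∃ b, K.InBlocks s'.S b ∧ b.view = u) ∧
          (s'.voted2 u = true ∨ s'.nullified u = true) := fun h =>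
      (ih u hu h).imp (.mono he.S) (.imp (fun ⟨b, hb, hv⟩ => ⟨b, hb.mono he.S, hv⟩)
        (.imp (he.voted2 u) (he.nullified u)))
    cases hs with
    | advance b hv hb h2 =>
      rcases Nat.lt_or_ge u s.view with h' | h'
      · exact hmono h'
      · have : u < s.view + 1 := hlt
        obtain rfl : u = s.view := by omega
        exact .inr ⟨⟨b, hb, hv⟩, h2⟩
    | skip hN =>
      rcases Nat.lt_or_ge u s.view with h' | h'
      · exact hmono h'
      · have : u < s.view + 1 := hlt
        obtain rfl : u = s.view := by omega
        exact .inl hN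
    | optimistic _ _ _ _ _ hs => exact hmono (hs.sameView.1.view ▸ hlt)
    | fresh _ _ _ _ hs => exact hmono (hs.sameView.1.view ▸ hlt)
    | later _ _ _ _ _ _ hs => exact hmono (hs.sameView.1.view ▸ hlt)
    | _ => exact hmono hlt

end Execution

namespace Setup

variable {P : Params} {K : Setup P} {p : P.Proc}

/-- A step stays in the present view or enters the next one. -/
theorem Step.view_cases {S₀ : P.Inbox} {s s' : LocalState P} (h : K.Step p S₀ s s') :
    (s'.view = s.view ∧ s'.T = s.T ∧ s'.entryBlocks = s.entryBlocks ∧ s'.b = s.b) ∨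
      (s'.view = s.view + 1 ∧ s'.T = 0 ∧ s'.entryBlocks = {b | K.InBlocks s'.S b} ∧
        (s'.b.view = s.view ∧ K.InBlocks s'.S s'.b ∨ s'.b = s.b ∧ P.HasN s'.S s.view)) := by
  have key : ∀ {v par rel}, K.SendBlock p v par rel s s' →
      s'.view = s.view ∧ s'.T = s.T ∧ s'.entryBlocks = s.entryBlocks ∧ s'.b = s.b := by
    rintro v par rel ⟨C, k, b, -, -, rfl⟩
    exact ⟨rfl, rfl, rfl, rfl⟩
  cases h with
  | optimistic _ _ _ _ _ hs => exact .inl (key hs)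
  | fresh _ _ _ _ hs => exact .inl (key hs)
  | later _ _ _ _ _ _ hs => exact .inl (key hs)
  | advance b hv hb => exact .inr ⟨rfl, rfl, rfl, .inl ⟨hv, hb⟩⟩
  | skip hN => exact .inr ⟨rfl, rfl, rfl, .inr ⟨rfl, hN⟩⟩
  | _ => exact .inl ⟨rfl, rfl, rfl, rfl⟩

end Setup

namespace Execution

variable {P : Params} {K : Setup P} {E : Execution K} {p : P.Proc}

/-! ### Views and timers -/

theorem viewAt_eq {t : ℕ} (ht : E.start p ≤ t) : E.viewAt p t = (E.state p t).view :=
  if_neg (by omega)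

theorem start_le_of_viewAt {t : ℕ} (h : 1 ≤ E.viewAt p t) : E.start p ≤ t := by
  by_contra hlt
  rw [viewAt, if_pos (by omega)] at h
  omega

theorem viewAt_mono (hp : p ∈ E.correct) {t t' : ℕ} (h : t ≤ t') :
    E.viewAt p t ≤ E.viewAt p t' := by
  by_cases hs : E.start p ≤ t
  · rw [viewAt_eq hs, viewAt_eq (hs.trans h)]
    exact (grows_state hp hs h).view
  · rw [viewAt, if_pos (by omega)]
    exact Nat.zero_le _

theorem exists_enters {v t : ℕ} (h : v ≤ E.viewAt p t) : ∃ t' ≤ t, E.Enters p v t' := by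
  classical
  have hex : ∃ t, v ≤ E.viewAt p t := ⟨t, h⟩
  exact ⟨Nat.find hex, Nat.find_min' hex h, Nat.find_spec hex,
    fun t' ht' => not_le.1 (Nat.find_min hex ht')⟩

theorem Enters.unique {v t t' : ℕ} (h : E.Enters p v t) (h' : E.Enters p v t') : t = t' := by
  rcases lt_trichotomy t t' with hlt | heq | hlt
  · exact absurd h.1 (not_le.2 (h'.2 t hlt))
  · exact heq
  · exact absurd h'.1 (not_le.2 (h.2 t' hlt))

theorem Micro.viewAt_le (hp : p ∈ E.correct) {t t' : ℕ} {s : LocalState P} (h : E.Micro p t s)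
    (ht : t' < t) : E.viewAt p t' ≤ s.view := by
  by_cases hs : E.start p ≤ t'
  · rw [viewAt_eq hs]
    exact ((micro_state hp hs).grows_of_lt hp h ht).view
  · rw [viewAt, if_pos (by omega)]
    exact Nat.zero_le _

theorem Micro.le_viewAt {t : ℕ} {s : LocalState P} (h : E.Micro p t s) :
    s.view ≤ E.viewAt p t := by
  rw [viewAt_eq h.start_le]
  exact h.ext_state.view

/-- The timer shows the time since the present view was entered. -/
theorem Micro.timer (hp : p ∈ E.correct) {t : ℕ} {s : LocalState P} (h : E.Micro p t s) :
    ∃ e, e + s.T = t ∧ E.start p ≤ e ∧ E.Enters p s.view e ∧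
      (∀ b ∈ s.entryBlocks, K.InBlocks (E.state p e).S b ∧ K.InBlocks s.S b) := by
  refine h.induct hp (Φ := fun t s => ∃ e, e + s.T = t ∧ E.start p ≤ e ∧ E.Enters p s.view e ∧
      (∀ b ∈ s.entryBlocks, K.InBlocks (E.state p e).S b ∧ K.InBlocks s.S b)) ?_ ?_ ?_
  · refine ⟨E.start p, rfl, le_rfl, ⟨?_, fun t' ht' => ?_⟩, fun b hb => ⟨?_, hb⟩⟩
    · have := (micro_init hp le_rfl).le_viewAt
      rwa [init_start] at this
    · simp [viewAt, ht', LocalState.first]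
    · have := (micro_init hp (le_refl (E.start p))).ext_state.S
      rw [init_start] at this
      exact Setup.InBlocks.mono this hb
  · rintro t ht ⟨e, h1, h2, h3, h4⟩
    exact ⟨e, by simp only [LocalState.tick]; omega, h2, h3, fun b hb =>
      ⟨(h4 b hb).1, (h4 b hb).2.mono Set.subset_union_left⟩⟩
  · rintro t s s' hm hm' hs ⟨e, h1, h2, h3, h4⟩
    rcases hs.view_cases with ⟨hv, hT, hb, -⟩ | ⟨hv, hT, hb, -⟩
    · rw [hv, hT, hb]
      exact ⟨e, h1, h2, h3, fun b hb => ⟨(h4 b hb).1, (h4 b hb).2.mono hs.ext.S⟩⟩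
    · rw [hT, hb]
      refine ⟨t, rfl, hm.start_le, ⟨hm'.le_viewAt, fun t' ht' => ?_⟩, fun b hb => ⟨?_, hb⟩⟩
      · have := hm.viewAt_le hp ht'
        omega
      · exact Setup.InBlocks.mono hm'.ext_state.S hb

theorem Micro.add_T_eq (hp : p ∈ E.correct) {t e v : ℕ} {s : LocalState P} (h : E.Micro p t s)
    (hv : s.view = v) (he : E.Enters p v e) : e + s.T = t := by
  obtain ⟨e', h1, -, h3, -⟩ := h.timer hp
  rw [hv] at h3
  rwa [he.unique h3]

/-- The parent that a processor would choose in Case 2 of `ProposeReady`. -/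
theorem Micro.b_spec (hp : p ∈ E.correct) {t : ℕ} {s : LocalState P} (h : E.Micro p t s) :
    K.InBlocks s.S s.b ∧ s.b.view < s.view ∧
      ∀ u, s.b.view < u → u < s.view → P.HasN s.S u := by
  refine h.induct hp (Φ := fun _ s => K.InBlocks s.S s.b ∧ s.b.view < s.view ∧
      ∀ u, s.b.view < u → u < s.view → P.HasN s.S u) ?_ ?_ ?_
  · refine ⟨.genesis, Nat.zero_lt_one, fun u h1 h2 => ?_⟩
    simp only [LocalState.first, Setup.genesis] at h1 h2
    omega
  · rintro t - ⟨h1, h2, h3⟩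
    exact ⟨h1.mono Set.subset_union_left, h2, fun u hu hu' =>
      (h3 u hu hu').mono Set.subset_union_left⟩
  · rintro t s s' - - hs ⟨h1, h2, h3⟩
    have he := hs.ext.S
    rcases hs.view_cases with ⟨hv, -, -, hb⟩ | ⟨hv, -, -, ⟨hb, hb'⟩ | ⟨hb, hN⟩⟩
    · rw [hv, hb]
      exact ⟨h1.mono he, h2, fun u hu hu' => (h3 u hu hu').mono he⟩
    · exact ⟨hb', by omega, fun u hu hu' => by omega⟩
    · rw [hv, hb]
      refine ⟨h1.mono he, by omega, fun u hu hu' => ?_⟩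
      rcases Nat.lt_or_ge u s.view with hlt | hge
      · exact (h3 u hu hlt).mono he
      · obtain rfl : u = s.view := by omega
        exact hN

/-! ### Votes -/

/-- Turns the flag back into the messages sent when it was set, which are what other processors can
count. -/
theorem Micro.voted1_spec (hp : p ∈ E.correct) {t : ℕ} {s : LocalState P} (h : E.Micro p t s) :
    ∀ u, s.voted1 u = true → ∃ b c π, P.IsBlock b ∧ b.view = u ∧ K.Certified b.tag p c π ∧
      (∃ b', K.H (.block b') = b.par ∧ K.InBlocks s.S b') ∧
      ∃ t₀ ≤ t, (∀ q, Msg.vote1 b p ∈ E.sent p t₀ q) ∧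
        (p ≠ P.lead (u + 1) → ∀ q, Msg.frag b p c π ∈ E.sent p t₀ q) := by
  refine h.induct hp (Φ := fun t s => ∀ u, s.voted1 u = true → ∃ b c π, P.IsBlock b ∧ b.view = u ∧
      K.Certified b.tag p c π ∧ (∃ b', K.H (.block b') = b.par ∧ K.InBlocks s.S b') ∧
      ∃ t₀ ≤ t, (∀ q, Msg.vote1 b p ∈ E.sent p t₀ q) ∧
        (p ≠ P.lead (u + 1) → ∀ q, Msg.frag b p c π ∈ E.sent p t₀ q)) ?_ ?_ ?_
  · simp [LocalState.first]
  · intro t ht ih u hu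
    obtain ⟨b, c, π, h1, h2, h3, ⟨b', h4, h5⟩, t₀, h6, h7⟩ := ih u hu
    exact ⟨b, c, π, h1, h2, h3, ⟨b', h4, h5.mono Set.subset_union_left⟩, t₀, by omega, h7⟩
  · intro t s s' hm hm' hs ih u hu
    have hmono : s.voted1 u = true → ∃ b c π, P.IsBlock b ∧ b.view = u ∧
        K.Certified b.tag p c π ∧ (∃ b', K.H (.block b') = b.par ∧ K.InBlocks s'.S b') ∧
        ∃ t₀ ≤ t, (∀ q, Msg.vote1 b p ∈ E.sent p t₀ q) ∧
        (p ≠ P.lead (u + 1) → ∀ q, Msg.frag b p c π ∈ E.sent p t₀ q) := by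
      intro hu
      obtain ⟨b, c, π, h1, h2, h3, ⟨b', h4, h5⟩, h⟩ := ih u hu
      exact ⟨b, c, π, h1, h2, h3, ⟨b', h4, h5.mono hs.ext.S⟩, h⟩
    have he := hs.ext.S
    cases hs with
    | optimistic _ _ _ _ _ hs => exact hmono (hs.sameView.2.2.1 ▸ hu)
    | fresh _ _ _ _ hs => exact hmono (hs.sameView.2.2.1 ▸ hu)
    | later _ _ _ _ _ _ hs => exact hmono (hs.sameView.2.2.1 ▸ hu)
    | vote1 b c π hb hv =>
      by_cases huv : u = s.view
      · subst huv
        obtain ⟨h1, h2, -, h4, b', h6, -, h8, -⟩ := hb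
        -- Only the middle way of being votable speaks of the past; the timer invariant carries
        -- blocks known on entry to the present.
        have hpar : K.InBlocks s.S b' := by
          rcases h8 with h8 | h8 | h8
          · exact h8.2
          · obtain ⟨_, -, -, -, h9⟩ := hm.timer hp
            exact (h9 b' h8.2).2
          · exact h8.2.2
        refine ⟨b, c, π, h1, h2, h4, ⟨b', h6, hpar.mono he⟩, t, le_rfl, fun q => ?_, fun hl q => ?_⟩
        · exact hm'.sent_of_out hp (.inr (.inl rfl))
        · exact hm'.sent_of_out hp (.inr (.inr ⟨hl, rfl⟩))
      · exact hmono (by simpa [huv] using hu)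
    | _ => exact hmono hu

theorem Micro.voted2_spec (hp : p ∈ E.correct) {t : ℕ} {s : LocalState P} (h : E.Micro p t s) :
    ∀ u, s.voted2 u = true → ∃ b, P.IsBlock b ∧ b.view = u ∧
      (∃ b', K.H (.block b') = b.par ∧ K.InBlocks s.S b') ∧
      ∃ t₀ ≤ t, ∀ q, Msg.vote2 b p ∈ E.sent p t₀ q := by
  refine h.induct hp (Φ := fun t s => ∀ u, s.voted2 u = true → ∃ b, P.IsBlock b ∧ b.view = u ∧
      (∃ b', K.H (.block b') = b.par ∧ K.InBlocks s.S b') ∧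
      ∃ t₀ ≤ t, ∀ q, Msg.vote2 b p ∈ E.sent p t₀ q) ?_ ?_ ?_
  · simp [LocalState.first]
  · intro t ht ih u hu
    obtain ⟨b, h1, h2, ⟨b', h4, h5⟩, t₀, h6, h7⟩ := ih u hu
    exact ⟨b, h1, h2, ⟨b', h4, h5.mono Set.subset_union_left⟩, t₀, by omega, h7⟩
  · intro t s s' hm hm' hs ih u hu
    have hmono : s.voted2 u = true → ∃ b, P.IsBlock b ∧ b.view = u ∧
        (∃ b', K.H (.block b') = b.par ∧ K.InBlocks s'.S b') ∧
        ∃ t₀ ≤ t, ∀ q, Msg.vote2 b p ∈ E.sent p t₀ q := by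
      intro hu
      obtain ⟨b, h1, h2, ⟨b', h4, h5⟩, h⟩ := ih u hu
      exact ⟨b, h1, h2, ⟨b', h4, h5.mono hs.ext.S⟩, h⟩
    have he := hs.ext.S
    cases hs with
    | optimistic _ _ _ _ _ hs => exact hmono (hs.sameView.2.1 ▸ hu)
    | fresh _ _ _ _ hs => exact hmono (hs.sameView.2.1 ▸ hu)
    | later _ _ _ _ _ _ hs => exact hmono (hs.sameView.2.1 ▸ hu)
    | vote2 b hv hb =>
      by_cases huv : u = s.view
      · subst huv
        have h1 : 1 ≤ b.view := hv ▸ (hm.regular hp).one_le_view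
        have hpar : P.IsBlock b ∧ ∃ b', K.H (.block b') = b.par ∧ K.InBlocks s.S b' :=
          hb.elim (fun h => ⟨(h.of_one_le h1).1, (h.of_one_le h1).2.2⟩)
            fun h => ⟨(h.of_one_le h1).1, (h.of_one_le h1).2.2⟩
        obtain ⟨hbl, b', h6, hpar⟩ := hpar
        exact ⟨b, hbl, hv, ⟨b', h6, hpar.mono he⟩, t, le_rfl,
          fun q => hm'.sent_of_out hp (.inr rfl)⟩
      · exact hmono (by simpa [Setup.castVote2, huv] using hu)
    | _ => exact hmono hu

theorem Micro.nullified_spec (hp : p ∈ E.correct) {t : ℕ} {s : LocalState P}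
    (h : E.Micro p t s) : ∀ u, s.nullified u = true → E.SendsNullify p u := by
  refine h.induct hp (Φ := fun t s => ∀ u, s.nullified u = true → E.SendsNullify p u) ?_ ?_ ?_
  · simp [LocalState.first]
  · exact fun t ht ih => ih
  · intro t s s' hm hm' hs ih u hu
    cases hs with
    | optimistic _ _ _ _ _ hs => exact ih u (hs.sameView.1.nullified ▸ hu)
    | fresh _ _ _ _ hs => exact ih u (hs.sameView.1.nullified ▸ hu)
    | later _ _ _ _ _ _ hs => exact ih u (hs.sameView.1.nullified ▸ hu)
    | timeout =>
      simp only [Bool.or_eq_true, decide_eq_true_eq] at hu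
      rcases hu with hu | ⟨hu, hw⟩
      · exact ih u hu
      · exact ⟨t, p, hm'.sent_of_out hp (.inr ⟨u, hu, hw, rfl⟩)⟩
    | _ => exact ih u hu

end Execution

namespace Setup

variable {P : Params} {K : Setup P} {p : P.Proc}

/-- The conditions under which a step sends an M-certificate or a stage-2 vote. -/
theorem Step.out_certs {S₀ : P.Inbox} {s s' : LocalState P} (h : K.Step p S₀ s s') {q : P.Proc}
    {m : Msg P.n} (hm : (q, m) ∈ s'.out) : (q, m) ∈ s.out ∨
      (∀ b, m = .mCert b → P.HasM s.S b) ∧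
      (∀ b i, m = .vote2 b i → b.view = s.view ∧ (K.InBlocksStar s.S b ∨ K.InBlocks s.S b)) := by
  have key : ∀ {v par rel}, K.SendBlock p v par rel s s' → (q, m) ∈ s.out ∨
      (∀ b, m = .mCert b → P.HasM s.S b) ∧
      (∀ b i, m = .vote2 b i → b.view = s.view ∧ (K.InBlocksStar s.S b ∨ K.InBlocks s.S b)) := by
    intro v par rel hs
    rcases hs.out hm with h | ⟨b, j, c, π, rfl⟩ | ⟨b, -, rfl, -⟩
    · exact .inl h
    all_goals exact .inr ⟨by simp, by simp⟩
  cases h with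
  | optimistic _ _ _ _ _ hs => exact key hs
  | fresh _ _ _ _ hs => exact key hs
  | later _ _ _ _ _ _ hs => exact key hs
  | nCerts =>
    rcases hm with h | ⟨v, rfl, -⟩
    · exact .inl h
    · exact .inr ⟨by simp, by simp⟩
  | certs =>
    rcases hm with h | ⟨b, rfl, -⟩ | ⟨b, rfl, hM, -⟩
    · exact .inl h
    · exact .inr ⟨by simp, by simp⟩
    · exact .inr ⟨fun b' h => Msg.mCert.inj h ▸ hM, by simp⟩
  | vote1 =>
    rcases hm with h | rfl | ⟨-, rfl⟩
    · exact .inl h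
    · exact .inr ⟨by simp, by simp⟩
    · exact .inr ⟨by simp, by simp⟩
  | release =>
    rcases hm with h | ⟨b, o, -, -, rfl⟩
    · exact .inl h
    · exact .inr ⟨by simp, by simp⟩
  | vote2 b hv hb =>
    rcases hm with h | rfl
    · exact .inl h
    · exact .inr ⟨by simp, fun b' i h => by obtain ⟨rfl, -⟩ := Msg.vote2.inj h; exact ⟨hv, hb⟩⟩
  | timeout =>
    rcases hm with h | ⟨v, -, -, rfl⟩
    · exact .inl h
    · exact .inr ⟨by simp, by simp⟩
  | second => exact .inl hm
  | advance => exact .inl hm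
  | skip => exact .inl hm

end Setup

namespace Execution

variable {P : Params} {K : Setup P} {E : Execution K} {p : P.Proc}

/-! ### Quorums -/

theorem exists_correct_of_card {Q : Finset P.Proc} (h : P.f < Q.card) :
    ∃ i ∈ Q, i ∈ E.correct := by
  by_contra hno
  push Not at hno
  have : Q ⊆ E.correctᶜ := fun i hi => Finset.mem_compl.2 (hno i hi)
  have := (Finset.card_le_card this).trans E.card_faulty
  omega

theorem card_correct : P.n - P.f ≤ E.correct.card := by
  have h1 := E.card_faulty
  have h2 := Finset.card_add_card_compl E.correct
  rw [Fintype.card_fin] at h2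
  omega

theorem Micro.signature (hp : p ∈ E.correct) {t : ℕ} {s : LocalState P} (h : E.Micro p t s)
    {m : Msg P.n} (hm : P.Received s.S m) {i : P.Proc} (hs : m.signer = some i)
    (hi : i ∈ E.correct) : ∃ t' ≤ t, ∃ q, m ∈ E.sent i t' q := by
  obtain ⟨q, t₀, h1, h2⟩ := h.received_sent hp hm
  obtain ⟨t', h3, h4⟩ := E.signature q t₀ p m i h2 hs hi
  exact ⟨t', by omega, h4⟩

theorem Micro.hasN_origin (hp : p ∈ E.correct) {t : ℕ} {s : LocalState P} (h : E.Micro p t s)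
    {v : ℕ} (hv : P.HasN s.S v) :
    ∃ i ∈ E.correct, ∃ t' ≤ t, ∃ q, Msg.nullify v i ∈ E.sent i t' q := by
  rcases hv with hv | ⟨Q, hQ, hv⟩
  · obtain ⟨q, t₀, h1, h2⟩ := h.received_sent hp hv
    obtain ⟨Q, hQ, h3⟩ := E.threshold_n q t₀ p v h2
    obtain ⟨i, hiQ, hi⟩ := E.exists_correct_of_card (Q := Q) (by omega)
    obtain ⟨t', h4, h5⟩ := h3 i hiQ hi
    exact ⟨i, hi, t', by omega, h5⟩
  · obtain ⟨i, hiQ, hi⟩ := E.exists_correct_of_card (Q := Q) (by omega)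
    exact ⟨i, hi, h.signature hp (hv i hiQ) rfl hi⟩

/-! ### Certified blocks have a stage-1 vote of a correct processor -/

variable (E) in
/-- Some correct processor sends a stage-1 vote for `b`. -/
def HonestVote (b : Block) : Prop := ∃ j ∈ E.correct, ∃ t q, Msg.vote1 b j ∈ E.sent j t q

/-- From `n ≥ 4f + 1` it follows that `n - (3/2) f` exceeds `f`, so some voter is correct, and its
signature cannot be forged. -/
theorem Micro.honestVote_of_notarisation (hp : p ∈ E.correct) {t : ℕ} {s : LocalState P}
    (h : E.Micro p t s) {b : Block} (hb : P.HasNotarisation s.S b) : E.HonestVote b := by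
  obtain ⟨Q, hQ, hv⟩ := hb
  have := P.four_mul_f_lt
  obtain ⟨i, hiQ, hi⟩ := E.exists_correct_of_card (Q := Q) (by omega)
  obtain ⟨t', -, q, h'⟩ := h.signature hp (hv i hiQ) rfl hi
  exact ⟨i, hi, t', q, h'⟩

theorem honestVote_of_hasM_aux {S : P.Inbox}
    (h1 : ∀ b, ∀ i ∈ E.correct, P.Received S (.vote2 b i) → E.HonestVote b)
    (h2 : ∀ b, P.Received S (.mCert b) → E.HonestVote b) {b : Block} (hb : P.HasM S b) :
    E.HonestVote b := by
  rcases hb with hb | ⟨Q, hQ, hb⟩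
  · exact h2 b hb
  · obtain ⟨i, hiQ, hi⟩ := E.exists_correct_of_card (Q := Q) (by omega)
    exact h1 b i hi (hb i hiQ)

/-- What is there at the beginning of the slot was sent strictly earlier, where `ih` applies. What
`p` adds during the slot is its own, received at once, and rests on a notarisation or M-certificate
it already had; hence a second induction, inside the slot. -/
theorem Micro.received_vote2_aux (hp : p ∈ E.correct) {t : ℕ}
    (ih : ∀ t' < t, ∀ i ∈ E.correct, ∀ q b, Msg.vote2 b i ∈ E.sent i t' q → E.HonestVote b)
    {s : LocalState P} (h : E.Micro p t s) :
    (∀ b, ∀ i ∈ E.correct, P.Received s.S (.vote2 b i) → E.HonestVote b) ∧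
      (∀ b, P.Received s.S (.mCert b) → E.HonestVote b) := by
  have hst := h.start_le
  refine h.slot_induct (Φ := fun s =>
    (∀ b, ∀ i ∈ E.correct, P.Received s.S (.vote2 b i) → E.HonestVote b) ∧
      (∀ b, P.Received s.S (.mCert b) → E.HonestVote b)) ⟨?_, ?_⟩ ?_
  · rintro b i hi ⟨q, hq⟩
    obtain ⟨t₀, h1, h2⟩ := sent_of_mem_init hp hst _ hq
    obtain ⟨t', h3, q', h4⟩ := E.signature q t₀ p _ i h2 rfl hi
    exact ih t' (by omega) i hi q' b h4
  · rintro b ⟨q, hq⟩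
    obtain ⟨t₀, h1, h2⟩ := sent_of_mem_init hp hst _ hq
    obtain ⟨Q, hQ, h3⟩ := E.threshold_m q t₀ p b h2
    obtain ⟨i, hiQ, hi⟩ := E.exists_correct_of_card (Q := Q) (by omega)
    obtain ⟨t', h4, q', h5⟩ := h3 i hiQ hi
    exact ih t' (by omega) i hi q' b h5
  · rintro s s' hm - hs ⟨h1, h2⟩
    have key : ∀ m, P.Received s'.S m → P.Received s.S m ∨
        (∀ b, m = .mCert b → P.HasM s.S b) ∧
        (∀ b i, m = .vote2 b i →
          b.view = s.view ∧ (K.InBlocksStar s.S b ∨ K.InBlocks s.S b)) := by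
      rintro m ⟨q, hq⟩
      rcases hs.self_sent.1 _ hq with hq | ⟨rfl, hq⟩
      · exact .inl ⟨q, hq⟩
      · exact (hs.out_certs hq).imp (fun h => ⟨q, hm.self_sent.2 _ h⟩) id
    refine ⟨fun b i hi hb => ?_, fun b hb => ?_⟩
    · rcases key _ hb with hb | ⟨-, hb⟩
      · exact h1 b i hi hb
      · obtain ⟨hv, hb⟩ := hb b i rfl
        have h1le : 1 ≤ b.view := hv ▸ (hm.regular hp).one_le_view
        rcases hb with hb | hb
        · exact hm.honestVote_of_notarisation hp (hb.of_one_le h1le).2.1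
        · exact honestVote_of_hasM_aux h1 h2 (hb.of_one_le h1le).2.1
    · rcases key _ hb with hb | ⟨hb, -⟩
      · exact h2 b hb
      · exact honestVote_of_hasM_aux h1 h2 (hb b rfl)

/-- A correct stage-2 vote rests either on a notarisation or on an M-certificate, whose `f + 1`
shares include an earlier correct stage-2 vote. Such a descent must end at a notarisation. -/
theorem honestVote_of_vote2 (t : ℕ) : ∀ i ∈ E.correct, ∀ q b,
    Msg.vote2 b i ∈ E.sent i t q → E.HonestVote b := by
  induction t using Nat.strong_induction_on with
  | _ t ih =>
    intro i hi q b h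
    obtain ⟨-, s, hs, hv, hb⟩ := vote2_origin hi h
    have h1le : 1 ≤ b.view := hv ▸ (hs.regular hi).one_le_view
    rcases hb with hb | hb
    · exact hs.honestVote_of_notarisation hi (hb.of_one_le h1le).2.1
    · obtain ⟨h1, h2⟩ := hs.received_vote2_aux hi ih
      exact honestVote_of_hasM_aux h1 h2 (hb.of_one_le h1le).2.1

theorem Micro.honestVote_of_hasM (hp : p ∈ E.correct) {t : ℕ} {s : LocalState P}
    (h : E.Micro p t s) {b : Block} (hb : P.HasM s.S b) : E.HonestVote b := by
  obtain ⟨h1, h2⟩ := h.received_vote2_aux hp fun t' _ => honestVote_of_vote2 t'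
  exact honestVote_of_hasM_aux h1 h2 hb

/-- A block with a stage-1 vote by a correct processor extends a block of an earlier view. -/
theorem HonestVote.spec {b : Block} (h : E.HonestVote b) :
    P.IsBlock b ∧ ∃ b', K.H (.block b') = b.par ∧ b'.view < b.view := by
  obtain ⟨j, hj, t, q, h⟩ := h
  obtain ⟨-, s, c, π, -, h1, h2, -, -, b', h3, h4, -⟩ := vote1_origin hj h
  exact ⟨h1, b', h3, h2 ▸ h4⟩

/-- The leader has proposed every block of its views that a correct processor votes for. -/
theorem HonestVote.proposed {b : Block} (h : E.HonestVote b) (hl : P.lead b.view ∈ E.correct) :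
    ∃ t, E.start (P.lead b.view) ≤ t ∧ ∃ o, (b, o) ∈ (E.state (P.lead b.view) t).proposed := by
  have hb := h.spec.1.1
  obtain ⟨j, hj, t, q, h⟩ := h
  obtain ⟨-, s, c, π, hm, -, -, h3, -⟩ := vote1_origin hj h
  obtain ⟨q', t₀, -, h4⟩ := hm.received_sent hj h3
  obtain ⟨t', -, h5⟩ := E.block_signature q' t₀ j _ b h4 rfl hb hl
  exact ⟨t', h5⟩

/-- While a processor is in view `v`, its own messages do not affect blocks of earlier views. -/
theorem Micro.inBlocks_init_of_lt (hp : p ∈ E.correct) {t v : ℕ} {s : LocalState P}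
    (h : E.Micro p t s) (h0 : (E.init p t).view = v) (hv : s.view = v) {b : Block}
    (hb : K.InBlocks s.S b) (hlt : b.view < v) : K.InBlocks (E.init p t).S b := by
  -- To itself `p` only sends stage-2 votes for its present view `v` and M-certificates it could
  -- already form, so for blocks of other views nothing is gained during the slot.
  have hM : ∀ b, b.view ≠ v → P.HasM s.S b → P.HasM (E.init p t).S b := by
    clear hb hlt
    revert hv
    refine h.slot_induct (Φ := fun s => s.view = v → ∀ b, b.view ≠ v → P.HasM s.S b →
      P.HasM (E.init p t).S b) (fun _ _ _ => id) ?_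
    intro s s' hm hm' hs ih hv b hbv hb
    have hv0 : s.view = v := le_antisymm (hv ▸ hs.ext.view) (h0 ▸ hm.ext_init.view)
    have key : ∀ m, P.Received s'.S m → P.Received s.S m ∨
        (∀ b, m = .mCert b → P.HasM s.S b) ∧
        (∀ b i, m = .vote2 b i →
          b.view = s.view ∧ (K.InBlocksStar s.S b ∨ K.InBlocks s.S b)) := by
      rintro m ⟨q, hq⟩
      rcases hs.self_sent.1 _ hq with hq | ⟨rfl, hq⟩
      · exact .inl ⟨q, hq⟩
      · exact (hs.out_certs hq).imp (fun h => ⟨q, hm.self_sent.2 _ h⟩) id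
    refine ih hv0 b hbv ?_
    rcases hb with hb | ⟨Q, hQ, hb⟩
    · rcases key _ hb with hb | ⟨hb, -⟩
      · exact .inl hb
      · exact hb b rfl
    · refine .inr ⟨Q, hQ, fun i hi => ?_⟩
      rcases key _ (hb i hi) with hb | ⟨-, hb⟩
      · exact hb
      · exact absurd ((hb b i rfl).1.trans hv0) hbv
  induction hb with
  | genesis => exact .genesis
  | child b b' hbl hMb _ hpar ih =>
    -- The definition of `blocks` does not say that a parent has a smaller view. The stage-1 vote of
    -- a correct processor behind the M-certificate does, which keeps all ancestors below `v`.
    obtain ⟨-, b1, h1, h2⟩ := (h.honestVote_of_hasM hp hMb).spec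
    obtain rfl := K.block_injective (h1.trans hpar.symm)
    exact .child b b1 hbl (hM b hlt.ne hMb) (ih (h2.trans hlt)) hpar

end Execution

/-! ### What a single change can do to votes, proposals and flags -/

namespace Setup

variable {P : Params} {K : Setup P} {p : P.Proc}

/-- The effect of a step on the variables that are set on stage-1 voting. -/
theorem Step.vote1_cases {S₀ : P.Inbox} {s s' : LocalState P} (h : K.Step p S₀ s s') :
    (s'.opar = s.opar ∧ s'.oprop = s.oprop ∧ s'.voted1 = s.voted1) ∨
      ∃ b, b.view = s.view ∧ s.voted1 s.view = false ∧ s'.view = s.view ∧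
        s'.proposed = s.proposed ∧ s'.voted1 = Function.update s.voted1 s.view true ∧
        ((p = P.lead (s.view + 1) ∧ P.Initial (s.view + 1)) ∧
            s'.oprop = Function.update s.oprop (s.view + 1) true ∧ s'.opar = b ∨
          ¬ (p = P.lead (s.view + 1) ∧ P.Initial (s.view + 1)) ∧
            s'.oprop = s.oprop ∧ s'.opar = s.opar) := by
  have key : ∀ {v par rel}, K.SendBlock p v par rel s s' →
      s'.opar = s.opar ∧ s'.oprop = s.oprop ∧ s'.voted1 = s.voted1 := by
    rintro v par rel ⟨C, k, b, -, -, rfl⟩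
    exact ⟨rfl, rfl, rfl⟩
  cases h with
  | optimistic _ _ _ _ _ hs => exact .inl (key hs)
  | fresh _ _ _ _ hs => exact .inl (key hs)
  | later _ _ _ _ _ _ hs => exact .inl (key hs)
  | vote1 b c π hb h1 =>
    refine .inr ⟨b, hb.2.1, h1, rfl, rfl, rfl, ?_⟩
    by_cases hc : p = P.lead (s.view + 1) ∧ P.Initial (s.view + 1)
    · exact .inl ⟨hc, if_pos hc, if_pos hc⟩
    · exact .inr ⟨hc, if_neg hc, if_neg hc⟩
  | _ => exact .inl ⟨rfl, rfl, rfl⟩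

/-- The effect of a step on the set of proposed blocks. -/
theorem Step.proposed_cases {S₀ : P.Inbox} {s s' : LocalState P} (h : K.Step p S₀ s s') :
    s'.proposed = s.proposed ∨
      ∃ b, s'.proposed = insert (b, s.secondPropose (P.superview b.view)) s.proposed ∧
        s'.view = s.view ∧ s'.opar = s.opar ∧ s'.oprop = s.oprop ∧ s'.voted1 = s.voted1 ∧
        (P.Initial (s.view + 1) ∧ p = P.lead (s.view + 1) ∧ s.voted1 s.view = true ∧
            b.view = s.view + 1 ∧ b.par = K.H (.block s.opar) ∨
          P.Initial s.view ∧ (¬ ∃ v', s.ProposedSince v') ∧ b.view = s.view ∧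
            b.par = K.H (.block s.b) ∧ (∀ q, (q, Msg.release b) ∈ s'.out) ∨
          ∃ b' o, (b', o) ∈ s.proposed ∧ P.superview b'.view = P.superview (b'.view + 1) ∧
            b.view = b'.view + 1) ∧
        ∃ C S, b.tag = K.tag C (K.g S b.view) ∧
          ∀ q, (q, Msg.frag b q (K.code.encode (K.g S b.view) C q) (K.path C (K.g S b.view) q)) ∈
            s'.out := by
  cases h with
  | optimistic _ hi hp hv hno hs =>
    obtain ⟨C, k, b, rfl, rfl, rfl⟩ := hs
    exact .inr ⟨_, rfl, rfl, rfl, rfl, rfl, .inl ⟨hi, hp, hv, rfl, rfl⟩, C, s.S, rfl,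
      fun q => .inr (.inl rfl)⟩
  | fresh _ hi hp hno hs =>
    obtain ⟨C, k, b, rfl, rfl, rfl⟩ := hs
    exact .inr ⟨_, rfl, rfl, rfl, rfl, rfl,
      .inr (.inl ⟨hi, hno, rfl, rfl, fun q => .inr (.inr ⟨trivial, rfl⟩)⟩), C, s.S, rfl,
      fun q => .inr (.inl rfl)⟩
  | later _ b' hb hw hw' hmax hs =>
    obtain ⟨C, k, b, rfl, rfl, rfl⟩ := hs
    exact .inr ⟨_, rfl, rfl, rfl, rfl, rfl, .inr (.inr ⟨b', _, hb, hw.trans hw'.symm, rfl⟩),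
      C, s.S, rfl, fun q => .inr (.inl rfl)⟩
  | _ => exact .inl rfl

/-- The effect of a step on `secondPropose`. -/
theorem Step.second_cases {S₀ : P.Inbox} {s s' : LocalState P} (h : K.Step p S₀ s s') :
    s'.secondPropose = s.secondPropose ∨
      (s'.secondPropose = Function.update s.secondPropose (P.superview s.view) true ∧
        P.Initial s.view ∧ s.oprop s.view = true ∧ s.T = 2 * P.Δ ∧
        ¬ K.InBlocks s.S s.opar) := by
  have key : ∀ {v par rel}, K.SendBlock p v par rel s s' →
      s'.secondPropose = s.secondPropose := by
    rintro v par rel ⟨C, k, b, -, -, rfl⟩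
    rfl
  cases h with
  | optimistic _ _ _ _ _ hs => exact .inl (key hs)
  | fresh _ _ _ _ hs => exact .inl (key hs)
  | later _ _ _ _ _ _ hs => exact .inl (key hs)
  | second hi hp ho hT hb => exact .inr ⟨rfl, hi, ho, hT, hb⟩
  | _ => exact .inl rfl

/-- A processor leaves a view only after its optimistic proposal. -/
theorem Step.optimisticDone {S₀ : P.Inbox} {s s' : LocalState P} (h : K.Step p S₀ s s')
    (hv : s'.view ≠ s.view) : OptimisticDone p s := by
  cases h with
  | optimistic _ _ _ _ _ hs => exact absurd hs.sameView.1.view hv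
  | fresh _ _ _ _ hs => exact absurd hs.sameView.1.view hv
  | later _ _ _ _ _ _ hs => exact absurd hs.sameView.1.view hv
  | advance _ _ _ _ hd => exact hd
  | skip _ hd => exact hd
  | _ => exact absurd rfl hv

end Setup

namespace Execution

variable {P : Params} {K : Setup P} {E : Execution K} {p : P.Proc}

/-! ### Proposals -/

theorem Micro.proposed_spec (hp : p ∈ E.correct) {t : ℕ} {s : LocalState P} (h : E.Micro p t s) :
    ∀ b o, (b, o) ∈ s.proposed → ∃ C S, b.tag = K.tag C (K.g S b.view) ∧
      ∃ t₀ ≤ t, ∀ q, Msg.frag b q (K.code.encode (K.g S b.view) C q)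
        (K.path C (K.g S b.view) q) ∈ E.sent p t₀ q := by
  refine h.induct hp (Φ := fun t s => ∀ b o, (b, o) ∈ s.proposed → ∃ C S,
    b.tag = K.tag C (K.g S b.view) ∧
      ∃ t₀ ≤ t, ∀ q, Msg.frag b q (K.code.encode (K.g S b.view) C q)
        (K.path C (K.g S b.view) q) ∈ E.sent p t₀ q) ?_ ?_ ?_
  · simp [LocalState.first]
  · intro t ht ih b o hb
    obtain ⟨C, S, h1, t₀, h2, h3⟩ := ih b o hb
    exact ⟨C, S, h1, t₀, by omega, h3⟩
  · intro t s s' hm hm' hs ih b o hb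
    rcases hs.proposed_cases with he | ⟨b1, he, -, -, -, -, -, C, S, h1, h2⟩
    · exact ih b o (he ▸ hb)
    · rw [he] at hb
      rcases hb with hb | hb
      · obtain ⟨rfl, -⟩ := Prod.mk.inj hb
        exact ⟨C, S, h1, t, le_rfl, fun q => hm'.sent_of_out hp (h2 q)⟩
      · exact ih b o hb

theorem Micro.oprop_voted1 (hp : p ∈ E.correct) {t : ℕ} {s : LocalState P} (h : E.Micro p t s) :
    ∀ u, s.oprop (u + 1) = true → s.voted1 u = true := by
  refine h.induct hp (Φ := fun t s => ∀ u, s.oprop (u + 1) = true → s.voted1 u = true) ?_ ?_ ?_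
  · simp [LocalState.first]
  · exact fun _ _ ih => ih
  · intro t s s' hm hm' hs ih u hu
    rcases hs.vote1_cases with ⟨-, h1, h2⟩ | ⟨b, -, -, -, -, h1, ⟨-, h2, -⟩ | ⟨-, h2, -⟩⟩
    · exact h2 ▸ ih u (h1 ▸ hu)
    · rw [h1]
      by_cases hus : u = s.view
      · simp [hus]
      · rw [h2] at hu
        exact Setup.update_true (ih u (by simpa [hus] using hu))
    · rw [h1]
      exact Setup.update_true (ih u (h2 ▸ hu))

/-- A leader that has voted in the last view before its superview remembers the block. -/
theorem Micro.opar_spec (hp : p ∈ E.correct) {t : ℕ} {s : LocalState P} (h : E.Micro p t s) :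
    P.Initial (s.view + 1) → p = P.lead (s.view + 1) → s.voted1 s.view = true →
      s.oprop (s.view + 1) = true ∧ s.opar.view = s.view := by
  refine h.induct hp (Φ := fun t s => P.Initial (s.view + 1) → p = P.lead (s.view + 1) →
    s.voted1 s.view = true → s.oprop (s.view + 1) = true ∧ s.opar.view = s.view) ?_ ?_ ?_
  · simp [LocalState.first]
  · exact fun _ _ ih => ih
  · intro t s s' hm hm' hs ih
    rcases hs.vote1_cases with ⟨h0, h1, h2⟩ | ⟨b, hb, hv, hv', -, h1, h2⟩
    · rcases hs.view_cases with ⟨hv, -⟩ | ⟨hv, -⟩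
      · rwa [h0, h1, h2, hv]
      · intro _ _ h3
        rw [h2, hv] at h3
        have := (hm.regular hp).voted1_le _ h3
        omega
    · rw [hv']
      intro hi hl _
      rcases h2 with ⟨-, h2, h3⟩ | ⟨h2, -⟩
      · exact ⟨by simp [h2], by rw [h3, hb]⟩
      · exact absurd ⟨hl, hi⟩ h2

/-- Recovers the state just before the flag was set, that is, the moment at which the leader decided
to replace its optimistic proposal. -/
theorem Micro.secondPropose_spec (hp : p ∈ E.correct) {t v : ℕ} {s : LocalState P}
    (hi : P.Initial v) (h : E.Micro p t s) (hsec : s.secondPropose (P.superview v) = true) :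
    v ≤ s.view ∧ ∃ t' ≤ t, ∃ s', E.Micro p t' s' ∧ s'.view = v ∧ s'.T = 2 * P.Δ ∧
      s'.oprop v = true ∧ (¬ K.InBlocks s'.S s'.opar) ∧
      s'.secondPropose (P.superview v) = false := by
  revert hsec
  refine h.induct hp (Φ := fun t s => s.secondPropose (P.superview v) = true →
    v ≤ s.view ∧ ∃ t' ≤ t, ∃ s', E.Micro p t' s' ∧ s'.view = v ∧ s'.T = 2 * P.Δ ∧
      s'.oprop v = true ∧ (¬ K.InBlocks s'.S s'.opar) ∧
      s'.secondPropose (P.superview v) = false) ?_ ?_ ?_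
  · simp [LocalState.first]
  · intro t ht ih hsec
    obtain ⟨h1, t', h2, h3⟩ := ih hsec
    exact ⟨h1, t', by omega, h3⟩
  · intro t s s' hm hm' hs ih hsec
    cases hold : s.secondPropose (P.superview v)
    · rcases hs.second_cases with he | ⟨he, hi', ho, hT, hb⟩
      · rw [he, hold] at hsec
        exact absurd hsec (by simp)
      · have hw : P.superview v = P.superview s.view := by
          by_contra hne
          rw [he, Function.update_of_ne hne, hold] at hsec
          exact absurd hsec (by simp)
        have h1 := hi.le_of_superview_eq (hm.regular hp).one_le_view hw.symm
        have h2 := hi'.le_of_superview_eq hi.one_le hw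
        obtain rfl : v = s.view := le_antisymm h1 h2
        exact ⟨hs.ext.view, t, le_rfl, s, hm, rfl, hT, ho, hb, hold⟩
    · obtain ⟨h1, h2⟩ := ih hold
      exact ⟨h1.trans hs.ext.view, h2⟩

/-- The flag `oprop(v)` does not change after entering view `v`. -/
theorem oprop_eq_of_step {S₀ : P.Inbox} {v : ℕ} {s s' : LocalState P} (hs : K.Step p S₀ s s')
    (hv : v ≤ s.view) : s'.oprop v = s.oprop v := by
  rcases hs.vote1_cases with ⟨-, h1, -⟩ | ⟨b, -, -, -, -, -, ⟨-, h1, -⟩ | ⟨-, h1, -⟩⟩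
  · rw [h1]
  · rw [h1, Function.update_of_ne (by omega)]
  · rw [h1]

/-- The flag is set by a stage-1 vote in the view before `v`, and the leader does not leave that
view after voting without having proposed. Once in `v` the flag is frozen. -/
theorem Micro.oprop_proposed (hp : p ∈ E.correct) {t v : ℕ} {s : LocalState P}
    (hi : P.Initial v) (hl : p = P.lead v) (h : E.Micro p t s) (hv : v ≤ s.view)
    (ho : s.oprop v = true) : ∃ b o, (b, o) ∈ s.proposed ∧ b.view = v := by
  revert hv ho
  refine h.induct hp (Φ := fun t s => v ≤ s.view → s.oprop v = true →
    ∃ b o, (b, o) ∈ s.proposed ∧ b.view = v) ?_ ?_ ?_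
  · simp [LocalState.first]
  · exact fun _ _ ih => ih
  · intro t s s' hm hm' hs ih hv ho
    have hmono : (∃ b o, (b, o) ∈ s.proposed ∧ b.view = v) →
        ∃ b o, (b, o) ∈ s'.proposed ∧ b.view = v :=
      fun ⟨b, o, hb, h⟩ => ⟨b, o, hs.ext.proposed hb, h⟩
    by_cases hvs : v ≤ s.view
    · exact hmono (ih hvs (oprop_eq_of_step hs hvs ▸ ho))
    · have hne : s'.view ≠ s.view := by omega
      obtain rfl : v = s.view + 1 := by
        rcases hs.view_cases with ⟨h1, -⟩ | ⟨h1, -⟩ <;> omega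
      have ho' := hm'.oprop_voted1 hp _ ho
      rcases hs.vote1_cases with ⟨-, -, h1⟩ | ⟨b, -, -, h1, -⟩
      · exact hmono (hs.optimisticDone hne hi hl (h1 ▸ ho'))
      · exact absurd h1 hne

variable (E) in
/-- A proposal for the initial view `v` that is released with the proposal. -/
def FreshProposal (p : P.Proc) (v t : ℕ) (s : LocalState P) (b : Block) (o : Bool) : Prop :=
  v ≤ s.view ∧ (o = true ∨ s.oprop v = false) ∧
    (∃ t₀ ≤ t, ∀ q, Msg.release b ∈ E.sent p t₀ q) ∧
    ∃ b', K.H (.block b') = b.par ∧ K.InBlocks s.S b' ∧ b'.view < v ∧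
      ∀ u, b'.view < u → u < v → P.HasN s.S u

variable (K) in
/-- An optimistic proposal for the initial view `v`. -/
def OptimisticProposal (v : ℕ) (s : LocalState P) (b : Block) (o : Bool) : Prop :=
  o = false ∧ s.oprop v = true ∧ s.voted1 (v - 1) = true ∧
    (s.view ≤ v → b.par = K.H (.block s.opar) ∧ s.opar.view + 1 = v)

/-- A proposal for an initial view is made either in the view before it or inside it, since a
continuation inside a superview never reaches its first view. For optimistic proposals the link to
`opar` is claimed only up to view `v`, because later superviews overwrite that variable. -/
theorem Micro.proposal_cases (hp : p ∈ E.correct) {t v : ℕ} {s : LocalState P}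
    (hi : P.Initial v) (hl : p = P.lead v) (h : E.Micro p t s) :
    ∀ b o, (b, o) ∈ s.proposed → b.view = v → v ≤ s.view + 1 ∧
      (E.FreshProposal p v t s b o ∨ OptimisticProposal K v s b o) := by
  refine h.induct hp (Φ := fun t s => ∀ b o, (b, o) ∈ s.proposed → b.view = v → v ≤ s.view + 1 ∧
      (E.FreshProposal p v t s b o ∨ OptimisticProposal K v s b o)) ?_ ?_ ?_
  · simp [LocalState.first]
  · intro t ht ih b o hb hbv
    obtain ⟨h0, h1⟩ := ih b o hb hbv
    refine ⟨h0, h1.imp ?_ id⟩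
    rintro ⟨h1, h2, ⟨t₀, h3, h4⟩, b', h5, h6, h7, h8⟩
    exact ⟨h1, h2, ⟨t₀, by omega, h4⟩, b', h5, h6.mono Set.subset_union_left, h7,
      fun u hu hu' => (h8 u hu hu').mono Set.subset_union_left⟩
  · intro t s s' hm hm' hs ih b o hb hbv
    have hold : (b, o) ∈ s.proposed → v ≤ s'.view + 1 ∧
        (E.FreshProposal p v t s' b o ∨ OptimisticProposal K v s' b o) := by
      intro hb
      obtain ⟨h0, h1⟩ := ih b o hb hbv
      have hview := hs.ext.view
      refine ⟨by omega, h1.imp ?_ ?_⟩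
      · rintro ⟨h1, h2, h3, b', h5, h6, h7, h8⟩
        rw [← oprop_eq_of_step hs h1] at h2
        exact ⟨by omega, h2, h3, b', h5, h6.mono hs.ext.S, h7,
          fun u hu hu' => (h8 u hu hu').mono hs.ext.S⟩
      · rintro ⟨h1, h2, h3, h4⟩
        refine ⟨h1, hs.ext.oprop _ h2, hs.ext.voted1 _ h3, fun hv => ?_⟩
        have hv0 : s.view ≤ v := hview.trans hv
        -- Only a stage-1 vote just before an initial view overwrites `opar`. The vote in `v - 1`
        -- has been cast, and `v + 1` is not initial.
        rcases hs.vote1_cases with ⟨h5, -⟩ | ⟨b1, -, hvf, -, -, -, ⟨⟨-, hi'⟩, -⟩ | ⟨-, -, h5⟩⟩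
        · rw [h5]; exact h4 hv0
        · rcases hv0.lt_or_eq with hlt | heq
          · obtain rfl : v = s.view + 1 := by omega
            simp [hvf] at h3
          · exact absurd hi' (heq ▸ hi).not_initial_succ
        · rw [h5]; exact h4 hv0
    rcases hs.proposed_cases with he | ⟨b1, he, hv', h5, h6, h7, hcase, -⟩
    · exact hold (he ▸ hb)
    · rw [he] at hb
      rcases hb with hb | hb
      swap
      · exact hold hb
      obtain ⟨rfl, rfl⟩ := Prod.mk.inj hb
      rcases hcase with ⟨hi', hl', h1, hbv', hpar⟩ | ⟨hi', hno, hbv', hpar, hrel⟩ |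
        ⟨b2, o2, hb2, hw, hbv'⟩
      · obtain rfl : v = s.view + 1 := hbv.symm.trans hbv'
        obtain ⟨h8, h9⟩ := hm.opar_spec hp hi' hl' h1
        refine ⟨by omega, .inr ⟨?_, by rw [h6]; exact h8, by rw [h7]; exact h1,
          fun _ => ⟨by rw [h5]; exact hpar, by rw [h5, h9]⟩⟩⟩
        rw [hbv]
        -- The replacement flag cannot be set before `v` is entered.
        by_contra hsec
        have := (hm.secondPropose_spec hp hi (by simpa using hsec)).1
        omega
      · obtain rfl : v = s.view := hbv.symm.trans hbv'
        obtain ⟨h8, h9, h10⟩ := hm.b_spec hp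
        refine ⟨by omega, .inl ⟨hv'.ge, ?_, ⟨t, le_rfl, fun q => hm'.sent_of_out hp (hrel q)⟩,
          s.b, hpar.symm, h8.mono hs.ext.S, h9, fun u hu hu' => (h10 u hu hu').mono hs.ext.S⟩⟩
        rw [h6, hbv]
        -- With `oprop(v)` set and the replacement flag still false, the optimistic proposal would
        -- count as recent and block this one.
        by_contra hc
        push Not at hc
        obtain ⟨hc1, hc2⟩ := hc
        obtain ⟨b0, o0, hb0, hb0v⟩ := hm.oprop_proposed hp hi hl le_rfl (by simpa using hc2)
        cases o0 with
        | false =>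
          refine hno ⟨_, b0, ?_, hb0v, hi.superview_succ.symm⟩
          rw [LocalState.secondNow, hi.superview_succ]
          simpa [Bool.eq_false_iff.2 hc1] using hb0
        | true => exact hc1 (hb0v ▸ (hm.regular hp).proposed_second b0 hb0)
      · have h1 := (hm.regular hp).one_le_proposed b2 o2 hb2
        have := hi.superview_pred_lt h1 (by omega)
        rw [← hbv, hbv'] at this
        omega

end Execution

theorem Params.one_le_k (P : Params) : 1 ≤ P.n - P.f - 1 := by
  have := P.four_mul_f_lt
  have := P.two_le_n
  omega

namespace Setup

variable {P : Params} {K : Setup P} {p : P.Proc} {s : LocalState P}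

/-! ### States in which no instruction has any further effect -/

namespace Quiescent

theorem not_hasN (h : K.Quiescent p s) : ¬ P.HasN s.S s.view := by
  intro hN
  have h1 : K.advanceN s s := h _ (by simp [instructions])
  rw [advanceN, if_pos hN] at h1
  have := congrArg LocalState.view h1
  simp [LocalState.enterNext] at this

theorem not_inBlocks (h : K.Quiescent p s) : ¬ ∃ b, K.InBlocks s.S b ∧ b.view = s.view := by
  intro hb
  have h1 : K.advanceBlock p s s := h _ (by simp [instructions])
  rw [advanceBlock, if_pos hb] at h1
  obtain ⟨b, -, -, h1⟩ := h1
  have := congrArg LocalState.view h1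
  split at this <;>
    simp [LocalState.enterNext, castVote2, LocalState.disseminate, LocalState.send] at this

theorem voted1 (h : K.Quiescent p s) (hv : K.HasVotable p s) : s.voted1 s.view = true := by
  by_contra hn
  have h1 : K.stage1 p s s := h _ (by simp [instructions])
  rw [stage1, if_pos ⟨hv, by simpa using hn⟩] at h1
  obtain ⟨b, c, π, -, h1⟩ := h1
  have := congrFun (congrArg LocalState.voted1 h1) s.view
  exact hn (by simpa using this)

theorem voted2 (h : K.Quiescent p s) (hb : ∃ b, K.InBlocksStar s.S b ∧ b.view = s.view)
    (hn : s.nullified s.view = false) : s.voted2 s.view = true := by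
  by_contra h2
  have h1 : K.stage2 p s s := h _ (by simp [instructions])
  rw [stage2, if_pos ⟨hb, hn, by simpa using h2⟩] at h1
  obtain ⟨b, -, -, h1⟩ := h1
  have := congrFun (congrArg LocalState.voted2 h1) s.view
  exact h2 (by simpa [castVote2] using this)

theorem proposed (h : K.Quiescent p s) (hr : Regular s) (hi : P.Initial s.view)
    (hl : p = P.lead s.view) :
    ∃ b, (b, s.secondPropose (P.superview s.view)) ∈ s.proposed ∧ b.view = s.view := by
  by_contra hno
  have hno2 : ¬ s.ProposedSince s.view := by
    rintro ⟨b, hb, hv, -⟩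
    rw [LocalState.secondNow, hi.superview_succ] at hb
    exact hno ⟨b, hb, hv⟩
  have h1 : K.propose p s s := h _ (by simp [instructions])
  rw [propose, if_pos (.inr ⟨hi, hl, hno2⟩), ProposeBlock,
    if_neg fun h => hi.not_initial_succ h.1,
    if_pos ⟨hi, fun ⟨_, h⟩ => hno2 (hr.proposedSince_initial hi h)⟩] at h1
  exact hno h1.sameView.2.2.2

theorem release (h : K.Quiescent p s) (hi : P.Initial s.view) (hl : p = P.lead s.view)
    (ho : s.oprop s.view = true) (hT : s.T = 2 * P.Δ) :
    (K.InBlocks s.S s.opar ∧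
        ∀ b o, (b, o) ∈ s.proposed → b.view = s.view → ∀ q, (q, Msg.release b) ∈ s.out) ∨
      s.secondPropose (P.superview s.view) = true := by
  have h1 : K.releaseOrReplace p s s := h _ (by simp [instructions])
  rw [releaseOrReplace, if_pos ⟨hi, hl, ho, hT⟩] at h1
  split at h1
  · rename_i hb
    refine .inl ⟨hb, fun b o hbo hv q => ?_⟩
    rw [h1]
    exact .inr ⟨b, o, hbo, hv, rfl⟩
  · have := congrFun (congrArg LocalState.secondPropose h1) (P.superview s.view)
    exact .inr (by simpa using this)

end Quiescent

end Setup

namespace Execution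

variable {P : Params} {K : Setup P} {E : Execution K} {p : P.Proc}

/-! ### Entering an initial view after `GST` -/

/-- All correct processors reach a view at most `Δ` after one of them has. -/
theorem le_viewAt_add (hp : p ∈ E.correct) {q : P.Proc} (hq : q ∈ E.correct) {v t : ℕ}
    (hv : v ≤ E.viewAt q t) (ht : E.GST ≤ t) : v ≤ E.viewAt p (t + P.Δ) := by
  have hst := E.start_le p hp
  have hs : E.start p ≤ t + P.Δ := by omega
  rw [viewAt_eq hs]
  -- Otherwise `p` rests in a view that `q` has left. Whatever let `q` leave has reached `p` within
  -- `Δ` and would make `p` advance as well.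
  by_contra hlt
  have hm := micro_state hp hs
  have h1 := (hm.regular hp).one_le_view
  have hsq : E.start q ≤ t := start_le_of_viewAt (by omega : 1 ≤ E.viewAt q t)
  rw [viewAt_eq hsq] at hv
  have hmq := micro_state hq hsq
  have hsub := (micro_init hp hs).ext_state.S
  rcases hmq.left_view hq _ h1 (by omega) with hN | ⟨⟨b, hb, hbv⟩, -⟩
  · exact (quiescent hp hs).not_hasN
      ((hmq.hasN_init hp hq hN (by omega) le_rfl).mono hsub)
  · exact (quiescent hp hs).not_inBlocks
      ⟨b, (hmq.inBlocks_init hp hq hb (by omega) le_rfl).mono hsub, hbv⟩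

theorem FirstEntry.enters {v t : ℕ} (h : E.FirstEntry v t) (ht : E.GST ≤ t)
    (hp : p ∈ E.correct) : ∃ e, t ≤ e ∧ e ≤ t + P.Δ ∧ E.Enters p v e := by
  obtain ⟨⟨q, hq, hqe⟩, hmin⟩ := h
  obtain ⟨e, h1, h2⟩ := exists_enters (le_viewAt_add hp hq hqe.1 ht)
  exact ⟨e, hmin p hp e h2, h1, h2⟩

theorem Micro.oprop_eq (hp : p ∈ E.correct) {t t' v : ℕ} {s : LocalState P}
    (h : E.Micro p t s) (hv : v ≤ s.view) (htt : t ≤ t') :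
    (E.state p t').oprop v = s.oprop v := by
  have key : ∀ {S₀ : P.Inbox} {s s' : LocalState P}, ReflTransGen (K.Step p S₀) s s' →
      v ≤ s.view → s'.oprop v = s.oprop v := by
    intro S₀ s s' h hv
    induction h with
    | refl => rfl
    | tail h1 h2 ih =>
      rw [oprop_eq_of_step h2 (hv.trans (Setup.Step.ext_of_reflTransGen h1).view), ih]
  induction t', htt using Nat.le_induction with
  | base => exact key h.to_state hv
  | succ t' htt ih =>
    have hs := h.start_le.trans htt
    rw [← ih, key (chain hp (by omega : E.start p ≤ t' + 1)), init_succ hs]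
    · rfl
    · rw [init_succ hs]
      exact hv.trans (h.grows hp htt).view

theorem proposed_unique (hp : p ∈ E.correct) {b b' : Block} {o : Bool} {t t' : ℕ}
    {s s' : LocalState P} (h : E.Micro p t s) (h' : E.Micro p t' s') (hb : (b, o) ∈ s.proposed)
    (hb' : (b', o) ∈ s'.proposed) (hv : b.view = b'.view) : b = b' := by
  have hm := micro_state hp (h.start_le.trans (le_max_left t t'))
  exact (hm.regular hp).proposed_unique b b' o ((h.grows hp (le_max_left t t')).proposed hb)
    ((h'.grows hp (le_max_right t t')).proposed hb') hv

variable {v t : ℕ}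

/-- An optimistic proposal that has been replaced gets no stage-1 vote. -/
theorem eq_of_replaced (hv : P.Initial v) (hlead : P.lead v ∈ E.correct)
    (hfirst : E.FirstEntry v t) (ht : E.GST ≤ t) {b b' : Block} {τ : ℕ}
    (hτ : E.start (P.lead v) ≤ τ) (hb : (b, false) ∈ (E.state (P.lead v) τ).proposed)
    (hb' : (b', true) ∈ (E.state (P.lead v) τ).proposed) (hbv : b.view = v) (hbv' : b'.view = v)
    (hvote : E.HonestVote b) : b = b' := by
  by_contra hne
  set L := P.lead v with hL
  have hmτ := micro_state hlead hτ
  have hΔ := P.one_le_Δ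
  -- the slot in which the leader decides to replace its proposal
  have hsec : (E.state L τ).secondPropose (P.superview v) = true :=
    hbv' ▸ (hmτ.regular hlead).proposed_second b' hb'
  obtain ⟨-, t', htτ, s', hm', hsv, hT, ho, hnb, hsf⟩ := hmτ.secondPropose_spec hlead hv hsec
  obtain ⟨e, hte, -, he⟩ := hfirst.enters ht hlead
  have het : e + 2 * P.Δ = t' := hT ▸ hm'.add_T_eq hlead hsv he
  have hse : E.start L ≤ e := start_le_of_viewAt (hv.one_le.trans he.1)
  have hiv : (E.init L t').view = v := by
    refine le_antisymm (hsv ▸ hm'.ext_init.view) ?_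
    refine le_trans ?_ (grows_init hlead hse (by omega)).view
    rw [← viewAt_eq hse]
    exact he.1
  -- The absence of the parent is moved to the beginning of the slot, the one reference point for
  -- all states inside it.
  have hno : ¬ K.InBlocks (E.init L t').S s'.opar := fun h => hnb (h.mono hm'.ext_init.S)
  -- the parent of the optimistic proposal
  have hpar : ∀ {t₁ s₁}, E.Micro L t₁ s₁ → s₁.view = v → s₁.oprop v = true →
      (b, false) ∈ s₁.proposed → b.par = K.H (.block s₁.opar) ∧ s₁.opar.view + 1 = v := by
    intro t₁ s₁ h₁ hv₁ ho₁ hb₁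
    rcases (h₁.proposal_cases hlead hv rfl b false hb₁ hbv).2 with h | h
    · obtain ⟨-, h | h, -⟩ := h
      · exact absurd h (by simp)
      · rw [ho₁] at h
        exact absurd h (by simp)
    · exact h.2.2.2 hv₁.le
  have hflag : ∀ {t₁ s₁ b₁ o₁}, E.Micro L t₁ s₁ → s₁.secondPropose (P.superview v) = false →
      (b₁, o₁) ∈ s₁.proposed → b₁.view = v → o₁ = false := by
    intro t₁ s₁ b₁ o₁ h₁ hs₁ hb₁ hv₁
    cases o₁ with
    | false => rfl
    | true =>
      have := (h₁.regular hlead).proposed_second b₁ hb₁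
      rw [hv₁, hs₁] at this
      exact absurd this (by simp)
  -- Before the replacement every proposal for `v` carries the flag value `false`, and there is only
  -- one such block.
  have hbs' : (b, false) ∈ s'.proposed := by
    obtain ⟨b0, o0, hb0, hb0v⟩ := hm'.oprop_proposed hlead hv rfl hsv.ge ho
    obtain rfl := hflag hm' hsf hb0 hb0v
    rwa [proposed_unique hlead hmτ hm' hb hb0 (hbv.trans hb0v.symm)]
  obtain ⟨hpar', -⟩ := hpar hm' hsv ho hbs'
  -- the vote
  obtain ⟨j, hj, tv, q, hvote⟩ := hvote
  obtain ⟨-, s₁, c, π, hm₁, -, hs₁v, -, -, b₁, hb₁, -, hcase, -⟩ := vote1_origin hj hvote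
  have hs₁v : s₁.view = v := hs₁v.symm.trans hbv
  obtain rfl := K.block_injective (hb₁.trans hpar')
  rcases hcase with ⟨h, -⟩ | ⟨-, h⟩ | ⟨-, h, -⟩
  · exact h (hs₁v ▸ hv)
  -- The voter knew the parent when it entered, by `t + Δ`; so the leader knows it by `t + 2Δ ≤ e +
  -- 2Δ`.
  · obtain ⟨e₁, -, hse₁, he₁, hin⟩ := hm₁.timer hj
    obtain ⟨e₂, -, h2, he₂⟩ := hfirst.enters ht hj
    rw [hs₁v] at he₁
    obtain rfl := he₁.unique he₂
    exact hno ((micro_state hj hse₁).inBlocks_init hlead hj (hin _ h).1 (by omega) (by omega))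
  · rw [hs₁v] at h
    obtain ⟨t₀, -, hrel⟩ := hm₁.sent_of_mem hj _ h
    obtain ⟨s₂, s₂', hm₂, hm₂', hs₂v, hcase⟩ := release_origin hlead hrel
    have hs₂v : s₂.view = v := hs₂v.symm.trans hbv
    rw [hs₂v] at hcase
    have hnt : ∀ {t₁ s₁}, E.Micro L t₁ s₁ → (b, true) ∉ s₁.proposed := fun h₁ hbt =>
      hne (proposed_unique hlead h₁ hmτ hbt hb' (hbv.trans hbv'.symm))
    rcases hcase with ⟨ho₂, hT₂, hin₂, o₂, hb₂⟩ | ⟨hnp, hb₂⟩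
    · cases o₂ with
      | true => exact hnt hm₂ hb₂
      | false =>
        obtain ⟨hpar₂, hlt⟩ := hpar hm₂ hs₂v ho₂ hb₂
        have hop := K.block_injective (hpar₂.symm.trans hpar')
        have het₂ : e + 2 * P.Δ = t₀ := hT₂ ▸ hm₂.add_T_eq hlead hs₂v he
        obtain rfl : t₀ = t' := het₂.symm.trans het
        -- Release and replacement would fall into the same slot. The parent is of a view below `v`,
        -- so messages the leader sends itself in that slot cannot account for the difference.
        exact hno (hop ▸ hm₂.inBlocks_init_of_lt hlead hiv hs₂v hin₂ (by omega))
    · cases hsec₂ : s₂.secondPropose (P.superview v) with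
      | true => exact hnt hm₂' (hsec₂ ▸ hb₂)
      | false =>
        -- Remaining case: `b` released as a fresh proposal under the value `false`. As `oprop(v)`
        -- is frozen from the entry into `v`, the optimistic proposal already existed and was
        -- recent.
        have ho₂ : s₂.oprop v = true := by
          rw [← hm₂.oprop_eq hlead hs₂v.ge (le_max_left t₀ t'),
            hm'.oprop_eq hlead hsv.ge (le_max_right t₀ t'), ho]
        obtain ⟨b0, o0, hb0, hb0v⟩ := hm₂.oprop_proposed hlead hv rfl hs₂v.ge ho₂
        obtain rfl := hflag hm₂ hsec₂ hb0 hb0v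
        refine hnp ⟨v, b0, ?_, hb0v, ?_⟩
        · rw [LocalState.secondNow, hs₂v, hv.superview_succ, hsec₂]
          exact hb0
        · rw [hs₂v, hv.superview_succ]

/-- Correct processors send stage-1 votes for at most one block of view `v`. -/
theorem HonestVote.unique (hv : P.Initial v) (hlead : P.lead v ∈ E.correct)
    (hfirst : E.FirstEntry v t) (ht : E.GST ≤ t) {b b' : Block} (hb : E.HonestVote b)
    (hb' : E.HonestVote b') (hbv : b.view = v) (hbv' : b'.view = v) : b = b' := by
  obtain ⟨t₁, h1, o, hp⟩ := hb.proposed (hbv.symm ▸ hlead)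
  obtain ⟨t₂, h2, o', hp'⟩ := hb'.proposed (hbv'.symm ▸ hlead)
  rw [hbv] at h1 hp
  rw [hbv'] at h2 hp'
  replace hp := (grows_state hlead h1 (le_max_left t₁ t₂)).proposed hp
  replace hp' := (grows_state hlead h2 (le_max_right t₁ t₂)).proposed hp'
  have h3 := h1.trans (le_max_left t₁ t₂)
  cases o <;> cases o'
  · exact ((micro_state hlead h3).regular hlead).proposed_unique b b' _ hp hp' (by rw [hbv, hbv'])
  · exact eq_of_replaced hv hlead hfirst ht h3 hp hp' hbv hbv' hb
  · exact (eq_of_replaced hv hlead hfirst ht h3 hp' hp hbv' hbv hb').symm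
  · exact ((micro_state hlead h3).regular hlead).proposed_unique b b' _ hp hp' (by rw [hbv, hbv'])

end Execution

namespace Execution

variable {P : Params} {K : Setup P} {E : Execution K} {p : P.Proc} {v t τ : ℕ}

/-! ### Progress in an initial view with a correct leader -/

variable (E) in
/-- No correct processor sends a `nullify(v)` message before timeslot `τ`. -/
def NoNullifyBefore (v τ : ℕ) : Prop :=
  ∀ i ∈ E.correct, ∀ t < τ, ∀ q, Msg.nullify v i ∉ E.sent i t q

theorem NoNullifyBefore.not_hasN (h : E.NoNullifyBefore v τ) (hp : p ∈ E.correct)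
    {s : LocalState P} (hm : E.Micro p t s) (ht : t < τ) : ¬ P.HasN s.S v := by
  intro hN
  obtain ⟨i, hi, t', h1, q, h2⟩ := hm.hasN_origin hp hN
  exact h i hi t' (by omega) q h2

/-- If a processor leaves view `v` without a nullification, the others get a view `v` block. -/
theorem NoNullifyBefore.inBlocks (h : E.NoNullifyBefore v τ) (hp : p ∈ E.correct)
    {q : P.Proc} (hq : q ∈ E.correct) (hv : 1 ≤ v) (hs : E.start q ≤ t)
    (hleft : v < (E.state q t).view) (hG : E.GST + P.Δ ≤ τ) (htτ : t + P.Δ ≤ τ) :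
    ∃ b, K.InBlocks (E.init p τ).S b ∧ b.view = v := by
  have hm := micro_state hq hs
  have hΔ := P.one_le_Δ
  rcases hm.left_view hq v hv hleft with hN | ⟨⟨b, hb, hbv⟩, -⟩
  · exact absurd hN (h.not_hasN hq hm (by omega))
  · exact ⟨b, hm.inBlocks_init hp hq hb hG htτ, hbv⟩

/-- Proposed blocks are well formed, and so are the fragments that are sent. -/
theorem Micro.proposed_frag (hp : p ∈ E.correct) {s : LocalState P} (hm : E.Micro p t s)
    {b : Block} {o : Bool} (hb : (b, o) ∈ s.proposed) : P.IsBlock b ∧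
      ∃ t₀ ≤ t, ∀ q, ∃ c π, Msg.frag b q c π ∈ E.sent p t₀ q ∧ K.Certified b.tag q c π := by
  obtain ⟨C, S, htag, t₀, h1, h2⟩ := hm.proposed_spec hp b o hb
  have hk1 := K.g_lower S b.view
  have hk2 := K.g_upper S b.view
  have hk3 := P.one_le_k
  refine ⟨⟨(hm.regular hp).one_le_proposed b o hb, by rw [htag]; exact hk1,
    by rw [htag]; exact hk2⟩, t₀, h1, fun q => ⟨_, _, h2 q, ?_⟩⟩
  rw [htag]
  exact K.certified_encode C _ (by omega) (by omega) q

theorem entered (hv : 1 ≤ v) {e : ℕ} (he : E.Enters p v e) (hp : p ∈ E.correct) (h : e ≤ τ) :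
    E.start p ≤ τ ∧ v ≤ (E.state p τ).view := by
  have h1 := he.1.trans (viewAt_mono hp h)
  have h2 := start_le_of_viewAt (hv.trans h1)
  exact ⟨h2, viewAt_eq h2 ▸ h1⟩

/-- The leader is in `v` by `t + Δ`. If it is still there at the end of its entry slot, it has
proposed, and fragments take at most another `Δ`. -/
theorem fragment_by (hv : P.Initial v) (hlead : P.lead v ∈ E.correct)
    (hfirst : E.FirstEntry v t) (ht : E.GST ≤ t) (hp : p ∈ E.correct) (hτ : t + 2 * P.Δ ≤ τ)
    (hno : E.NoNullifyBefore v τ) :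
    (∃ b, K.InBlocks (E.init p τ).S b ∧ b.view = v) ∨
      ∃ b j c π, P.IsBlock b ∧ b.view = v ∧ P.Received (E.init p τ).S (.frag b j c π) ∧
        K.Certified b.tag j c π := by
  obtain ⟨e, -, h2, he⟩ := hfirst.enters ht hlead
  obtain ⟨hs, hview⟩ := entered hv.one_le he hlead h2
  rcases hview.lt_or_eq with hlt | heq
  · exact .inl (hno.inBlocks hp hlead hv.one_le hs hlt (by omega) (by omega))
  · have hm := micro_state hlead hs
    obtain ⟨b, hb, hbv⟩ := (quiescent hlead hs).proposed (hm.regular hlead) (heq ▸ hv) (heq ▸ rfl)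
    obtain ⟨hbl, t₀, h3, h4⟩ := hm.proposed_frag hlead hb
    obtain ⟨c, π, h5, h6⟩ := h4 p
    exact .inr ⟨b, p, c, π, hbl, hbv.trans heq.symm,
      ⟨_, mem_init_of_sent hp hlead h5 (by omega) (by omega)⟩, h6⟩

/-- Taken `2Δ` after the leader's entry, hence by `t + 3Δ`. The proposal under the current flag
value is either fresh, and was released when made, or optimistic with the flag still `false`, and
then the decision of this slot must have been to release it. The leader holds the parent and the
N-certificates in between, and all of this arrives within `Δ`. -/
theorem votable_by (hv : P.Initial v) (hlead : P.lead v ∈ E.correct)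
    (hfirst : E.FirstEntry v t) (ht : E.GST ≤ t) (hp : p ∈ E.correct) (hτ : t + 4 * P.Δ ≤ τ)
    (hno : E.NoNullifyBefore v τ) :
    (∃ b, K.InBlocks (E.init p τ).S b ∧ b.view = v) ∨ K.ReleasedVotable p (E.init p τ).S v := by
  obtain ⟨e, -, h2, he⟩ := hfirst.enters ht hlead
  have hΔ := P.one_le_Δ
  obtain ⟨hs, hview⟩ := entered hv.one_le he hlead (by omega : e ≤ e + 2 * P.Δ)
  rcases hview.lt_or_eq with hlt | heq
  · exact .inl (hno.inBlocks hp hlead hv.one_le hs hlt (by omega) (by omega))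
  right
  have hm := micro_state hlead hs
  have hq := quiescent hlead hs
  have hT := hm.add_T_eq hlead heq.symm he
  obtain ⟨b, hb, hbv⟩ := hq.proposed (hm.regular hlead) (heq ▸ hv) (heq ▸ rfl)
  rw [← heq] at hb hbv
  obtain ⟨hbl, t₀, h3, h4⟩ := hm.proposed_frag hlead hb
  obtain ⟨c, π, h5, h6⟩ := h4 p
  have hrel : (∃ t₀ ≤ e + 2 * P.Δ, Msg.release b ∈ E.sent (P.lead v) t₀ p) ∧
      ∃ b', K.H (.block b') = b.par ∧ K.InBlocks (E.state (P.lead v) (e + 2 * P.Δ)).S b' ∧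
        b'.view < v ∧
        ∀ u, b'.view < u → u < v → P.HasN (E.state (P.lead v) (e + 2 * P.Δ)).S u := by
    rcases (hm.proposal_cases hlead hv rfl b _ hb hbv).2 with
      ⟨-, -, ⟨t₁, h7, h8⟩, b', h9, h10, h11, h12⟩ | ⟨h7, h8, -, h9⟩
    · exact ⟨⟨t₁, h7, h8 p⟩, b', h9, h10, h11, h12⟩
    · obtain ⟨hpar, hopv⟩ := h9 heq.ge
      rcases hq.release (heq ▸ hv) (heq ▸ rfl) (heq ▸ h8) (by omega) with ⟨h10, h11⟩ | h10
      · exact ⟨⟨_, le_rfl, hm.sent_of_out hlead (h11 b _ hb (hbv.trans heq) p)⟩, _, hpar.symm,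
          h10, by omega, fun u hu hu' => by omega⟩
      · rw [← heq, h7] at h10
        exact absurd h10 (by simp)
  obtain ⟨⟨t₁, h7, h8⟩, b', h9, h10, h11, h12⟩ := hrel
  exact ⟨b, c, π, hbl, hbv, ⟨_, mem_init_of_sent hp hlead h5 (by omega) (by omega)⟩, h6,
    mem_init_of_sent hp hlead h8 (by omega) (by omega), b', h9, h11,
    hm.inBlocks_init hp hlead h10 (by omega) (by omega),
    fun u hu hu' => hm.hasN_init hp hlead (h12 u hu hu') (by omega) (by omega)⟩

/-- If nobody has left `v` at `t + 4Δ`, all correct processors have cast stage-1 votes, necessarily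
for one block. These are enough for a notarisation, and the fragments sent with them are enough to
decode. -/
theorem blocksStar_by (hv : P.Initial v) (hlead : P.lead v ∈ E.correct)
    (hfirst : E.FirstEntry v t) (ht : E.GST ≤ t) (hp : p ∈ E.correct) (hτ : t + 5 * P.Δ ≤ τ)
    (hno : E.NoNullifyBefore v τ) :
    (∃ b, K.InBlocks (E.init p τ).S b ∧ b.view = v) ∨
      ∃ b, K.InBlocksStar (E.init p τ).S b ∧ b.view = v := by
  have hΔ := P.one_le_Δ
  by_cases hleft : ∃ q ∈ E.correct, E.start q ≤ t + 4 * P.Δ ∧ v < (E.state q (t + 4 * P.Δ)).view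
  · obtain ⟨q, hq, hs, hlt⟩ := hleft
    exact .inl (hno.inBlocks hp hq hv.one_le hs hlt (by omega) (by omega))
  right
  push Not at hleft
  have hno' : E.NoNullifyBefore v (t + 4 * P.Δ) := fun i hi t' ht' =>
    hno i hi t' (by omega)
  -- every correct processor has voted
  have hvoted : ∀ q ∈ E.correct, ∃ b c π, P.IsBlock b ∧ b.view = v ∧ K.Certified b.tag q c π ∧
      (∃ b', K.H (.block b') = b.par ∧ K.InBlocks (E.init p τ).S b') ∧
      P.Received (E.init p τ).S (.vote1 b q) ∧ E.HonestVote b ∧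
      (q ≠ P.lead v → (q, Msg.frag b q c π) ∈ (E.init p τ).S) := by
    intro q hq
    obtain ⟨e, -, h2, he⟩ := hfirst.enters ht hq
    obtain ⟨hs, hview⟩ := entered hv.one_le he hq (by omega : e ≤ t + 4 * P.Δ)
    have hview : (E.state q (t + 4 * P.Δ)).view = v := le_antisymm (hleft q hq hs) hview
    have hm := micro_state hq hs
    have hqu := quiescent hq hs
    have hsub := (micro_init hq hs).ext_state.S
    have hvot : K.ReleasedVotable q (E.init q (t + 4 * P.Δ)).S v := by
      refine (votable_by hv hlead hfirst ht hq le_rfl hno').resolve_left ?_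
      rintro ⟨b, hb, hbv⟩
      exact hqu.not_inBlocks ⟨b, hb.mono hsub, hbv.trans hview.symm⟩
    rw [← hview] at hvot
    obtain ⟨b, c, π, h1, h2, h3, ⟨b', h4, h5⟩, t₀, h6, h7, h8⟩ :=
      hm.voted1_spec hq _ (hqu.voted1 (hvot.hasVotable hsub (hview ▸ hv)))
    rw [hview] at h2 h8
    refine ⟨b, c, π, h1, h2, h3, ⟨b', h4, hm.inBlocks_init hp hq h5 (by omega) (by omega)⟩,
      ⟨q, mem_init_of_sent hp hq (h7 p) (by omega) (by omega)⟩, ⟨q, hq, t₀, p, h7 p⟩,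
      fun hne => ?_⟩
    -- The processor that withholds its fragment is the leader of `v + 1`, which is also the leader
    -- of `v`.
    rw [← Params.lead_congr hv.superview_succ] at hne
    exact mem_init_of_sent hp hq (h8 hne p) (by omega) (by omega)
  obtain ⟨b, -, -, hbl, hbv, -, hpar, -, hvote, -⟩ := hvoted _ hlead
  refine ⟨b, .inr ⟨hbl, ?_, ?_, hpar.imp fun _ h => ⟨h.2, h.1⟩⟩, hbv⟩
  · refine ⟨E.correct, ?_, fun q hq => ?_⟩
    · have := E.card_correct
      have := P.four_mul_f_lt
      omega
    · obtain ⟨b', -, -, -, hbv', -, -, h1, hvote', -⟩ := hvoted q hq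
      rwa [hvote.unique hv hlead hfirst ht hvote' hbv hbv']
  · have hfrag : ∀ q ∈ E.correct, ∃ c π, K.Certified b.tag q c π ∧
        (q ≠ P.lead v → (q, Msg.frag b q c π) ∈ (E.init p τ).S) := by
      intro q hq
      obtain ⟨b', c, π, -, hbv', h1, -, -, hvote', h2⟩ := hvoted q hq
      rw [hvote.unique hv hlead hfirst ht hvote' hbv hbv']
      exact ⟨c, π, h1, h2⟩
    choose! c π hcert hmem using hfrag
    obtain ⟨t', hs', o, hprop⟩ := hvote.proposed (hbv.symm ▸ hlead)
    rw [hbv] at hs' hprop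
    obtain ⟨C, S, htag, -⟩ := (micro_state hlead hs').proposed_spec hlead b o hprop
    rw [K.g_initial S b.view (hbv.symm ▸ hv)] at htag
    have hk : b.tag.k = P.n - P.f - 1 := by rw [htag]; rfl
    -- The leader withholds its fragment, so only `n - f - 1` correct senders are guaranteed. This
    -- is exactly the reconstruction parameter prescribed for initial views.
    have hcard : P.n - P.f - 1 ≤ (E.correct.erase (P.lead v)).card := by
      rw [Finset.card_erase_of_mem hlead]
      have := E.card_correct
      omega
    obtain ⟨I, hI, hIcard⟩ := Finset.exists_subset_card_eq hcard
    have hIc : ∀ j ∈ I, j ∈ E.correct ∧ j ≠ P.lead v := fun j hj =>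
      (Finset.mem_erase.1 (hI hj)).symm
    refine ⟨I, c, π, hIcard.trans hk.symm, fun j hj =>
      ⟨hmem j (hIc j hj).1 (hIc j hj).2, hcert j (hIc j hj).1⟩, ?_⟩
    rw [htag] at hcert ⊢
    exact K.decode_ne_none P.one_le_k (by omega) I hIcard c π fun j hj =>
      hcert j (hIc j hj).1

/-- No correct processor nullifies an initial view of a correct leader entered after `GST`. -/
theorem noNullify (hv : P.Initial v) (hlead : P.lead v ∈ E.correct)
    (hfirst : E.FirstEntry v t) (ht : E.GST ≤ t) (τ : ℕ) : E.NoNullifyBefore v τ := by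
  induction τ with
  | zero => exact fun _ _ t h => absurd h (Nat.not_lt_zero t)
  | succ τ ih =>
    intro p hp t' ht' q hsent
    rcases Nat.lt_succ_iff_lt_or_eq.1 ht' with hlt | rfl
    · exact ih p hp t' hlt q hsent
    obtain ⟨-, s, hm, hsv, hw, hT, hnb, hstar, hvot⟩ := nullify_origin hp hsent
    -- A time-out also nullifies later views of the superview, but `v` is the first one, so it can
    -- only be nullified from within.
    have hsv : s.view = v :=
      le_antisymm hsv (hv.le_of_superview_eq (hm.regular hp).one_le_view hw.symm)
    obtain ⟨e, hte, -, he⟩ := hfirst.enters ht hp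
    have heT := hm.add_T_eq hp hsv he
    have hsub := hm.ext_init.S
    have hnb' : ¬ ∃ b, K.InBlocks (E.init p t').S b ∧ b.view = v := fun ⟨b, hb, hbv⟩ =>
      hnb ⟨b, hb.mono hsub, hbv.trans hsv.symm⟩
    rw [Setup.TimeoutReady, hsv] at hT
    rw [hsv] at hstar hvot
    rcases hT with ⟨h, -⟩ | ⟨h, -⟩ | ⟨-, hT, hf⟩ | ⟨-, hT, h1, -⟩ | ⟨-, hT, h2⟩
    · exact h hv
    · exact h hv
    · obtain ⟨b, j, c, π, h1, h2, h3, h4⟩ :=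
        (fragment_by hv hlead hfirst ht hp (by omega) ih).resolve_left hnb'
      exact hf ⟨b, j, c, π, h1, h2, h3.mono hsub, h4⟩
    · have := hvot hv ((votable_by hv hlead hfirst ht hp (by omega) ih).resolve_left hnb')
      rw [h1] at this
      exact absurd this (by simp)
    · have := hstar ((blocksStar_by hv hlead hfirst ht hp (by omega) ih).resolve_left hnb')
      rw [h2] at this
      exact absurd this (by simp)

/-- `5Δ` after the first entry all correct processors have cast a stage-2 vote. -/
theorem vote2_by (hv : P.Initial v) (hlead : P.lead v ∈ E.correct)
    (hfirst : E.FirstEntry v t) (ht : E.GST ≤ t) (hp : p ∈ E.correct) :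
    ∃ b, P.IsBlock b ∧ b.view = v ∧ E.HonestVote b ∧
      (∃ b', K.H (.block b') = b.par ∧ ∀ q ∈ E.correct,
        K.InBlocks (E.init q (t + 6 * P.Δ)).S b') ∧
      ∀ q ∈ E.correct, (p, Msg.vote2 b p) ∈ (E.init q (t + 6 * P.Δ)).S := by
  obtain ⟨e, -, h2, he⟩ := hfirst.enters ht hp
  have hΔ := P.one_le_Δ
  obtain ⟨hs, hview⟩ := entered hv.one_le he hp (by omega : e ≤ t + 5 * P.Δ)
  have hm := micro_state hp hs
  have hqu := quiescent hp hs
  have hno := noNullify hv hlead hfirst ht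
  have hnn : (E.state p (t + 5 * P.Δ)).nullified v = false := by
    by_contra h
    obtain ⟨t', q, h⟩ := hm.nullified_spec hp v (by simpa using h)
    exact hno (t' + 1) p hp t' (by omega) q h
  have hvoted : (E.state p (t + 5 * P.Δ)).voted2 v = true := by
    -- A processor that has already left `v` did so through a block, hence after voting or
    -- nullifying, and the latter is excluded. One still in `v` has a block in `blocks*` and must
    -- have voted.
    rcases hview.lt_or_eq with hlt | heq
    · rcases hm.left_view hp v hv.one_le hlt with hN | ⟨-, h | h⟩
      · exact absurd hN ((hno (t + 5 * P.Δ + 1)).not_hasN hp hm (by omega))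
      · exact h
      · rw [hnn] at h
        exact absurd h (by simp)
    · have hsub := (micro_init hp hs).ext_state.S
      rcases blocksStar_by hv hlead hfirst ht hp le_rfl (hno _) with ⟨b, hb, hbv⟩ | ⟨b, hb, hbv⟩
      · exact absurd ⟨b, hb.mono hsub, hbv.trans heq⟩ hqu.not_inBlocks
      · have := hqu.voted2 ⟨b, hb.mono hsub, hbv.trans heq⟩ (heq ▸ hnn)
        rwa [← heq] at this
  obtain ⟨b, h1, h2, ⟨b', h3, h4⟩, t₀, h5, h6⟩ := hm.voted2_spec hp v hvoted
  exact ⟨b, h1, h2, honestVote_of_vote2 t₀ p hp p b (h6 p), ⟨b', h3, fun q hq =>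
    hm.inBlocks_init hq hp h4 (by omega) (by omega)⟩, fun q hq =>
    mem_init_of_sent hq hp (h6 q) (by omega) (by omega)⟩

end Execution

end Carnot

/-! ### Conclusion: collecting the stage-2 votes -/

theorem mainTheorem5 (P : Carnot.Params) (K : Carnot.Setup P) (E : Carnot.Execution K)
    (v t : ℕ) (hv : P.Initial v) (hlead : P.lead v ∈ E.correct)
    (hfirst : E.FirstEntry v t) (ht : E.GST ≤ t) :
    (∃ b : Carnot.Block, P.IsBlock b ∧ b.view = v ∧
      ∀ p ∈ E.correct, E.HasCertBy p (t + 6 * P.Δ) b) ∧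
    (∀ p ∈ E.correct, ∃ t' ≤ t + 6 * P.Δ, E.Enters p (v + 1) t') ∧
    (∀ p ∈ E.correct, ¬ E.SendsNullify p v) := by
  open Carnot Execution in
  obtain ⟨b, hbl, hbv, hb, ⟨b', hpar, hb'⟩, -⟩ := vote2_by hv hlead hfirst ht hlead
  have hvotes : ∀ p ∈ E.correct, ∀ q ∈ E.correct,
      (p, Msg.vote2 b p) ∈ (E.init q (t + 6 * P.Δ)).S := by
    intro p hp
    obtain ⟨b₁, -, hbv₁, hb₁, -, h⟩ := vote2_by hv hlead hfirst ht hp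
    rwa [hb.unique hv hlead hfirst ht hb₁ hbv hbv₁]
  have hquorum : ∀ k ≤ P.n - P.f, ∀ q ∈ E.correct, ∃ Q : Finset P.Proc, Q.card = k ∧
      ∀ i ∈ Q, P.Received (E.init q (t + 6 * P.Δ)).S (.vote2 b i) := by
    intro k hk q hq
    obtain ⟨Q, hQ, hcard⟩ := Finset.exists_subset_card_eq (hk.trans E.card_correct)
    exact ⟨Q, hcard, fun i hi => ⟨i, hvotes i (hQ hi) q hq⟩⟩
  have hstart : ∀ p ∈ E.correct, E.start p ≤ t + 6 * P.Δ := fun p hp =>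
    (E.start_le p hp).trans (by omega)
  refine ⟨⟨b, hbl, hbv, fun p hp => ⟨hstart p hp, ?_⟩⟩, fun p hp => ?_, fun p hp => ?_⟩
  · obtain ⟨Q, hcard, hQ⟩ := hquorum _ le_rfl p hp
    exact .inr ⟨Q, hcard, fun i hi =>
      (hQ i hi).mono (micro_init hp (hstart p hp)).ext_state.S⟩
  · obtain ⟨e, -, he, hent⟩ := hfirst.enters ht hp
    obtain ⟨hs, hview⟩ := entered hv.one_le hent hp (by omega : e ≤ t + 6 * P.Δ)
    refine exists_enters ?_
    rw [viewAt_eq hs]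
    -- Still being in `v` is impossible: the `n - f ≥ f + 1` votes form an M-certificate and the
    -- parent is in `blocks`, so the block is too, and the processor would advance.
    refine Nat.succ_le_of_lt (lt_of_le_of_ne hview fun heq => ?_)
    have hfn := P.four_mul_f_lt
    have hM : P.HasM (E.init p (t + 6 * P.Δ)).S b := .inr (hquorum _ (by omega) p hp)
    exact (quiescent hp hs).not_inBlocks
      ⟨b, (Setup.InBlocks.child b b' hbl hM (hb' p hp) hpar).mono
        (micro_init hp hs).ext_state.S, hbv.trans heq⟩
  · rintro ⟨t', q, h⟩
    exact noNullify hv hlead hfirst ht (t' + 1) p hp t' (by omega) q h
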